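/- Let $d\ge 1$, $0<s<1$, $p>1$, $a:=1-2s$, $0<T<T_M$, and write $X=(x_0,x)\in\mathbb{R}^{d+1}_+=(0,\infty)\times\mathbb{R}^d$; $\nabla$ is the gradient in $X$. **Equation.** Let $u:\mathbb{R}^d\times(0,\infty)\to\mathbb{R}$ be a backward solution of $(\partial_t-\Delta)^su=|u|^{p-1}u$ on $(0,T_M)$, i.e. for all $(x,t)\in\mathbb{R}^d\times(0,T_M)$ $$\int_t^\infty\Big(\int_{\mathbb{R}^d}(u(x,t)-u(z,\tau))K_s(x-z,\tau-t)\,dz\Big)d\tau=|u|^{p-1}u(x,t),\qquad K_s(z,\tau)=\frac{1}{(4\pi)^{d/2}|\Gamma(-s)|}\frac{e^{-|z|^2/4\tau}}{\tau^{d/2+1+s}},$$ the outer integral being absolutely convergent. Assume $u\in\mathcal{B}((0,T])$: $u$ is bounded on $\mathbb{R}^d\times(0,\infty)$, there are $\varepsilon>0$ and $C$ with $|u(x,t)-u(z,r)|\le C(|x-z|+|t-r|)^{s+\varepsilon/2}$ for all $(x,t),(z,r)\in\mathbb{R}^d\times(0,\infty)$, and $u\in C((0,T];L^{p+1}(\mathbb{R}^d))$.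 **Extension.** Let $U:\mathbb{R}^{d+1}_+\times(0,T_M)\to\mathbb{R}$ be the backward extension of $u$, $$U(x_0,x,t)=\int_0^\infty\int_{\mathbb{R}^d}P^s_{x_0}(z,\tau)\,u(x-z,t+\tau)\,dz\,d\tau,\qquad P^s_{x_0}(z,\tau)=\frac{1}{4^{d/2+s}\pi^{d/2}\Gamma(s)}\frac{x_0^{2s}}{\tau^{d/2+1+s}}e^{-(x_0^2+|z|^2)/4\tau}.$$ Assume $U\in\mathcal{C}((0,T])$, that is: - $U\in C^2(\mathbb{R}^{d+1}_+\times(0,T])$, and $U$ and $x_0^a\partial_{x_0}U$ extend continuously to $\overline{\mathbb{R}^{d+1}_+}\times(0,T]$; - $x_0^a\partial_tU$ is bounded on $(0,\delta)\times\mathbb{R}^d\times(0,T]$ for some $\delta>0$; - $x_0^a|\nabla U|^2$, $x_0^aU^2$ and $x_0^a\big(X\cdot\nabla U+2t\,\partial_tU+\tfrac{2s}{p-1}U\big)^2$ belong to $C((0,T];L^1(\mathbb{R}^{d+1}_+))$; - $\sup_{t\in(0,T]}\int_{\mathbb{R}^{d+1}_+}|f|\,x_0^ae^{-|X|^2/4t}\,dX<\infty$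 for each of the functions $f=|\nabla U|^2$, $f=(X\cdot\nabla U)\,\partial_tU+t(\partial_tU)^2$ and $f=\big(\tfrac{2s}{p-1}U+X\cdot\nabla U+2t\,\partial_tU\big)H$, where $H=2\big(X\cdot\nabla\partial_tU+t\,\partial_t^2U\big)+a\,\partial_tU$. **Energy.** Let $$\mathcal{G}(X,t)=\frac{1}{(4\pi)^{d/2}\Gamma(s)}\frac{e^{-|X|^2/4t}}{t^{d/2+1-s}},\quad \mathcal{G}_s(X,t)=t^{\frac{2s}{p-1}+1}\mathcal{G}(X,t),\quad \tilde{\mathcal{G}}_s(x,t)=\mathcal{G}_s((0,x),t),\quad \eta_s=\frac{2s|\Gamma(-s)|}{4^s\Gamma(s)},$$ and for $t\in(0,T)$ $$\mathcal{J}(t)=\int_{\mathbb{R}^{d+1}_+}x_0^{1-2s}\frac{|\nabla U|^2}{2}\mathcal{G}_s\,dX-\frac{\eta_s}{p+1}\int_{\mathbb{R}^d}|u|^{p+1}\tilde{\mathcal{G}}_s\,dx+\frac{s}{p-1}\int_{\mathbb{R}^{d+1}_+}x_0^{1-2s}\frac{U^2}{2t}\mathcal{G}_s\,dX .$$ **Conclusion.**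 For every $t\in(0,T)$ the three integrals in $\mathcal{J}(t)$ and the integral below converge absolutely; $\mathcal{J}$ is non-decreasing on $(0,T)$; and $\mathcal{J}$ is differentiable on $(0,T)$ with $$\frac{d}{dt}\mathcal{J}(t)=\int_{\mathbb{R}^{d+1}_+}x_0^{1-2s}\Big(\partial_tU+\frac{X}{2t}\cdot\nabla U+\frac{2s}{p-1}\frac{U}{2t}\Big)^2\mathcal{G}_s\,dX .$$ -/

import Mathlib

open Set Filter Topology MeasureTheory
open scoped ENNReal NNReal

namespace FracHeat

noncomputable section

/-- The Euclidean space `ℝ^d`. -/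
abbrev Rd (d : ℕ) := EuclideanSpace ℝ (Fin d)

/-- The open half-space `ℝ^{d+1}_+`; its points are `X = (x₀, x)` with `x₀ > 0`. The measure on
`ℝ × ℝ^d` is the product of the Lebesgue measures. -/
def halfSpace (d : ℕ) : Set (ℝ × Rd d) := {X | 0 < X.1}

/-- The closed half-space. -/
def closedHalfSpace (d : ℕ) : Set (ℝ × Rd d) := {X | 0 ≤ X.1}

/-- `|X|² = x₀² + |x|²` (the norm Mathlib puts on the product is not the Euclidean one). -/
def sqNorm {d : ℕ} (X : ℝ × Rd d) : ℝ := X.1 ^ 2 + ‖X.2‖ ^ 2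

/-! ### Kernels and constants -/

/-- The kernel `K_s(z, τ) = (4π)^{-d/2} |Γ(-s)|⁻¹ e^{-|z|²/4τ} / τ^{d/2+1+s}`, for `τ > 0`. -/
def kernelK (d : ℕ) (s : ℝ) (z : Rd d) (τ : ℝ) : ℝ :=
  1 / ((4 * Real.pi) ^ ((d : ℝ) / 2) * |Real.Gamma (-s)|) *
    (Real.exp (-‖z‖ ^ 2 / (4 * τ)) / τ ^ ((d : ℝ) / 2 + 1 + s))

/-- The fractional Poisson kernel `P^s_{x₀}(z, τ)`, for `x₀, τ > 0`. -/
def poissonKernel (d : ℕ) (s x₀ : ℝ) (z : Rd d) (τ : ℝ) : ℝ :=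
  1 / ((4 : ℝ) ^ ((d : ℝ) / 2 + s) * Real.pi ^ ((d : ℝ) / 2) * Real.Gamma s) *
    (x₀ ^ (2 * s) / τ ^ ((d : ℝ) / 2 + 1 + s)) * Real.exp (-(x₀ ^ 2 + ‖z‖ ^ 2) / (4 * τ))

/-- The fundamental solution `𝒢(X, t)` of the extension problem, for `t > 0`. -/
def fundSol (d : ℕ) (s : ℝ) (X : ℝ × Rd d) (t : ℝ) : ℝ :=
  1 / ((4 * Real.pi) ^ ((d : ℝ) / 2) * Real.Gamma s) *
    (Real.exp (-sqNorm X / (4 * t)) / t ^ ((d : ℝ) / 2 + 1 - s))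

/-- `𝒢_s(X, t) = t^{2s/(p-1)+1} 𝒢(X, t)`. -/
def scaledG (d : ℕ) (s p : ℝ) (X : ℝ × Rd d) (t : ℝ) : ℝ :=
  t ^ (2 * s / (p - 1) + 1) * fundSol d s X t

/-- `𝒢̃_s(x, t) = t^{2s/(p-1)+1} 𝒢((0, x), t)`. -/
def scaledGBdry (d : ℕ) (s p : ℝ) (x : Rd d) (t : ℝ) : ℝ :=
  t ^ (2 * s / (p - 1) + 1) * fundSol d s (0, x) t

/-- `η_s = 2 s |Γ(-s)| / (4^s Γ(s))`. -/
def etaConst (s : ℝ) : ℝ :=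
  2 * s * |Real.Gamma (-s)| / ((4 : ℝ) ^ s * Real.Gamma s)

/-! ### The backward fractional heat operator and the backward extension -/

/-- The inner (space) integral of the backward fractional heat operator at time `τ > t`. -/
def backwardInner {d : ℕ} (s : ℝ) (u : Rd d → ℝ → ℝ) (x : Rd d) (t τ : ℝ) : ℝ :=
  ∫ z, (u x t - u z τ) * kernelK d s (x - z) (τ - t)

/-- `(-∂_t - Δ)^s u (x, t) = ∫_t^∞ ∫_{ℝ^d} (u(x,t) - u(z,τ)) K_s(x - z, τ - t) dz dτ`. -/
def backwardFracHeat {d : ℕ} (s : ℝ) (u : Rd d → ℝ → ℝ) (x : Rd d) (t : ℝ) : ℝ :=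
  ∫ τ in Ioi t, backwardInner s u x t τ

/-- `u` solves `(-∂_t - Δ)^s u = |u|^{p-1} u` in `ℝ^d × (0, T_M)`; the (iterated) integral that
defines the operator is required to converge. -/
def IsBackwardSolution {d : ℕ} (s p TM : ℝ) (u : Rd d → ℝ → ℝ) : Prop :=
  ∀ x : Rd d, ∀ t ∈ Ioo 0 TM,
    IntegrableOn (fun τ => backwardInner s u x t τ) (Ioi t) ∧
      backwardFracHeat s u x t = |u x t| ^ (p - 1) * u x t

/-- The backward extension
`U(x₀, x, t) = ∫_0^∞ ∫_{ℝ^d} P^s_{x₀}(z, τ) u(x - z, t + τ) dz dτ`, for `x₀ > 0` and `t > 0`. -/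
def backwardExtension {d : ℕ} (s : ℝ) (u : Rd d → ℝ → ℝ) (X : ℝ × Rd d) (t : ℝ) : ℝ :=
  ∫ τ in Ioi (0 : ℝ), ∫ z, poissonKernel d s X.1 z τ * u (X.2 - z) (t + τ)

/-! ### Derivatives of functions `U(X, t)` -/

/-- `∂_t U`. -/
def dT {d : ℕ} (U : ℝ × Rd d → ℝ → ℝ) (X : ℝ × Rd d) (t : ℝ) : ℝ :=
  deriv (fun τ => U X τ) t

/-- `∂_{x₀} U`. -/
def dX0 {d : ℕ} (U : ℝ × Rd d → ℝ → ℝ) (X : ℝ × Rd d) (t : ℝ) : ℝ :=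
  deriv (fun r => U (r, X.2) t) X.1

/-- `∇_x U`. -/
def gradx {d : ℕ} (U : ℝ × Rd d → ℝ → ℝ) (X : ℝ × Rd d) (t : ℝ) : Rd d :=
  gradient (fun x => U (X.1, x) t) X.2

/-- `|∇U|²`, the gradient being taken in `X = (x₀, x)`. -/
def sqGrad {d : ℕ} (U : ℝ × Rd d → ℝ → ℝ) (X : ℝ × Rd d) (t : ℝ) : ℝ :=
  dX0 U X t ^ 2 + ‖gradx U X t‖ ^ 2

/-- `X · ∇U`. -/
def euler {d : ℕ} (U : ℝ × Rd d → ℝ → ℝ) (X : ℝ × Rd d) (t : ℝ) : ℝ :=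
  X.1 * dX0 U X t + inner ℝ X.2 (gradx U X t)

/-- `H = 2 (X, t) · ∇_{(X,t)} ∂_t U + a ∂_t U` with `a = 1 - 2s`. -/
def sourceH {d : ℕ} (s : ℝ) (U : ℝ × Rd d → ℝ → ℝ) (X : ℝ × Rd d) (t : ℝ) : ℝ :=
  2 * (euler (dT U) X t + t * dT (dT U) X t) + (1 - 2 * s) * dT U X t

/-- `X · ∇U + 2t ∂_t U + (2s/(p-1)) U`. -/
def scalingField {d : ℕ} (s p : ℝ) (U : ℝ × Rd d → ℝ → ℝ) (X : ℝ × Rd d) (t : ℝ) : ℝ :=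
  euler U X t + 2 * t * dT U X t + 2 * s / (p - 1) * U X t

/-! ### Function classes -/

/-- `t ↦ f(·, t)` belongs to `C(S; L^q(μ))`. -/
def ContinuousInLp {α : Type*} [MeasurableSpace α] (f : α → ℝ → ℝ) (q : ℝ≥0∞) (μ : Measure α)
    (S : Set ℝ) : Prop :=
  (∀ t ∈ S, MemLp (fun y => f y t) q μ) ∧
    ∀ t₀ ∈ S, Tendsto (fun t => eLpNorm (fun y => f y t - f y t₀) q μ) (𝓝[S] t₀) (𝓝 0)

/-- `f`, given on `ℝ^{d+1}_+ × (0, T]`, belongs to `C(closure(ℝ^{d+1}_+) × (0, T])`, that is, it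
extends continuously up to `x₀ = 0`. -/
def ContinuousUpToBoundary {d : ℕ} (f : ℝ × Rd d → ℝ → ℝ) (T : ℝ) : Prop :=
  ∃ g : (ℝ × Rd d) × ℝ → ℝ, ContinuousOn g (closedHalfSpace d ×ˢ Ioc 0 T) ∧
    ∀ X ∈ halfSpace d, ∀ t ∈ Ioc 0 T, g (X, t) = f X t

/-- The class `𝓑((0, T])`. -/
structure ClassB {d : ℕ} (s p T : ℝ) (u : Rd d → ℝ → ℝ) : Prop where
  bounded : ∃ C : ℝ, ∀ x : Rd d, ∀ t : ℝ, 0 < t → |u x t| ≤ C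
  holder : ∃ ε > 0, ∃ C : ℝ, ∀ x z : Rd d, ∀ t r : ℝ, 0 < t → 0 < r →
    |u x t - u z r| ≤ C * (‖x - z‖ + |t - r|) ^ (s + ε / 2)
  continuous_Lp : ContinuousInLp u (ENNReal.ofReal (p + 1)) volume (Ioc 0 T)

/-- `sup_{t ∈ (0,T]} ∫_{ℝ^{d+1}_+} |f(X,t)| x₀^a e^{-|X|²/4t} dX < ∞`, with `a = 1 - 2s`. -/
def GaussianBounded {d : ℕ} (s T : ℝ) (f : ℝ × Rd d → ℝ → ℝ) : Prop :=
  ∃ C : ℝ≥0, ∀ t ∈ Ioc 0 T,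
    ∫⁻ X in halfSpace d,
      ENNReal.ofReal (|f X t| * X.1 ^ (1 - 2 * s) * Real.exp (-sqNorm X / (4 * t))) ≤ C

/-- The class `𝓒((0, T])`, for functions `U` on `ℝ^{d+1}_+ × (0, T_M)` with `T < T_M`; throughout
`a = 1 - 2s`. -/
structure ClassC {d : ℕ} (s p T : ℝ) (U : ℝ × Rd d → ℝ → ℝ) : Prop where
  contDiff : ContDiffOn ℝ 2 (fun q : (ℝ × Rd d) × ℝ => U q.1 q.2) (halfSpace d ×ˢ Ioc 0 T)
  continuous : ContinuousUpToBoundary U T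
  dT_bounded : ∃ δ > 0, ∃ C : ℝ, ∀ X : ℝ × Rd d, 0 < X.1 → X.1 < δ → ∀ t ∈ Ioc 0 T,
    |X.1 ^ (1 - 2 * s) * dT U X t| ≤ C
  flux_continuous : ContinuousUpToBoundary (fun X t => X.1 ^ (1 - 2 * s) * dX0 U X t) T
  grad_L1 : ContinuousInLp (fun X t => X.1 ^ (1 - 2 * s) * sqGrad U X t) 1
    (volume.restrict (halfSpace d)) (Ioc 0 T)
  sq_L1 : ContinuousInLp (fun X t => X.1 ^ (1 - 2 * s) * U X t ^ 2) 1
    (volume.restrict (halfSpace d)) (Ioc 0 T)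
  scaling_L1 : ContinuousInLp (fun X t => X.1 ^ (1 - 2 * s) * scalingField s p U X t ^ 2) 1
    (volume.restrict (halfSpace d)) (Ioc 0 T)
  grad_growth : GaussianBounded s T (sqGrad U)
  mixed_growth : GaussianBounded s T (fun X t => euler U X t * dT U X t + t * dT U X t ^ 2)
  source_growth : GaussianBounded s T (fun X t => scalingField s p U X t * sourceH s U X t)

/-! ### The energy -/

/-- The integrand `x₀^{1-2s} (|∇U|²/2) 𝒢_s` of the Dirichlet term. -/
def dirichletDensity {d : ℕ} (s p : ℝ) (U : ℝ × Rd d → ℝ → ℝ) (t : ℝ) (X : ℝ × Rd d) : ℝ :=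
  X.1 ^ (1 - 2 * s) * (sqGrad U X t / 2) * scaledG d s p X t

/-- The integrand `|u|^{p+1} 𝒢̃_s` of the boundary term. -/
def boundaryDensity {d : ℕ} (s p : ℝ) (u : Rd d → ℝ → ℝ) (t : ℝ) (x : Rd d) : ℝ :=
  |u x t| ^ (p + 1) * scaledGBdry d s p x t

/-- The integrand `x₀^{1-2s} (U²/(2t)) 𝒢_s` of the zeroth-order term. -/
def massDensity {d : ℕ} (s p : ℝ) (U : ℝ × Rd d → ℝ → ℝ) (t : ℝ) (X : ℝ × Rd d) : ℝ :=
  X.1 ^ (1 - 2 * s) * (U X t ^ 2 / (2 * t)) * scaledG d s p X t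

/-- The integrand `x₀^{1-2s} (∂_t U + X·∇U/(2t) + (2s/(p-1)) U/(2t))² 𝒢_s` of the derivative. -/
def dissipationDensity {d : ℕ} (s p : ℝ) (U : ℝ × Rd d → ℝ → ℝ) (t : ℝ) (X : ℝ × Rd d) : ℝ :=
  X.1 ^ (1 - 2 * s) *
    (dT U X t + euler U X t / (2 * t) + 2 * s / (p - 1) * (U X t / (2 * t))) ^ 2 *
      scaledG d s p X t

/-- The weighted energy `𝒥(t)`. -/
def energyJ {d : ℕ} (s p : ℝ) (u : Rd d → ℝ → ℝ) (U : ℝ × Rd d → ℝ → ℝ) (t : ℝ) : ℝ :=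
  (∫ X in halfSpace d, dirichletDensity s p U t X)
    - etaConst s / (p + 1) * (∫ x, boundaryDensity s p u t x)
    + s / (p - 1) * (∫ X in halfSpace d, massDensity s p U t X)

end

end FracHeat

/-! Put `κ = s/(p-1)` and pass to self-similar variables: `w(Y,t) = t^κ U(√t Y, t)`, with trace `v`
on `y₀ = 0`. The powers of `t` in `𝒢_s` are exactly those that freeze the weight. Up to a positive
constant, `𝒥(t)` equals `E = ½ B(w,w) - η/(p+1) ∫ e^{-|y|²/4} |v|^{p+1}`, where `B(f,g) = ∫ y₀^a
e^{-|Y|²/4} (∇f·∇g + κ f g)` (`energyJ_eq`). The equation becomes `B(w,φ) = t ⟨∂ₜw, φ⟩ + η ∫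
e^{-|y|²/4} |v|^{p-1} v φ` for bounded `φ` of finite energy (`RescaledFlow.dirichletForm_eq`). So `t
∂ₜw` is the gradient of `E` in the weighted `L²`, and formally `E' = t ‖∂ₜw‖²`, which is the stated
dissipation after scaling back.

The computation is only formal, since `∂ₜw` is not known to have finite energy and cannot be used as
`φ`. `hasDerivAt_energy` works with increments instead: the weak form at the times `t` and `t₀` is
tested with `w(t)` and `w(t₀)` only. With `Z = w(t) - w(t₀)`, the increment of `E` is the mean of
`⟨t ∂ₜw(t), Z⟩` and `⟨t₀ ∂ₜw(t₀), Z⟩`, up to the trapezoidal error of the nonlinearity, which is at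
most a constant times `∫ e^{-|y|²/4} (v(t) - v(t₀))²`. A trace inequality (`trace_halfSpace`) bounds
this by `δ B(Z,Z) + A ‖Z‖²` with `δ` as small as desired. In turn `B(Z,Z)` equals `⟨t ∂ₜw(t) - t₀
∂ₜw(t₀), Z⟩` plus a term of the same boundary type, so for small `δ` it can be absorbed, and the
error is `o(t - t₀)`.

This needs `t ↦ w(t)` to be differentiable in the weighted `L²` with continuous derivative.
Pointwise that is clear from smoothness; the norm of `∂ₜw` is continuous by the `L¹` continuity of
the squared scaling field, and `tendsto_L2of` and `hasDerivAt_L2of` upgrade both facts to `L²`.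

It remains to derive the boundary value problem from the definition of `U`. The equation in the
interior follows by differentiating the kernel under the integral (`heatPotential_pde`,
`extension_pde`). At the boundary, `(U - u)/x₀^{2s}` tends to a multiple of the fractional operator
(`tendsto_backwardExtension_sub_div`), and L'Hôpital's rule turns this into the value of the flux
(`flux_eq_of_tendsto`). Integration by parts with two cutoffs gives the weak form (`weak_form`). -/

namespace FracHeat

variable {d : ℕ}

/-! ### Gaussian and gamma integrals; the Poisson kernel in terms of `K_s` -/

section Kernel

lemma integrable_gaussian {b : ℝ} (hb : 0 < b) :
    Integrable (fun z : Rd d => Real.exp (-b * ‖z‖ ^ 2)) := by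
  have h := GaussianFourier.integrable_cexp_neg_mul_sq_norm_add (V := Rd d) (b := (b : ℂ))
    (by simpa using hb) 0 0
  refine h.re.congr (Eventually.of_forall fun z => ?_)
  have : (-(b : ℂ) * (‖z‖ : ℂ) ^ 2 + 0 * (inner ℝ (0 : Rd d) z : ℂ)) = ((-b * ‖z‖ ^ 2 : ℝ) : ℂ) := by
    push_cast; ring
  simp only [this]
  rw [← Complex.ofReal_exp]
  exact Complex.ofReal_re _

lemma integral_gaussian {b : ℝ} (hb : 0 < b) :
    ∫ z : Rd d, Real.exp (-b * ‖z‖ ^ 2) = (Real.pi / b) ^ ((d : ℝ) / 2) := by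
  have h := GaussianFourier.integral_rexp_neg_mul_sq_norm (V := Rd d) hb
  simpa using h

lemma kernelK_nonneg (s : ℝ) (z : Rd d) {τ : ℝ} (hτ : 0 < τ) : 0 ≤ kernelK d s z τ := by
  unfold kernelK
  have := Real.rpow_nonneg hτ.le ((d : ℝ) / 2 + 1 + s)
  positivity

lemma kernelK_eq (s : ℝ) (z : Rd d) (τ : ℝ) : kernelK d s z τ =
    1 / ((4 * Real.pi) ^ ((d : ℝ) / 2) * |Real.Gamma (-s)|) / τ ^ ((d : ℝ) / 2 + 1 + s) *
      Real.exp (-(1 / (4 * τ)) * ‖z‖ ^ 2) := by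
  unfold kernelK
  rw [show -‖z‖ ^ 2 / (4 * τ) = -(1 / (4 * τ)) * ‖z‖ ^ 2 by ring]
  ring

lemma integrable_kernelK (s : ℝ) {τ : ℝ} (hτ : 0 < τ) :
    Integrable (fun z : Rd d => kernelK d s z τ) := by
  simp_rw [kernelK_eq]
  exact (integrable_gaussian (by positivity)).const_mul _

/-- The Gaussian mass `(4πτ)^{d/2}` cancels the dimensional part of the kernel. What is left is not
integrable at `τ = 0` when `s > 0`, so the two terms of the fractional operator can be separated
only after a damping in `τ`. -/
lemma integral_kernelK (s : ℝ) {τ : ℝ} (hτ : 0 < τ) :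
    ∫ z : Rd d, kernelK d s z τ = τ ^ (-(1 + s)) / |Real.Gamma (-s)| := by
  simp_rw [kernelK_eq]
  rw [integral_const_mul, integral_gaussian (by positivity)]
  have e : Real.pi / (1 / (4 * τ)) = (4 * Real.pi) * τ := by field_simp
  rw [e, Real.mul_rpow (by positivity) hτ.le,
    show (d : ℝ) / 2 + 1 + s = (d : ℝ) / 2 + (1 + s) by ring, Real.rpow_add hτ,
    Real.rpow_neg hτ.le]
  have h1 : (4 * Real.pi) ^ ((d : ℝ) / 2) ≠ 0 := by positivity
  have h2 : τ ^ ((d : ℝ) / 2) ≠ 0 := by positivity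
  have h3 : τ ^ (1 + s) ≠ 0 := by positivity
  field_simp

/-- The substitution `τ ↦ τ⁻¹` turns this into the gamma integrand `t^{s-1} e^{-bt}`; the same
substitution evaluates the integral in the next lemma. -/
lemma integrableOn_rpow_mul_exp_inv {s b : ℝ} (hs : 0 < s) (hb : 0 < b) :
    IntegrableOn (fun τ : ℝ => τ ^ (-(1 + s)) * Real.exp (-b / τ)) (Ioi 0) := by
  have h : IntegrableOn (fun t : ℝ => t ^ (s - 1) * Real.exp (-b * t)) (Ioi 0) := by
    have := integrableOn_rpow_mul_exp_neg_mul_rpow (p := 1) (s := s - 1) (b := b) (by linarith)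
      one_pos hb
    simpa using this
  have h2 := (integrableOn_Ioi_comp_rpow_iff (fun t : ℝ => t ^ (s - 1) * Real.exp (-b * t))
    (p := -1) (by norm_num)).2 h
  refine h2.congr_fun (fun τ (hτ : 0 < τ) => ?_) measurableSet_Ioi
  simp only [abs_neg, abs_one, one_mul, smul_eq_mul]
  rw [← Real.rpow_mul hτ.le, ← mul_assoc, ← Real.rpow_add hτ, Real.rpow_neg_one]
  congr 2
  ring

lemma integral_rpow_mul_exp_inv {s b : ℝ} (hs : 0 < s) (hb : 0 < b) :
    ∫ τ in Ioi (0 : ℝ), τ ^ (-(1 + s)) * Real.exp (-b / τ) = Real.Gamma s * b ^ (-s) := by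
  have h := integral_comp_rpow_Ioi (fun t : ℝ => t ^ (s - 1) * Real.exp (-(b * t)))
    (p := -1) (by norm_num)
  rw [Real.integral_rpow_mul_exp_neg_mul_Ioi hs hb] at h
  rw [Real.rpow_neg hb.le, ← Real.inv_rpow hb.le, ← one_div, mul_comm, ← h]
  refine setIntegral_congr_fun measurableSet_Ioi (fun τ (hτ : 0 < τ) => ?_)
  simp only [abs_neg, abs_one, one_mul, smul_eq_mul]
  rw [← Real.rpow_mul hτ.le, ← mul_assoc, ← Real.rpow_add hτ, Real.rpow_neg_one]
  congr 2
  · ring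
  · ring

/-- The constant relating the Poisson kernel to `K_s`. -/
noncomputable def poissonConst (s : ℝ) : ℝ := |Real.Gamma (-s)| / ((4 : ℝ) ^ s * Real.Gamma s)

lemma Gamma_neg_ne_zero {s : ℝ} (hs0 : 0 < s) (hs1 : s < 1) : Real.Gamma (-s) ≠ 0 := by
  refine Real.Gamma_ne_zero fun m hm => ?_
  have h1 : s = m := by linarith
  have h2 : (0 : ℝ) < m := by linarith
  have h3 : (m : ℝ) < 1 := by linarith
  norm_cast at h2 h3
  omega

lemma poissonConst_pos {s : ℝ} (hs0 : 0 < s) (hs1 : s < 1) : 0 < poissonConst s := by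
  have := Real.Gamma_pos_of_pos hs0
  have := abs_pos.2 (Gamma_neg_ne_zero hs0 hs1)
  unfold poissonConst
  positivity

lemma etaConst_eq (s : ℝ) : etaConst s = 2 * s * poissonConst s := by
  unfold etaConst poissonConst; ring

/-- The Poisson kernel is `K_s` damped by `e^{-x₀²/4τ}`. This is the link through which the
behaviour of the extension at `x₀ = 0` is read off from the fractional operator. -/
lemma poissonKernel_eq {s : ℝ} (hs0 : 0 < s) (hs1 : s < 1) (x₀ : ℝ) (z : Rd d) {τ : ℝ}
    (hτ : 0 < τ) : poissonKernel d s x₀ z τ =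
      poissonConst s * x₀ ^ (2 * s) * Real.exp (-(x₀ ^ 2 / 4) / τ) * kernelK d s z τ := by
  unfold poissonKernel kernelK poissonConst
  have h0 := Real.Gamma_pos_of_pos hs0
  have h1 := abs_pos.2 (Gamma_neg_ne_zero hs0 hs1)
  have h2 : τ ^ ((d : ℝ) / 2 + 1 + s) ≠ 0 := by positivity
  rw [show -(x₀ ^ 2 + ‖z‖ ^ 2) / (4 * τ) = -(x₀ ^ 2 / 4) / τ + -‖z‖ ^ 2 / (4 * τ) by
    field_simp; ring, Real.exp_add, Real.rpow_add (by norm_num),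
    Real.mul_rpow (by norm_num) Real.pi_pos.le]
  have h3 : (4 : ℝ) ^ ((d : ℝ) / 2) ≠ 0 := by positivity
  have h4 : (4 : ℝ) ^ s ≠ 0 := by positivity
  have h5 : Real.pi ^ ((d : ℝ) / 2) ≠ 0 := by positivity
  field_simp

end Kernel

/-! ### The extension near `x₀ = 0` and the Neumann flux -/

section Extension

variable {s : ℝ} {u : Rd d → ℝ → ℝ}

lemma continuousOn_of_holder {β C : ℝ} (hβ : 0 < β)
    (h : ∀ x z : Rd d, ∀ t r : ℝ, 0 < t → 0 < r →
      |u x t - u z r| ≤ C * (‖x - z‖ + |t - r|) ^ β) :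
    ContinuousOn (fun q : Rd d × ℝ => u q.1 q.2) (univ ×ˢ Ioi 0) := by
  rintro ⟨x, t⟩ ⟨-, ht : 0 < t⟩
  rw [ContinuousWithinAt, tendsto_iff_dist_tendsto_zero]
  have hc : Tendsto (fun q : Rd d × ℝ => C * (‖q.1 - x‖ + |q.2 - t|) ^ β)
      (𝓝[univ ×ˢ Ioi 0] (x, t)) (𝓝 0) := by
    have : Continuous (fun q : Rd d × ℝ => C * (‖q.1 - x‖ + |q.2 - t|) ^ β) :=
      continuous_const.mul (Continuous.rpow_const (by fun_prop) fun _ => Or.inr hβ.le)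
    have h2 := (this.tendsto (x, t)).mono_left (nhdsWithin_le_nhds (s := univ ×ˢ Ioi (0 : ℝ)))
    simpa [Real.zero_rpow hβ.ne'] using h2
  refine squeeze_zero' (Eventually.of_forall fun _ => dist_nonneg) ?_ hc
  filter_upwards [self_mem_nhdsWithin] with q hq
  exact h _ _ _ _ hq.2 ht

lemma continuous_slice (hu : ContinuousOn (fun q : Rd d × ℝ => u q.1 q.2) (univ ×ˢ Ioi 0))
    {t : ℝ} (ht : 0 < t) : Continuous fun x => u x t := by
  rw [← continuousOn_univ]
  exact hu.comp (f := fun x : Rd d => (x, t)) (by fun_prop) fun x _ => ⟨mem_univ _, ht⟩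

lemma integrable_slice_mul_kernelK {C : ℝ}
    (hu : ContinuousOn (fun q : Rd d × ℝ => u q.1 q.2) (univ ×ˢ Ioi 0))
    (hC : ∀ x t, 0 < t → |u x t| ≤ C) (x : Rd d) {σ τ : ℝ} (hσ : 0 < σ) (hτ : 0 < τ) :
    Integrable (fun z => u z σ * kernelK d s (x - z) τ) :=
  ((integrable_kernelK s hτ).comp_sub_left x).bdd_mul (c := C)
    (continuous_slice hu hσ).aestronglyMeasurable (Eventually.of_forall fun z => hC z σ hσ)

lemma backwardInner_eq {C : ℝ}
    (hu : ContinuousOn (fun q : Rd d × ℝ => u q.1 q.2) (univ ×ˢ Ioi 0))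
    (hC : ∀ x t, 0 < t → |u x t| ≤ C) (x : Rd d) {t σ : ℝ} (ht : 0 < t) (hσ : t < σ) :
    backwardInner s u x t σ = u x t * ((σ - t) ^ (-(1 + s)) / |Real.Gamma (-s)|) -
      ∫ z, u z σ * kernelK d s (x - z) (σ - t) := by
  unfold backwardInner
  simp_rw [sub_mul]
  have hτ : 0 < σ - t := sub_pos.2 hσ
  rw [integral_sub (((integrable_kernelK s hτ).comp_sub_left x).const_mul _)
    (integrable_slice_mul_kernelK hu hC x (ht.trans hσ) hτ), integral_const_mul,
    integral_sub_left_eq_self (fun z => kernelK d s z (σ - t)), integral_kernelK s hτ]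

lemma integral_poissonKernel_mul (hs0 : 0 < s) (hs1 : s < 1) (x₀ : ℝ) (x : Rd d) {t τ : ℝ}
    (hτ : 0 < τ) :
    ∫ z, poissonKernel d s x₀ z τ * u (x - z) (t + τ) =
      poissonConst s * x₀ ^ (2 * s) * Real.exp (-(x₀ ^ 2 / 4) / τ) *
        ∫ z, u z (t + τ) * kernelK d s (x - z) τ := by
  rw [← integral_const_mul, ← integral_sub_left_eq_self _ _ x]
  refine integral_congr_ae (Eventually.of_forall fun z => ?_)
  simp only [poissonKernel_eq hs0 hs1 _ _ hτ, sub_sub_cancel]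
  ring

lemma integral_Ioi_shift (f : ℝ → ℝ) (t : ℝ) :
    ∫ τ in Ioi (0 : ℝ), f (t + τ) = ∫ σ in Ioi t, f σ := by
  have := (measurePreserving_add_left volume t).setIntegral_preimage_emb
    (measurableEmbedding_addLeft t) f (Ioi t)
  rw [← this]
  simp

lemma integrableOn_Ioi_shift {f : ℝ → ℝ} {t : ℝ} (h : IntegrableOn f (Ioi t)) :
    IntegrableOn (fun τ => f (t + τ)) (Ioi 0) := by
  have := ((measurePreserving_add_left volume t).integrableOn_comp_preimage
    (measurableEmbedding_addLeft t) (f := f) (s := Ioi t)).2 h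
  simpa [Function.comp_def] using this

/-- With `b = x₀²/4` in the gamma integral, this cancellation gives the Poisson kernel total mass
one for every `x₀`. -/
lemma rpow_div_mul_rpow {x₀ : ℝ} (hx : 0 < x₀) (s : ℝ) :
    x₀ ^ (2 * s) * (x₀ ^ 2 / 4) ^ (-s) = (4 : ℝ) ^ s := by
  rw [Real.div_rpow (by positivity) (by norm_num), ← Real.rpow_natCast, ← Real.rpow_mul hx.le,
    mul_div_assoc', ← Real.rpow_add hx, Real.rpow_neg (by norm_num)]
  simp

/-- The extension differs from `u` by a weighted integral of the fractional heat operator. -/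
lemma backwardExtension_sub {C : ℝ} (hs0 : 0 < s) (hs1 : s < 1)
    (hu : ContinuousOn (fun q : Rd d × ℝ => u q.1 q.2) (univ ×ˢ Ioi 0))
    (hC : ∀ x t, 0 < t → |u x t| ≤ C) {X : ℝ × Rd d} (hX : 0 < X.1) {t : ℝ} (ht : 0 < t)
    (hint : IntegrableOn (fun σ => backwardInner s u X.2 t σ) (Ioi t)) :
    backwardExtension s u X t - u X.2 t = -(poissonConst s * X.1 ^ (2 * s) *
      ∫ τ in Ioi (0 : ℝ), Real.exp (-(X.1 ^ 2 / 4) / τ) * backwardInner s u X.2 t (t + τ)) := by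
  have hΓ := abs_pos.2 (Gamma_neg_ne_zero hs0 hs1)
  have hΓ' := Real.Gamma_pos_of_pos hs0
  have hb : 0 < X.1 ^ 2 / 4 := by positivity
  have hi1 := (integrableOn_rpow_mul_exp_inv hs0 hb).const_mul
    (poissonConst s * X.1 ^ (2 * s) * u X.2 t / |Real.Gamma (-s)|)
  have hi2 : IntegrableOn (fun τ => Real.exp (-(X.1 ^ 2 / 4) / τ) *
      backwardInner s u X.2 t (t + τ)) (Ioi 0) := by
    refine (integrableOn_Ioi_shift hint).bdd_mul (c := 1) (by
      exact (Measurable.aestronglyMeasurable (by fun_prop))) ?_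
    filter_upwards [self_mem_ae_restrict measurableSet_Ioi] with τ (hτ : 0 < τ)
    rw [Real.norm_of_nonneg (Real.exp_pos _).le, Real.exp_le_one_iff]
    exact div_nonpos_of_nonpos_of_nonneg (by linarith) hτ.le
  have key : backwardExtension s u X t = ∫ τ in Ioi (0 : ℝ),
      (poissonConst s * X.1 ^ (2 * s) * u X.2 t / |Real.Gamma (-s)| *
        (τ ^ (-(1 + s)) * Real.exp (-(X.1 ^ 2 / 4) / τ)) - poissonConst s * X.1 ^ (2 * s) *
          (Real.exp (-(X.1 ^ 2 / 4) / τ) * backwardInner s u X.2 t (t + τ))) := by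
    unfold backwardExtension
    refine setIntegral_congr_fun measurableSet_Ioi (fun τ (hτ : 0 < τ) => ?_)
    rw [integral_poissonKernel_mul hs0 hs1 _ _ hτ,
      backwardInner_eq hu hC X.2 ht (by linarith : t < t + τ), add_sub_cancel_left]
    ring
  rw [key, integral_sub hi1 (hi2.const_mul _), integral_const_mul, integral_const_mul,
    integral_rpow_mul_exp_inv hs0 hb]
  have e := rpow_div_mul_rpow hX s
  -- The half carrying `u(x,t)` integrates to exactly `u(x,t)`, since the Poisson kernel has mass
  -- one; the other half is the damped operator.
  have : poissonConst s * X.1 ^ (2 * s) * u X.2 t / |Real.Gamma (-s)| *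
      (Real.Gamma s * (X.1 ^ 2 / 4) ^ (-s)) = u X.2 t := by
    have h4 : (4 : ℝ) ^ s ≠ 0 := by positivity
    rw [show poissonConst s * X.1 ^ (2 * s) * u X.2 t / |Real.Gamma (-s)| *
      (Real.Gamma s * (X.1 ^ 2 / 4) ^ (-s)) = poissonConst s * u X.2 t / |Real.Gamma (-s)| *
      Real.Gamma s * (X.1 ^ (2 * s) * (X.1 ^ 2 / 4) ^ (-s)) by ring, e]
    unfold poissonConst
    field_simp
  rw [this]
  ring

/-- The extension is an average of `u` against a nonnegative kernel of total mass one. -/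
lemma abs_backwardExtension_le {C : ℝ} (hs0 : 0 < s) (hs1 : s < 1)
    (hC : ∀ x t, 0 < t → |u x t| ≤ C) {X : ℝ × Rd d} (hX : 0 < X.1) {t : ℝ} (ht : 0 < t) :
    |backwardExtension s u X t| ≤ C := by
  have hΓ := abs_pos.2 (Gamma_neg_ne_zero hs0 hs1)
  have hΓ' := Real.Gamma_pos_of_pos hs0
  have hb : 0 < X.1 ^ 2 / 4 := by positivity
  have hi1 := (integrableOn_rpow_mul_exp_inv hs0 hb).const_mul
    (poissonConst s * X.1 ^ (2 * s) * C / |Real.Gamma (-s)|)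
  have hle : |backwardExtension s u X t| ≤ ∫ τ in Ioi (0 : ℝ),
      poissonConst s * X.1 ^ (2 * s) * C / |Real.Gamma (-s)| *
        (τ ^ (-(1 + s)) * Real.exp (-(X.1 ^ 2 / 4) / τ)) := by
    rw [backwardExtension, ← Real.norm_eq_abs]
    refine norm_integral_le_of_norm_le hi1 ?_
    filter_upwards [self_mem_ae_restrict measurableSet_Ioi] with τ (hτ : 0 < τ)
    rw [integral_poissonKernel_mul hs0 hs1 _ _ hτ]
    have h1 : ‖∫ z, u z (t + τ) * kernelK d s (X.2 - z) τ‖ ≤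
        C * (τ ^ (-(1 + s)) / |Real.Gamma (-s)|) := by
      rw [← integral_kernelK (d := d) s hτ,
        ← integral_sub_left_eq_self (fun z => kernelK d s z τ) _ X.2, ← integral_const_mul]
      refine norm_integral_le_of_norm_le
        (((integrable_kernelK s hτ).comp_sub_left X.2).const_mul C)
        (Eventually.of_forall fun z => ?_)
      rw [norm_mul, Real.norm_of_nonneg (kernelK_nonneg s _ hτ)]
      exact mul_le_mul_of_nonneg_right (hC _ _ (by linarith)) (kernelK_nonneg s _ hτ)
    have h2 := (poissonConst_pos hs0 hs1).le
    have h3 : 0 ≤ X.1 ^ (2 * s) := by positivity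
    rw [norm_mul, Real.norm_of_nonneg (by positivity)]
    calc _ ≤ poissonConst s * X.1 ^ (2 * s) * Real.exp (-(X.1 ^ 2 / 4) / τ) *
        (C * (τ ^ (-(1 + s)) / |Real.Gamma (-s)|)) :=
          mul_le_mul_of_nonneg_left h1 (by positivity)
      _ = _ := by ring
  rw [integral_const_mul, integral_rpow_mul_exp_inv hs0 hb] at hle
  refine hle.trans_eq ?_
  have e := rpow_div_mul_rpow hX s
  have h4 : (4 : ℝ) ^ s ≠ 0 := by positivity
  rw [show poissonConst s * X.1 ^ (2 * s) * C / |Real.Gamma (-s)| *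
    (Real.Gamma s * (X.1 ^ 2 / 4) ^ (-s)) = poissonConst s * C / |Real.Gamma (-s)| *
    Real.Gamma s * (X.1 ^ (2 * s) * (X.1 ^ 2 / 4) ^ (-s)) by ring, e]
  unfold poissonConst
  field_simp

/-- The rescaled difference `x₀^{-2s} (U - u)` converges to the fractional heat operator. -/
lemma tendsto_backwardExtension_sub_div {C : ℝ} (hs0 : 0 < s) (hs1 : s < 1)
    (hu : ContinuousOn (fun q : Rd d × ℝ => u q.1 q.2) (univ ×ˢ Ioi 0))
    (hC : ∀ x t, 0 < t → |u x t| ≤ C) (x : Rd d) {t : ℝ} (ht : 0 < t)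
    (hint : IntegrableOn (fun σ => backwardInner s u x t σ) (Ioi t)) :
    Tendsto (fun r => (backwardExtension s u (r, x) t - u x t) / r ^ (2 * s)) (𝓝[>] 0)
      (𝓝 (-(poissonConst s * backwardFracHeat s u x t))) := by
  have hi := integrableOn_Ioi_shift hint
  have h1 : Tendsto (fun r : ℝ => ∫ τ in Ioi (0 : ℝ), Real.exp (-(r ^ 2 / 4) / τ) *
      backwardInner s u x t (t + τ)) (𝓝[>] 0)
      (𝓝 (∫ τ in Ioi (0 : ℝ), backwardInner s u x t (t + τ))) := by
    refine tendsto_integral_filter_of_dominated_convergence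
      (fun τ => ‖backwardInner s u x t (t + τ)‖) (Eventually.of_forall fun r => ?_)
      (Eventually.of_forall fun r => ?_) hi.norm ?_
    · exact (Measurable.aestronglyMeasurable (by fun_prop)).mul hi.aestronglyMeasurable
    · filter_upwards [self_mem_ae_restrict measurableSet_Ioi] with τ (hτ : 0 < τ)
      rw [norm_mul, Real.norm_of_nonneg (Real.exp_pos _).le]
      refine mul_le_of_le_one_left (norm_nonneg _) (Real.exp_le_one_iff.2 ?_)
      exact div_nonpos_of_nonpos_of_nonneg (neg_nonpos.2 (by positivity)) hτ.le
    · filter_upwards with τ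
      have : Continuous fun r : ℝ => Real.exp (-(r ^ 2 / 4) / τ) *
          backwardInner s u x t (t + τ) := by fun_prop
      have h := (this.tendsto 0).mono_left (nhdsWithin_le_nhds (s := Ioi 0))
      simpa using h
  rw [integral_Ioi_shift] at h1
  refine ((h1.const_mul (poissonConst s)).neg).congr' ?_
  filter_upwards [self_mem_nhdsWithin] with r (hr : 0 < r)
  rw [backwardExtension_sub hs0 hs1 hu hC (X := (r, x)) hr ht hint]
  have : r ^ (2 * s) ≠ 0 := by positivity
  field_simp

/-- The Neumann flux of a function is determined by its growth at the boundary. -/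
lemma flux_eq_of_tendsto {s b G L : ℝ} {w : ℝ → ℝ} (hs0 : 0 < s)
    (hw : ∀ r, 0 < r → DifferentiableAt ℝ w r)
    (hG : Tendsto (fun r => r ^ (1 - 2 * s) * deriv w r) (𝓝[>] 0) (𝓝 G))
    (hL : Tendsto (fun r => (w r - b) / r ^ (2 * s)) (𝓝[>] 0) (𝓝 L)) :
    G = 2 * s * L ∧ Tendsto w (𝓝[>] 0) (𝓝 b) := by
  have hr : Tendsto (fun r : ℝ => r ^ (2 * s)) (𝓝[>] 0) (𝓝 0) := by
    have := (Real.continuousAt_rpow_const 0 (2 * s) (Or.inr (by positivity))).tendsto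
    rw [Real.zero_rpow (by positivity)] at this
    exact this.mono_left nhdsWithin_le_nhds
  have hw0 : Tendsto (fun r => w r - b) (𝓝[>] 0) (𝓝 0) := by
    have := hL.mul hr
    rw [mul_zero] at this
    refine this.congr' ?_
    filter_upwards [self_mem_nhdsWithin] with r (hr : 0 < r)
    have : r ^ (2 * s) ≠ 0 := by positivity
    field_simp
  refine ⟨?_, by simpa using hw0.add_const b⟩
  -- The quotient of derivatives is `r^{1-2s} w'(r) / (2s)`, whose limit exists by `hG`. L'Hôpital's
  -- rule then forces the two limits to agree; without `hG` the growth of `w` alone would say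
  -- nothing about the flux.
  have h : Tendsto (fun r => (w r - b) / r ^ (2 * s)) (𝓝[>] 0) (𝓝 (G / (2 * s))) := by
    refine HasDerivAt.lhopital_zero_nhdsGT (f' := deriv w)
      (g' := fun r => 2 * s * r ^ (2 * s - 1)) ?_ ?_ ?_ hw0 hr ?_
    · filter_upwards [self_mem_nhdsWithin] with r (hr : 0 < r)
      exact (hw r hr).hasDerivAt.sub_const b
    · filter_upwards [self_mem_nhdsWithin] with r (hr : 0 < r)
      exact Real.hasDerivAt_rpow_const (Or.inl hr.ne')
    · filter_upwards [self_mem_nhdsWithin] with r (hr : 0 < r)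
      positivity
    · refine (hG.div_const (2 * s)).congr' ?_
      filter_upwards [self_mem_nhdsWithin] with r (hr : 0 < r)
      rw [show 2 * s - 1 = -(1 - 2 * s) by ring, Real.rpow_neg hr.le]
      have : r ^ (1 - 2 * s) ≠ 0 := by positivity
      field_simp
  have := tendsto_nhds_unique hL h
  rw [this]
  field_simp

end Extension


/-! ### Polynomial bounds for the heat-type kernel -/

section GaussianBounds

/-- The heat-type kernel `τ^{-α} e^{-Q/4τ}`. -/
noncomputable def heatKer (α Q τ : ℝ) : ℝ := τ ^ (-α) * Real.exp (-Q / (4 * τ))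

lemma heatKer_nonneg {α Q τ : ℝ} (hτ : 0 < τ) : 0 ≤ heatKer α Q τ :=
  mul_nonneg (Real.rpow_nonneg hτ.le _) (Real.exp_pos _).le

/-- With `θ = Q/τ` one has `τ^{-α} = (τ+Q)^{-α} (1+θ)^α`, and `e^{-θ/4}` beats `(1+θ)^{α+2}`. The
two spare powers of `1+θ` pay for the factors that derivatives of the kernel bring down, and
`(τ+Q)^{-α}` is integrable in space-time. -/
lemma exists_heatKer_bound (α : ℝ) : ∃ K, 0 < K ∧ ∀ Q τ : ℝ, 0 ≤ Q → 0 < τ →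
    (1 + Q / τ) ^ 2 * heatKer α Q τ ≤ K * (τ + Q) ^ (-α) := by
  obtain ⟨n, hn⟩ := exists_nat_ge (α + 2)
  refine ⟨4 ^ n * n.factorial * Real.exp (1 / 4), by positivity, fun Q τ hQ hτ => ?_⟩
  have hθ : 0 ≤ Q / τ := by positivity
  set θ := Q / τ with hθd
  have h1 : (1 + θ) ^ (α + 2) ≤ 4 ^ n * n.factorial * Real.exp (1 / 4) * Real.exp (θ / 4) := by
    calc (1 + θ) ^ (α + 2) ≤ (1 + θ) ^ (n : ℝ) :=
          Real.rpow_le_rpow_of_exponent_le (by linarith) hn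
      _ = 4 ^ n * n.factorial * (((1 + θ) / 4) ^ n / n.factorial) := by
          rw [Real.rpow_natCast, div_pow]
          field_simp
      _ ≤ 4 ^ n * n.factorial * Real.exp ((1 + θ) / 4) := by
          gcongr
          exact Real.pow_div_factorial_le_exp _ (by positivity) n
      _ = _ := by rw [mul_assoc _ (Real.exp _), ← Real.exp_add]; ring_nf
  have h2 : (τ + Q) ^ (-α) = τ ^ (-α) * (1 + θ) ^ (-α) := by
    rw [← Real.mul_rpow hτ.le (by positivity), hθd]
    congr 1
    field_simp
  have h3 : -Q / (4 * τ) = -(θ / 4) := by rw [hθd]; field_simp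
  have h5 : (1 + θ) ^ (α + 2) = (1 + θ) ^ α * (1 + θ) ^ 2 := by
    rw [Real.rpow_add (by positivity)]
    norm_cast
  rw [h5] at h1
  rw [heatKer, h2, h3, Real.exp_neg, Real.rpow_neg (by positivity : (0 : ℝ) ≤ 1 + θ)]
  have h4 : 0 < (1 + θ) ^ α := by positivity
  have h6 : 0 ≤ τ ^ (-α) := by positivity
  have h7 := Real.exp_pos (θ / 4)
  rw [show (1 + θ) ^ 2 * (τ ^ (-α) * (Real.exp (θ / 4))⁻¹) =
    ((1 + θ) ^ 2 / Real.exp (θ / 4)) * τ ^ (-α) by ring,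
    show 4 ^ n * (n.factorial : ℝ) * Real.exp (1 / 4) * (τ ^ (-α) * ((1 + θ) ^ α)⁻¹) =
    (4 ^ n * (n.factorial : ℝ) * Real.exp (1 / 4) / (1 + θ) ^ α) * τ ^ (-α) by ring]
  gcongr ?_ * _
  rw [div_le_div_iff₀ h7 h4]
  linarith

end GaussianBounds

/-! ### Differentiating kernel integrals along lines and in time -/

section LineDerivatives

variable {Ω : Type*} [MeasurableSpace Ω]

lemma measurable_heatKer {α : ℝ} {Q τ : Ω → ℝ} (hQ : Measurable Q) (hτ : Measurable τ) :
    Measurable fun ω => heatKer α (Q ω) (τ ω) := by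
  unfold heatKer
  exact (hτ.pow_const _).mul ((hQ.neg.div (hτ.const_mul 4)).exp)

/-- Here `Q` is a squared distance and `b` a component of the corresponding vector. A displacement
of at most a quarter of the lower bound `m` for the distance costs at most half of `Q`, which makes
the bounds uniform for nearby points. -/
lemma line_quadratic_ge {b Q m r : ℝ} (hb : b ^ 2 ≤ Q) (hQ : m ^ 2 ≤ Q)
    (hr : |r| ≤ m / 4) : Q / 2 ≤ Q + 2 * b * r + r ^ 2 := by
  have h1 : r ^ 2 ≤ (m / 4) ^ 2 := sq_le_sq' (by linarith [neg_abs_le r]) (by linarith [le_abs_self r])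
  nlinarith [sq_nonneg (b + 4 * r)]

/-- Pointwise bounds for the kernel and its derivatives along a line. -/
lemma exists_line_bound {α m : ℝ} (hα : 0 ≤ α) (hm : 0 < m) : ∃ K, 0 < K ∧
    ∀ b Q τ r : ℝ, 0 < τ → b ^ 2 ≤ Q → m ^ 2 ≤ Q → |r| ≤ m / 4 →
      heatKer α (Q + 2 * b * r + r ^ 2) τ ≤ K * (τ + Q) ^ (-α) ∧
      |-(b + r) / (2 * τ) * heatKer α (Q + 2 * b * r + r ^ 2) τ| ≤ K * (τ + Q) ^ (-α) ∧
      |((b + r) ^ 2 / (4 * τ ^ 2) - 1 / (2 * τ)) * heatKer α (Q + 2 * b * r + r ^ 2) τ| ≤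
        K * (τ + Q) ^ (-α) := by
  obtain ⟨K, hK, h⟩ := exists_heatKer_bound α
  refine ⟨(1 + 1 / m + 2 / m ^ 2) * (K * 2 ^ α), by positivity,
    fun b Q τ r hτ hb hQ hr => ?_⟩
  have hQr := line_quadratic_ge hb hQ hr
  set R := Q + 2 * b * r + r ^ 2 with hR
  have hbr : (b + r) ^ 2 ≤ R := by rw [hR]; nlinarith
  have hm2 : 0 < m ^ 2 := by positivity
  have hQpos : 0 < Q := by linarith
  have hRpos : 0 < R := by linarith
  have hθ : 0 < R / τ := by positivity
  have hbase : (1 + R / τ) ^ 2 * heatKer α R τ ≤ K * 2 ^ α * (τ + Q) ^ (-α) := by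
    refine (h R τ hRpos.le hτ).trans ?_
    have : (τ + R) ^ (-α) ≤ ((τ + Q) / 2) ^ (-α) :=
      Real.rpow_le_rpow_of_nonpos (by positivity) (by linarith) (by linarith)
    rw [Real.div_rpow (by positivity) (by norm_num), Real.rpow_neg (by norm_num : (0 : ℝ) ≤ 2),
      div_inv_eq_mul] at this
    calc _ ≤ K * ((τ + Q) ^ (-α) * 2 ^ α) := by gcongr
      _ = _ := by ring
  have hk := heatKer_nonneg (α := α) (Q := R) hτ
  have hG : 0 ≤ (τ + Q) ^ (-α) := Real.rpow_nonneg (by positivity) _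
  -- Each factor `A` produced by differentiation is at most a constant times `(1 + R/τ)²`, exactly
  -- the room left by `exists_heatKer_bound`.
  have main : ∀ A c : ℝ, 0 ≤ c → c ≤ 1 + 1 / m + 2 / m ^ 2 → |A| ≤ c * (1 + R / τ) ^ 2 →
      |A * heatKer α R τ| ≤ (1 + 1 / m + 2 / m ^ 2) * (K * 2 ^ α) * (τ + Q) ^ (-α) := by
    intro A c hc hc' hA
    rw [abs_mul, abs_of_nonneg hk]
    calc |A| * heatKer α R τ ≤ c * (1 + R / τ) ^ 2 * heatKer α R τ := by gcongr
      _ = c * ((1 + R / τ) ^ 2 * heatKer α R τ) := by ring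
      _ ≤ (1 + 1 / m + 2 / m ^ 2) * (K * 2 ^ α * (τ + Q) ^ (-α)) := by gcongr
      _ = _ := by ring
  have p1 : 0 < 1 / m := by positivity
  have p2 : 0 < 2 / m ^ 2 := by positivity
  refine ⟨?_, ?_, ?_⟩
  · have := main 1 1 (by norm_num) (by linarith) (by rw [abs_one]; nlinarith)
    rwa [one_mul, abs_of_nonneg hk] at this
  · refine main _ (1 / m) p1.le (by linarith) ?_
    have h1 : |b + r| ≤ 3 / 2 * (R / m) := by
      have h2 : |b + r| * (2 * m) ≤ (b + r) ^ 2 + m ^ 2 := by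
        rw [← sq_abs (b + r)]; nlinarith [sq_nonneg (|b + r| - m)]
      rw [show 3 / 2 * (R / m) = (3 * R) / (2 * m) by field_simp, le_div_iff₀ (by positivity)]
      linarith
    rw [abs_div, abs_neg, abs_of_pos (by positivity : 0 < 2 * τ)]
    calc |b + r| / (2 * τ) ≤ 3 / 2 * (R / m) / (2 * τ) := by gcongr
      _ = 1 / m * (3 / 4 * (R / τ)) := by field_simp; norm_num
      _ ≤ 1 / m * (1 + R / τ) ^ 2 := by gcongr; nlinarith
  · refine main _ (2 / m ^ 2) p2.le (by linarith) ?_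
    have e1 : (b + r) ^ 2 / (4 * τ ^ 2) ≤ 1 / m ^ 2 * (R / τ) ^ 2 := by
      rw [div_mul_eq_mul_div, one_mul, div_pow, div_div, div_le_div_iff₀ (by positivity)
        (by positivity)]
      have : (b + r) ^ 2 * m ^ 2 ≤ R * (2 * R) := by
        apply mul_le_mul hbr (by linarith) hm2.le hRpos.le
      nlinarith [sq_nonneg τ, mul_le_mul_of_nonneg_right this (sq_nonneg τ)]
    have e2 : 1 / (2 * τ) ≤ 1 / m ^ 2 * (R / τ) := by
      rw [div_mul_div_comm, one_mul, div_le_div_iff₀ (by positivity) (by positivity)]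
      nlinarith
    have e3 : 0 ≤ (b + r) ^ 2 / (4 * τ ^ 2) := by positivity
    have e4 : 0 ≤ 1 / (2 * τ) := by positivity
    have e5 : |(b + r) ^ 2 / (4 * τ ^ 2) - 1 / (2 * τ)| ≤
        1 / m ^ 2 * (R / τ) ^ 2 + 1 / m ^ 2 * (R / τ) := by
      rw [abs_le]; constructor <;> nlinarith
    refine e5.trans ?_
    rw [← mul_add, show 2 / m ^ 2 = 1 / m ^ 2 * 2 by ring, mul_assoc]
    gcongr
    nlinarith

lemma hasDerivAt_heatKer_line (α b Q τ r : ℝ) :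
    HasDerivAt (fun r => heatKer α (Q + 2 * b * r + r ^ 2) τ)
      (-(b + r) / (2 * τ) * heatKer α (Q + 2 * b * r + r ^ 2) τ) r := by
  unfold heatKer
  have h1 : HasDerivAt (fun r : ℝ => -(Q + 2 * b * r + r ^ 2) / (4 * τ))
      (-(2 * b + 2 * r) / (4 * τ)) r := by
    have := (((hasDerivAt_id' r).const_mul (2 * b)).const_add Q).add (hasDerivAt_pow 2 r)
    refine (this.neg.div_const (4 * τ)).congr_deriv ?_
    simp
  refine (h1.exp.const_mul _).congr_deriv ?_
  rw [show -(2 * b + 2 * r) / (4 * τ) = -(b + r) / (2 * τ) by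
    rw [show 4 * τ = 2 * (2 * τ) by ring, show -(2 * b + 2 * r) = 2 * -(b + r) by ring,
      mul_div_mul_left _ _ (by norm_num : (2 : ℝ) ≠ 0)]]
  ring

lemma hasDerivAt_heatKer_line' (α b Q τ r : ℝ) :
    HasDerivAt (fun r => -(b + r) / (2 * τ) * heatKer α (Q + 2 * b * r + r ^ 2) τ)
      (((b + r) ^ 2 / (4 * τ ^ 2) - 1 / (2 * τ)) * heatKer α (Q + 2 * b * r + r ^ 2) τ) r := by
  have h1 : HasDerivAt (fun r : ℝ => -(b + r) / (2 * τ)) (-1 / (2 * τ)) r :=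
    (((hasDerivAt_id' r).const_add b).neg).div_const _
  refine (h1.mul (hasDerivAt_heatKer_line α b Q τ r)).congr_deriv ?_
  rw [show (b + r) ^ 2 / (4 * τ ^ 2) = (-(b + r) / (2 * τ)) ^ 2 by rw [div_pow]; ring]
  ring

variable {μ : Measure Ω} {b Q τ h : Ω → ℝ} {α m C : ℝ}

/-- Differentiation under the integral sign, twice, along a line. -/
lemma hasDerivAt_integral_line (hα : 0 ≤ α) (hm : 0 < m) (hbm : Measurable b) (hQm : Measurable Q)
    (hτm : Measurable τ) (hh : AEStronglyMeasurable h μ) (hC : ∀ᵐ ω ∂μ, |h ω| ≤ C)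
    (hτ : ∀ᵐ ω ∂μ, 0 < τ ω) (hb : ∀ ω, b ω ^ 2 ≤ Q ω) (hQ : ∀ ω, m ^ 2 ≤ Q ω)
    (hG : Integrable (fun ω => (τ ω + Q ω) ^ (-α)) μ) :
    (∀ r, |r| < m / 4 →
      HasDerivAt (fun r => ∫ ω, h ω * heatKer α (Q ω + 2 * b ω * r + r ^ 2) (τ ω) ∂μ)
        (∫ ω, h ω * (-(b ω + r) / (2 * τ ω) *
          heatKer α (Q ω + 2 * b ω * r + r ^ 2) (τ ω)) ∂μ) r) ∧
    HasDerivAt (fun r => ∫ ω, h ω * (-(b ω + r) / (2 * τ ω) *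
          heatKer α (Q ω + 2 * b ω * r + r ^ 2) (τ ω)) ∂μ)
      (∫ ω, h ω * ((b ω ^ 2 / (4 * τ ω ^ 2) - 1 / (2 * τ ω)) * heatKer α (Q ω) (τ ω)) ∂μ) 0 ∧
    Integrable (fun ω => h ω * heatKer α (Q ω) (τ ω)) μ ∧
    Integrable (fun ω => h ω * (-b ω / (2 * τ ω) * heatKer α (Q ω) (τ ω))) μ ∧
    Integrable (fun ω => h ω * ((b ω ^ 2 / (4 * τ ω ^ 2) - 1 / (2 * τ ω)) *
      heatKer α (Q ω) (τ ω))) μ := by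
  obtain ⟨K, hK, hbd⟩ := exists_line_bound hα hm
  have hm4 : 0 < m / 4 := by positivity
  have mk : ∀ r, Measurable fun ω => heatKer α (Q ω + 2 * b ω * r + r ^ 2) (τ ω) := fun r =>
    measurable_heatKer (by fun_prop) hτm
  have mk1 : ∀ r, Measurable fun ω => -(b ω + r) / (2 * τ ω) *
      heatKer α (Q ω + 2 * b ω * r + r ^ 2) (τ ω) := fun r => by
    have := mk r
    fun_prop
  have mk2 : ∀ r, Measurable fun ω => ((b ω + r) ^ 2 / (4 * τ ω ^ 2) - 1 / (2 * τ ω)) *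
      heatKer α (Q ω + 2 * b ω * r + r ^ 2) (τ ω) := fun r => by
    have := mk r
    fun_prop
  have hb1 : ∀ᵐ ω ∂μ, ∀ r ∈ Metric.ball (0 : ℝ) (m / 4),
      ‖h ω * heatKer α (Q ω + 2 * b ω * r + r ^ 2) (τ ω)‖ ≤ C * K * (τ ω + Q ω) ^ (-α) ∧
      ‖h ω * (-(b ω + r) / (2 * τ ω) * heatKer α (Q ω + 2 * b ω * r + r ^ 2) (τ ω))‖ ≤
        C * K * (τ ω + Q ω) ^ (-α) ∧
      ‖h ω * (((b ω + r) ^ 2 / (4 * τ ω ^ 2) - 1 / (2 * τ ω)) *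
        heatKer α (Q ω + 2 * b ω * r + r ^ 2) (τ ω))‖ ≤ C * K * (τ ω + Q ω) ^ (-α) := by
    filter_upwards [hC, hτ] with ω hC hτ r hr
    have hr' : |r| ≤ m / 4 := by simpa using (Metric.mem_ball.1 hr).le
    obtain ⟨h1, h2, h3⟩ := hbd (b ω) (Q ω) (τ ω) r hτ (hb ω) (hQ ω) hr'
    have hC0 : 0 ≤ C := (abs_nonneg _).trans hC
    refine ⟨?_, ?_, ?_⟩ <;> rw [norm_mul, Real.norm_eq_abs, Real.norm_eq_abs, mul_assoc C K]
    · refine mul_le_mul hC ?_ (abs_nonneg _) hC0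
      rwa [abs_of_nonneg (heatKer_nonneg hτ)]
    · exact mul_le_mul hC h2 (abs_nonneg _) hC0
    · exact mul_le_mul hC h3 (abs_nonneg _) hC0
  have hGi := hG.const_mul (C * K)
  have i0 : ∀ r ∈ Metric.ball (0 : ℝ) (m / 4),
      Integrable (fun ω => h ω * heatKer α (Q ω + 2 * b ω * r + r ^ 2) (τ ω)) μ := fun r hr =>
    hGi.mono' (hh.mul (mk r).aestronglyMeasurable) (hb1.mono fun ω h => (h r hr).1)
  have i1 : ∀ r ∈ Metric.ball (0 : ℝ) (m / 4),
      Integrable (fun ω => h ω * (-(b ω + r) / (2 * τ ω) *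
        heatKer α (Q ω + 2 * b ω * r + r ^ 2) (τ ω))) μ := fun r hr =>
    hGi.mono' (hh.mul (mk1 r).aestronglyMeasurable) (hb1.mono fun ω h => (h r hr).2.1)
  have i2 : ∀ r ∈ Metric.ball (0 : ℝ) (m / 4),
      Integrable (fun ω => h ω * (((b ω + r) ^ 2 / (4 * τ ω ^ 2) - 1 / (2 * τ ω)) *
        heatKer α (Q ω + 2 * b ω * r + r ^ 2) (τ ω))) μ := fun r hr =>
    hGi.mono' (hh.mul (mk2 r).aestronglyMeasurable) (hb1.mono fun ω h => (h r hr).2.2)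
  have h0 : (0 : ℝ) ∈ Metric.ball (0 : ℝ) (m / 4) := by simpa using hm4
  refine ⟨fun r hr => ?_, ?_, by simpa using i0 0 h0, by simpa using i1 0 h0,
    by simpa using i2 0 h0⟩
  · have hr' : r ∈ Metric.ball (0 : ℝ) (m / 4) := by simpa using hr
    refine (hasDerivAt_integral_of_dominated_loc_of_deriv_le
      (Metric.isOpen_ball.mem_nhds hr') (Eventually.of_forall fun r =>
        hh.mul (mk r).aestronglyMeasurable) (i0 r hr')
      (hh.mul (mk1 r).aestronglyMeasurable) (hb1.mono fun ω h r hr => (h r hr).2.1) hGi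
      (Eventually.of_forall fun ω r _ => (hasDerivAt_heatKer_line _ _ _ _ _).const_mul _)).2
  · have := (hasDerivAt_integral_of_dominated_loc_of_deriv_le
      (Metric.isOpen_ball.mem_nhds h0) (Eventually.of_forall fun r =>
        hh.mul (mk1 r).aestronglyMeasurable) (i1 0 h0)
      (hh.mul (mk2 0).aestronglyMeasurable) (hb1.mono fun ω h r hr => (h r hr).2.2) hGi
      (Eventually.of_forall fun ω r _ => (hasDerivAt_heatKer_line' _ _ _ _ _).const_mul _)).2
    simpa using this

/-- The kernel extended by zero to negative times. -/
noncomputable def heatKerExt (α Q τ : ℝ) : ℝ := if 0 < τ then heatKer α Q τ else 0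

/-- The time derivative of the kernel, extended by zero to negative times. -/
noncomputable def heatKerExtDeriv (α Q τ : ℝ) : ℝ :=
  if 0 < τ then (Q / (4 * τ ^ 2) - α / τ) * heatKer α Q τ else 0

/-- Away from `Q = 0` negative powers of `τ` are controlled by powers of `Q/τ`. The version with the
factor `τ²` gives second-order vanishing at `τ = 0`, which makes the extension by zero
differentiable there. -/
lemma exists_time_bound {α m : ℝ} (hα : 0 ≤ α) (hm : 0 < m) : ∃ K, 0 < K ∧
    ∀ Q τ : ℝ, m ≤ Q → 0 < τ → heatKer α Q τ ≤ K * (τ + Q) ^ (-α) ∧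
      heatKer α Q τ ≤ K * (τ + Q) ^ (-α) * τ ^ 2 ∧
      |(Q / (4 * τ ^ 2) - α / τ) * heatKer α Q τ| ≤ K * (τ + Q) ^ (-α) := by
  obtain ⟨K, hK, h⟩ := exists_heatKer_bound α
  refine ⟨(1 + 1 / m ^ 2 + (1 + α) / m) * K, by positivity, fun Q τ hQ hτ => ?_⟩
  have hQ0 : 0 < Q := hm.trans_le hQ
  have hbase := h Q τ hQ0.le hτ
  have hθ : 0 < Q / τ := by positivity
  have hk := heatKer_nonneg (α := α) (Q := Q) hτ
  have hG : 0 ≤ (τ + Q) ^ (-α) := Real.rpow_nonneg (by positivity) _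
  have p1 : 0 < 1 / m ^ 2 := by positivity
  have p2 : 0 < (1 + α) / m := by positivity
  have main : ∀ A c : ℝ, 0 ≤ c → c ≤ 1 + 1 / m ^ 2 + (1 + α) / m → |A| ≤ c * (1 + Q / τ) ^ 2 →
      |A * heatKer α Q τ| ≤ (1 + 1 / m ^ 2 + (1 + α) / m) * K * (τ + Q) ^ (-α) := by
    intro A c hc hc' hA
    rw [abs_mul, abs_of_nonneg hk]
    calc |A| * heatKer α Q τ ≤ c * (1 + Q / τ) ^ 2 * heatKer α Q τ := by gcongr
      _ = c * ((1 + Q / τ) ^ 2 * heatKer α Q τ) := by ring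
      _ ≤ (1 + 1 / m ^ 2 + (1 + α) / m) * (K * (τ + Q) ^ (-α)) := by gcongr
      _ = _ := by ring
  refine ⟨?_, ?_, ?_⟩
  · have := main 1 1 (by norm_num) (by linarith) (by rw [abs_one]; nlinarith)
    rwa [one_mul, abs_of_nonneg hk] at this
  · have := main (1 / τ ^ 2) (1 / m ^ 2) p1.le (by linarith) (by
      rw [abs_of_pos (by positivity)]
      calc 1 / τ ^ 2 = 1 / Q ^ 2 * (Q / τ) ^ 2 := by field_simp
        _ ≤ 1 / m ^ 2 * (1 + Q / τ) ^ 2 := by gcongr; linarith)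
    rw [abs_of_nonneg (by positivity)] at this
    calc heatKer α Q τ = 1 / τ ^ 2 * heatKer α Q τ * τ ^ 2 := by field_simp
      _ ≤ _ := by gcongr
  · refine main _ ((1 + α) / m) p2.le (by linarith) ?_
    have e1 : Q / (4 * τ ^ 2) ≤ 1 / m * (Q / τ) ^ 2 := by
      calc Q / (4 * τ ^ 2) = 1 / (4 * Q) * (Q / τ) ^ 2 := by field_simp
        _ ≤ 1 / m * (Q / τ) ^ 2 := by gcongr; linarith
    have e2 : α / τ ≤ α / m * (Q / τ) := by
      calc α / τ = α / Q * (Q / τ) := by field_simp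
        _ ≤ _ := by gcongr
    have e3 : 0 ≤ Q / (4 * τ ^ 2) := by positivity
    have e4 : 0 ≤ α / τ := by positivity
    have e5 : |Q / (4 * τ ^ 2) - α / τ| ≤ 1 / m * (Q / τ) ^ 2 + α / m * (Q / τ) := by
      have e6 : 0 ≤ 1 / m * (Q / τ) ^ 2 := by positivity
      have e7 : 0 ≤ α / m * (Q / τ) := by positivity
      rw [abs_le]; constructor <;> linarith
    refine e5.trans ?_
    calc _ ≤ 1 / m * (1 + Q / τ) ^ 2 + α / m * (1 + Q / τ) ^ 2 := by
          gcongr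
          · linarith
          · nlinarith
      _ = _ := by ring

lemma hasDerivAt_heatKer_time {α Q τ : ℝ} (hτ : 0 < τ) :
    HasDerivAt (fun τ => heatKer α Q τ) ((Q / (4 * τ ^ 2) - α / τ) * heatKer α Q τ) τ := by
  unfold heatKer
  have h1 : HasDerivAt (fun τ : ℝ => -Q / (4 * τ)) (Q / (4 * τ ^ 2)) τ := by
    have := ((hasDerivAt_id' τ).const_mul 4).inv (by positivity : (4 * τ) ≠ 0)
    refine (this.const_mul (-Q)).congr_deriv ?_
    field_simp
  refine ((Real.hasDerivAt_rpow_const (p := -α) (Or.inl hτ.ne')).mul h1.exp).congr_deriv ?_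
  rw [Real.rpow_sub_one hτ.ne']
  field_simp
  ring

/-- For `Q > 0` the kernel is `O(τ²)` as `τ` decreases to `0`, so the extension by zero has
derivative `0` there. Working with the extension removes `t` from the domain of integration before
differentiating in `t`. -/
lemma hasDerivAt_heatKerExt {α Q : ℝ} (hα : 0 ≤ α) (hQ : 0 < Q) (τ : ℝ) :
    HasDerivAt (fun τ => heatKerExt α Q τ) (heatKerExtDeriv α Q τ) τ := by
  rcases lt_trichotomy τ 0 with hτ | rfl | hτ
  · rw [heatKerExtDeriv, if_neg hτ.not_gt]
    refine (hasDerivAt_const τ (0 : ℝ)).congr_of_eventuallyEq ?_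
    filter_upwards [gt_mem_nhds hτ] with r hr
    rw [heatKerExt, if_neg (not_lt.2 (le_of_lt hr))]
  · rw [heatKerExtDeriv, if_neg (lt_irrefl _)]
    obtain ⟨K, hK, h⟩ := exists_time_bound hα hQ
    have hO : (fun τ => heatKerExt α Q τ) =O[𝓝 0] fun τ => ‖τ - 0‖ ^ 2 := by
      refine Asymptotics.IsBigO.of_bound (K * Q ^ (-α)) (Eventually.of_forall fun r => ?_)
      rw [sub_zero, norm_pow, norm_norm, Real.norm_eq_abs, Real.norm_eq_abs, sq_abs, heatKerExt]
      split_ifs with hr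
      · rw [abs_of_nonneg (heatKer_nonneg hr)]
        refine (h Q r le_rfl hr).2.1.trans ?_
        gcongr ?_ * _
        refine mul_le_mul_of_nonneg_left ?_ hK.le
        exact Real.rpow_le_rpow_of_nonpos hQ (by linarith) (by linarith)
      · rw [abs_zero]; positivity
    have := (hO.hasFDerivAt (by norm_num)).hasDerivAt
    simpa using this
  · rw [heatKerExtDeriv, if_pos hτ]
    refine (hasDerivAt_heatKer_time hτ).congr_of_eventuallyEq ?_
    filter_upwards [lt_mem_nhds hτ] with r hr
    rw [heatKerExt, if_pos hr]

/-- Differentiation under the integral sign with respect to time. -/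
lemma hasDerivAt_integral_time (hα : 0 ≤ α) (hm : 0 < m) (hQm : Measurable Q)
    (hτm : Measurable τ) (hh : AEStronglyMeasurable h μ) (hC : ∀ᵐ ω ∂μ, |h ω| ≤ C)
    (hQ : ∀ ω, m ≤ Q ω) (hG : Integrable (fun ω => (|τ ω| + Q ω) ^ (-α)) μ) :
    HasDerivAt (fun r => ∫ ω, h ω * heatKerExt α (Q ω) (τ ω - r) ∂μ)
      (∫ ω, h ω * -heatKerExtDeriv α (Q ω) (τ ω) ∂μ) 0 ∧
    Integrable (fun ω => h ω * -heatKerExtDeriv α (Q ω) (τ ω)) μ := by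
  obtain ⟨K, hK, hbd⟩ := exists_time_bound hα hm
  have hm4 : 0 < m / 4 := by positivity
  have mk : ∀ r, Measurable fun ω => heatKerExt α (Q ω) (τ ω - r) := fun r =>
    Measurable.ite (measurableSet_lt measurable_const (by fun_prop))
      (measurable_heatKer hQm (by fun_prop)) measurable_const
  have mk1 : ∀ r, Measurable fun ω => heatKerExtDeriv α (Q ω) (τ ω - r) := fun r =>
    Measurable.ite (measurableSet_lt measurable_const (by fun_prop))
      (Measurable.mul (by fun_prop) (measurable_heatKer hQm (by fun_prop))) measurable_const
  have hb1 : ∀ᵐ ω ∂μ, ∀ r ∈ Metric.ball (0 : ℝ) (m / 4),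
      ‖h ω * heatKerExt α (Q ω) (τ ω - r)‖ ≤ C * (K * 2 ^ α) * (|τ ω| + Q ω) ^ (-α) ∧
      ‖h ω * -heatKerExtDeriv α (Q ω) (τ ω - r)‖ ≤ C * (K * 2 ^ α) * (|τ ω| + Q ω) ^ (-α) := by
    filter_upwards [hC] with ω hC r hr
    have hr' : |r| ≤ m / 4 := by simpa using (Metric.mem_ball.1 hr).le
    have hC0 : 0 ≤ C := (abs_nonneg _).trans hC
    have hQ' := hQ ω
    have hpos : 0 < |τ ω| + Q ω := by have := abs_nonneg (τ ω); linarith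
    have hB : 0 ≤ K * 2 ^ α * (|τ ω| + Q ω) ^ (-α) := by positivity
    rw [norm_mul, norm_mul, norm_neg, Real.norm_eq_abs, Real.norm_eq_abs, Real.norm_eq_abs,
      mul_assoc]
    unfold heatKerExt heatKerExtDeriv
    split_ifs with hr2
    · obtain ⟨h1, -, h3⟩ := hbd (Q ω) (τ ω - r) (hQ ω) hr2
      have hge : (|τ ω| + Q ω) / 2 ≤ τ ω - r + Q ω := by
        rcases abs_cases (τ ω) with ⟨h, _⟩ | ⟨h, _⟩ <;> rw [h] <;>
          linarith [le_abs_self r, neg_abs_le r]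
      have hcmp : K * (τ ω - r + Q ω) ^ (-α) ≤ K * 2 ^ α * (|τ ω| + Q ω) ^ (-α) := by
        have : (τ ω - r + Q ω) ^ (-α) ≤ ((|τ ω| + Q ω) / 2) ^ (-α) :=
          Real.rpow_le_rpow_of_nonpos (by positivity) hge (by linarith)
        rw [Real.div_rpow (by positivity) (by norm_num),
          Real.rpow_neg (by norm_num : (0 : ℝ) ≤ 2), div_inv_eq_mul] at this
        calc _ ≤ K * ((|τ ω| + Q ω) ^ (-α) * 2 ^ α) := by gcongr
          _ = _ := by ring
      refine ⟨mul_le_mul hC ?_ (abs_nonneg _) hC0, mul_le_mul hC ?_ (abs_nonneg _) hC0⟩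
      · rw [abs_of_nonneg (heatKer_nonneg hr2)]
        exact h1.trans hcmp
      · exact h3.trans hcmp
    · rw [abs_zero, mul_zero]
      exact ⟨mul_nonneg hC0 hB, mul_nonneg hC0 hB⟩
  have hGi := hG.const_mul (C * (K * 2 ^ α))
  have h0 : (0 : ℝ) ∈ Metric.ball (0 : ℝ) (m / 4) := by simpa using hm4
  have := hasDerivAt_integral_of_dominated_loc_of_deriv_le
      (F := fun r ω => h ω * heatKerExt α (Q ω) (τ ω - r))
      (F' := fun r ω => h ω * -heatKerExtDeriv α (Q ω) (τ ω - r)) (μ := μ)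
      (Metric.isOpen_ball.mem_nhds h0) (Eventually.of_forall fun r =>
        hh.mul (mk r).aestronglyMeasurable) (hGi.mono' (hh.mul (mk 0).aestronglyMeasurable)
          (hb1.mono fun ω h => (h 0 h0).1))
      (hh.mul (mk1 0).neg.aestronglyMeasurable) (hb1.mono fun ω h r hr => (h r hr).2) hGi
      (Eventually.of_forall fun ω r _ => by
        have h1 := (hasDerivAt_heatKerExt (α := α) hα (hm.trans_le (hQ ω)) (τ ω - r)).comp r
          ((hasDerivAt_id' r).const_sub (τ ω))
        refine (h1.const_mul (h ω)).congr_deriv ?_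
        ring)
  simpa using And.intro this.2 this.1

end LineDerivatives


/-! ### Pure second derivatives from lines -/

section SecondDerivatives

/-- The second directional derivative. -/
noncomputable def dirDeriv2 (w : ℝ × Rd d → ℝ) (X e : ℝ × Rd d) : ℝ :=
  fderiv ℝ (fun Y => fderiv ℝ w Y e) X e

/-- The unit vector of `ℝ × ℝ^d` in the direction of the extension variable. -/
def e₀ : ℝ × Rd d := (1, 0)

/-- The unit vectors of `ℝ × ℝ^d` in the directions of `ℝ^d`. -/
noncomputable def eX (i : Fin d) : ℝ × Rd d := (0, EuclideanSpace.single i 1)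

lemma dirDeriv_of_line {w : ℝ × Rd d → ℝ} {X e : ℝ × Rd d} (hw : ContDiffAt ℝ 2 w X) {g : ℝ → ℝ}
    {g' : ℝ} (h1 : ∀ᶠ r in 𝓝 (0 : ℝ), HasDerivAt (fun r => w (X + r • e)) (g r) r)
    (h2 : HasDerivAt g g' 0) : fderiv ℝ w X e = g 0 ∧ dirDeriv2 w X e = g' := by
  have hline : ∀ r : ℝ, HasDerivAt (fun r : ℝ => X + r • e) e r := fun r => by
    simpa using ((hasDerivAt_id' r).smul_const e).const_add X
  have hc : Tendsto (fun r : ℝ => X + r • e) (𝓝 0) (𝓝 X) := by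
    have := (hline 0).continuousAt.tendsto
    simpa using this
  have hd : ∀ᶠ Y in 𝓝 X, DifferentiableAt ℝ w Y :=
    (hw.eventually (by norm_num)).mono fun Y h => h.differentiableAt (by norm_num)
  have heq : ∀ᶠ r in 𝓝 (0 : ℝ), fderiv ℝ w (X + r • e) e = g r := by
    filter_upwards [hc.eventually hd, h1] with r hr1 hr2
    exact (hr1.hasFDerivAt.comp_hasDerivAt r (hline r)).unique hr2
  have hf : DifferentiableAt ℝ (fun Y => fderiv ℝ w Y e) X :=
    ((hw.fderiv_right (m := 1) (by norm_num)).differentiableAt (by norm_num)).clm_apply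
      (differentiableAt_const e)
  refine ⟨by simpa using heq.self_of_nhds, ?_⟩
  have hf' : HasFDerivAt (fun Y => fderiv ℝ w Y e) (fderiv ℝ (fun Y => fderiv ℝ w Y e) X)
    (X + (0 : ℝ) • e) := by simpa using hf.hasFDerivAt
  have h3 : HasDerivAt (fun r : ℝ => fderiv ℝ w (X + r • e) e) g' 0 :=
    h2.congr_of_eventuallyEq heq
  have h4 := HasFDerivAt.comp_hasDerivAt (l := fun Y => fderiv ℝ w Y e) (0 : ℝ) hf' (hline 0)
  exact h4.unique h3

end SecondDerivatives

/-! ### The extension as a potential of the heat-type kernel -/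

section Representation

variable {s : ℝ} {u : Rd d → ℝ → ℝ}

/-- The exponent splits as `d/2 + 1 + s = (d+s)/2 + (1 + s/2)`: the first part is integrable in `z ∈
ℝ^d` and the second in `τ ∈ ℝ`, each with a margin of order `s`. -/
lemma integrable_parabolic_decay (hs : 0 < s) {m : ℝ} (hm : 0 < m) :
    Integrable fun q : Rd d × ℝ => (|q.2| + (m + ‖q.1‖ ^ 2)) ^ (-((d : ℝ) / 2 + 1 + s)) := by
  have h1 : Integrable fun z : Rd d => ((1 : ℝ) + ‖z‖ ^ 2) ^ (-((d : ℝ) + s) / 2) :=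
    integrable_rpow_neg_one_add_norm_sq (by simpa using hs)
  have h2 : Integrable fun τ : ℝ => ((1 : ℝ) + ‖τ‖) ^ (-(1 + s / 2)) :=
    integrable_one_add_norm (by simpa using hs)
  have hc : 0 < min 1 m := lt_min one_pos hm
  have h3 := (h1.mul_prod h2).const_mul
    (((min 1 m) ^ (-((d : ℝ) + s) / 2)) * (min 1 m) ^ (-(1 + s / 2)))
  refine h3.mono' (Measurable.aestronglyMeasurable (by fun_prop))
    (Eventually.of_forall fun ⟨z, τ⟩ => ?_)
  have hz := sq_nonneg ‖z‖
  have hτ := abs_nonneg τ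
  have hpos : 0 < |τ| + (m + ‖z‖ ^ 2) := by linarith
  have hle1 := min_le_left 1 m
  have hle2 := min_le_right 1 m
  have e1 : min 1 m * (1 + ‖z‖ ^ 2) ≤ |τ| + (m + ‖z‖ ^ 2) := by nlinarith
  have e2 : min 1 m * (1 + ‖τ‖) ≤ |τ| + (m + ‖z‖ ^ 2) := by rw [Real.norm_eq_abs]; nlinarith
  have hd : (0 : ℝ) ≤ d := d.cast_nonneg
  rw [Real.norm_of_nonneg (Real.rpow_nonneg hpos.le _),
    show -((d : ℝ) / 2 + 1 + s) = -((d : ℝ) + s) / 2 + -(1 + s / 2) by ring, Real.rpow_add hpos]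
  calc _ ≤ (min 1 m * (1 + ‖z‖ ^ 2)) ^ (-((d : ℝ) + s) / 2) *
        (min 1 m * (1 + ‖τ‖)) ^ (-(1 + s / 2)) := by
        refine mul_le_mul (Real.rpow_le_rpow_of_nonpos (by positivity) e1 (by linarith))
          (Real.rpow_le_rpow_of_nonpos (by positivity) e2 (by linarith)) (by positivity)
          (by positivity)
    _ = _ := by
        rw [Real.mul_rpow hc.le (by positivity), Real.mul_rpow hc.le (by positivity)]
        ring

instance isAddHaarMeasure_volume_left : (volume : Measure (Rd d × ℝ)).IsAddHaarMeasure :=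
  Measure.prod.instIsAddHaarMeasure volume volume

instance isAddHaarMeasure_volume_right : (volume : Measure (ℝ × Rd d)).IsAddHaarMeasure :=
  Measure.prod.instIsAddHaarMeasure volume volume

lemma integrable_parabolic_decay_shift (hs : 0 < s) {m : ℝ} (hm : 0 < m) (x : Rd d) (t : ℝ) :
    Integrable fun q : Rd d × ℝ =>
      (|q.2 - t| + (m + ‖x - q.1‖ ^ 2)) ^ (-((d : ℝ) / 2 + 1 + s)) := by
  have := (integrable_parabolic_decay (d := d) hs hm).comp_sub_right (x, t)
  refine this.congr (Eventually.of_forall fun q => ?_)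
  simp [norm_sub_rev x]

/-- Lebesgue measure on `ℝ^d × (t, ∞)`. -/
noncomputable def futureMeasure (d : ℕ) (t : ℝ) : Measure (Rd d × ℝ) :=
  (volume : Measure (Rd d)).prod (volume.restrict (Ioi t))

lemma futureMeasure_eq (t : ℝ) :
    futureMeasure d t = (volume : Measure (Rd d × ℝ)).restrict (univ ×ˢ Ioi t) := by
  rw [futureMeasure, Measure.volume_eq_prod, ← Measure.prod_restrict, Measure.restrict_univ]

lemma ae_futureMeasure (t : ℝ) : ∀ᵐ q ∂futureMeasure d t, t < q.2 := by
  rw [futureMeasure_eq]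
  filter_upwards [self_mem_ae_restrict (MeasurableSet.univ.prod measurableSet_Ioi)] with q hq
  exact hq.2

lemma futureMeasure_restrict {t : ℝ} (ht : 0 ≤ t) :
    (futureMeasure d 0).restrict {q | 0 < q.2 - t} = futureMeasure d t := by
  rw [futureMeasure_eq, futureMeasure_eq, Measure.restrict_restrict
    (measurableSet_lt measurable_const (by fun_prop))]
  congr 1
  ext q
  simp only [mem_inter_iff, mem_ofPred_eq, mem_prod, mem_univ, true_and, mem_Ioi, sub_pos]
  exact ⟨fun h => h.1, fun h => ⟨h, ht.trans_lt h⟩⟩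

lemma integral_futureMeasure_ite {t : ℝ} (ht : 0 ≤ t) (f : Rd d × ℝ → ℝ) :
    ∫ q, (if 0 < q.2 - t then f q else 0) ∂futureMeasure d 0 = ∫ q, f q ∂futureMeasure d t := by
  rw [← futureMeasure_restrict ht, ← integral_indicator
    (measurableSet_lt measurable_const (by fun_prop))]
  rfl

lemma integrable_futureMeasure_ite {t : ℝ} (ht : 0 ≤ t) {f : Rd d × ℝ → ℝ}
    (hf : Integrable (fun q => if 0 < q.2 - t then f q else 0) (futureMeasure d 0)) :
    Integrable f (futureMeasure d t) := by
  rw [← futureMeasure_restrict ht]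
  exact (integrable_indicator_iff (measurableSet_lt measurable_const (by fun_prop))).1 hf

/-- The integral that, up to the factor `c x₀^{2s}`, represents the extension. -/
noncomputable def heatPotential (s : ℝ) (u : Rd d → ℝ → ℝ) (X : ℝ × Rd d) (t : ℝ) : ℝ :=
  ∫ q, u q.1 q.2 * heatKer ((d : ℝ) / 2 + 1 + s) (X.1 ^ 2 + ‖X.2 - q.1‖ ^ 2) (q.2 - t)
    ∂futureMeasure d t

/-- The normalisation of the Poisson kernel. -/
noncomputable def extConst (d : ℕ) (s : ℝ) : ℝ :=
  1 / ((4 : ℝ) ^ ((d : ℝ) / 2 + s) * Real.pi ^ ((d : ℝ) / 2) * Real.Gamma s)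

lemma aestronglyMeasurable_future
    (hu : ContinuousOn (fun q : Rd d × ℝ => u q.1 q.2) (univ ×ˢ Ioi 0)) {t : ℝ} (ht : 0 ≤ t) :
    AEStronglyMeasurable (fun q : Rd d × ℝ => u q.1 q.2) (futureMeasure d t) := by
  rw [← futureMeasure_restrict ht, futureMeasure_eq]
  exact (hu.aestronglyMeasurable (MeasurableSet.univ.prod measurableSet_Ioi)).restrict

variable {C : ℝ}

/-- `b` is to be the component of `(x₀, x - z)` along the direction of differentiation; the distance
`x₀` to the boundary serves as the lower bound `m`. -/
lemma line_hyps (hs : 0 < s) (hu : ContinuousOn (fun q : Rd d × ℝ => u q.1 q.2) (univ ×ˢ Ioi 0))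
    (hC : ∀ x t, 0 < t → |u x t| ≤ C) {X : ℝ × Rd d} (hX : 0 < X.1) {t : ℝ} (ht : 0 < t)
    {b : Rd d × ℝ → ℝ} (hbm : Measurable b) (hb : ∀ q, b q ^ 2 ≤ X.1 ^ 2 + ‖X.2 - q.1‖ ^ 2) :
    let α := (d : ℝ) / 2 + 1 + s
    let Q : Rd d × ℝ → ℝ := fun q => X.1 ^ 2 + ‖X.2 - q.1‖ ^ 2
    let τ : Rd d × ℝ → ℝ := fun q => q.2 - t
    let h : Rd d × ℝ → ℝ := fun q => u q.1 q.2
    let μ := futureMeasure d t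
    (∀ r, |r| < X.1 / 4 →
      HasDerivAt (fun r => ∫ ω, h ω * heatKer α (Q ω + 2 * b ω * r + r ^ 2) (τ ω) ∂μ)
        (∫ ω, h ω * (-(b ω + r) / (2 * τ ω) *
          heatKer α (Q ω + 2 * b ω * r + r ^ 2) (τ ω)) ∂μ) r) ∧
    HasDerivAt (fun r => ∫ ω, h ω * (-(b ω + r) / (2 * τ ω) *
          heatKer α (Q ω + 2 * b ω * r + r ^ 2) (τ ω)) ∂μ)
      (∫ ω, h ω * ((b ω ^ 2 / (4 * τ ω ^ 2) - 1 / (2 * τ ω)) * heatKer α (Q ω) (τ ω)) ∂μ) 0 ∧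
    Integrable (fun ω => h ω * heatKer α (Q ω) (τ ω)) μ ∧
    Integrable (fun ω => h ω * (-b ω / (2 * τ ω) * heatKer α (Q ω) (τ ω))) μ ∧
    Integrable (fun ω => h ω * ((b ω ^ 2 / (4 * τ ω ^ 2) - 1 / (2 * τ ω)) *
      heatKer α (Q ω) (τ ω))) μ := by
  intro α Q τ h μ
  refine hasDerivAt_integral_line (C := C) (by positivity) hX hbm (by fun_prop) (by fun_prop)
    (aestronglyMeasurable_future hu ht.le) ?_ ?_ hb (fun q => ?_) ?_
  · filter_upwards [ae_futureMeasure t] with q hq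
    exact hC _ _ (ht.trans hq)
  · filter_upwards [ae_futureMeasure t] with q hq
    exact sub_pos.2 hq
  · show X.1 ^ 2 ≤ X.1 ^ 2 + ‖X.2 - q.1‖ ^ 2
    have := sq_nonneg ‖X.2 - q.1‖
    linarith
  · have hi := (integrable_parabolic_decay_shift hs (by positivity : 0 < X.1 ^ 2) X.2 t).restrict
      (s := univ ×ˢ Ioi t)
    rw [← futureMeasure_eq] at hi
    refine hi.congr ?_
    filter_upwards [ae_futureMeasure t] with q hq
    rw [abs_of_pos (sub_pos.2 hq)]

/-- The changes of variables `σ = t + τ` and `z ↦ x - z` move all dependence on `(X,t)` from `u`,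
which is only Hölder, to the smooth kernel. -/
lemma backwardExtension_eq_heatPotential (hs : 0 < s)
    (hu : ContinuousOn (fun q : Rd d × ℝ => u q.1 q.2) (univ ×ˢ Ioi 0))
    (hC : ∀ x t, 0 < t → |u x t| ≤ C) {X : ℝ × Rd d} (hX : 0 < X.1) {t : ℝ} (ht : 0 < t) :
    backwardExtension s u X t = extConst d s * X.1 ^ (2 * s) * heatPotential s u X t := by
  have hi := (line_hyps hs hu hC hX ht (b := fun _ => X.1) measurable_const
    (fun q => by have := sq_nonneg ‖X.2 - q.1‖; linarith)).2.2.1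
  rw [heatPotential, futureMeasure, integral_prod_symm _ hi, ← integral_const_mul,
    ← integral_Ioi_shift, backwardExtension]
  refine setIntegral_congr_fun measurableSet_Ioi fun τ (hτ : 0 < τ) => ?_
  beta_reduce
  rw [← integral_const_mul, ← integral_sub_left_eq_self _ _ X.2]
  refine integral_congr_ae (Eventually.of_forall fun z => ?_)
  simp only [poissonKernel, extConst, heatKer, sub_sub_cancel, add_sub_cancel_left]
  rw [Real.rpow_neg hτ.le]
  ring

lemma integral_add_four {Ω : Type*} [MeasurableSpace Ω] {μ : Measure Ω} {f g h k : Ω → ℝ}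
    (hf : Integrable f μ) (hg : Integrable g μ) (hh : Integrable h μ) (hk : Integrable k μ) :
    ∫ x, f x ∂μ + ∫ x, g x ∂μ + ∫ x, h x ∂μ + ∫ x, k x ∂μ = ∫ x, (f x + g x + h x + k x) ∂μ := by
  have e := integral_add' ((hf.add hg).add hh) hk
  rw [integral_add' (hf.add hg) hh, integral_add' hf hg] at e
  exact e.symm

/-- The equation satisfied by the heat potential, together with its derivatives along lines. -/
lemma heatPotential_pde (hs : 0 < s)
    (hu : ContinuousOn (fun q : Rd d × ℝ => u q.1 q.2) (univ ×ˢ Ioi 0))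
    (hC : ∀ x t, 0 < t → |u x t| ≤ C) {X : ℝ × Rd d} (hX : 0 < X.1) {t : ℝ} (ht : 0 < t) :
    ∃ (It I00 : ℝ) (g0 : ℝ → ℝ) (Iii : Fin d → ℝ) (g : Fin d → ℝ → ℝ),
      HasDerivAt (fun r => heatPotential s u X (t + r)) It 0 ∧
      (∀ᶠ r in 𝓝 (0 : ℝ), HasDerivAt (fun r => heatPotential s u (X + r • e₀) t) (g0 r) r) ∧
      HasDerivAt g0 I00 0 ∧
      (∀ i, ∀ᶠ r in 𝓝 (0 : ℝ),
        HasDerivAt (fun r => heatPotential s u (X + r • eX i) t) (g i r) r) ∧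
      (∀ i, HasDerivAt (g i) (Iii i) 0) ∧
      It + I00 + ∑ i, Iii i + (1 + 2 * s) / X.1 * g0 0 = 0 := by
  have hX4 : 0 < X.1 / 4 := by positivity
  have hsmall : ∀ᶠ r in 𝓝 (0 : ℝ), |r| < X.1 / 4 := by
    have : Tendsto (fun r : ℝ => |r|) (𝓝 0) (𝓝 0) := by
      simpa using (continuous_abs.tendsto (0 : ℝ))
    exact this.eventually (gt_mem_nhds hX4)
  obtain ⟨a1, a2, a3, a4, a5⟩ := line_hyps hs hu hC hX ht (b := fun _ => X.1) measurable_const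
    (fun q => by have := sq_nonneg ‖X.2 - q.1‖; linarith)
  have hbi := fun i : Fin d => line_hyps hs hu hC hX ht (b := fun q => (X.2 - q.1) i)
    (by fun_prop) (fun q => by
      have h1 := EuclideanSpace.norm_sq_eq (X.2 - q.1)
      have h2 := Finset.single_le_sum (f := fun j => ‖(X.2 - q.1) j‖ ^ 2)
        (fun j _ => sq_nonneg _) (Finset.mem_univ i)
      simp only [Real.norm_eq_abs, sq_abs] at h1 h2
      have := sq_nonneg X.1
      linarith)
  -- The integral is taken over the fixed domain `σ > 0` with the kernel extended by zero. It is cut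
  -- back to `σ > t` only after differentiating.
  have htime := hasDerivAt_integral_time (μ := futureMeasure d 0) (C := C)
    (α := (d : ℝ) / 2 + 1 + s) (m := X.1 ^ 2) (h := fun q => u q.1 q.2)
    (Q := fun q => X.1 ^ 2 + ‖X.2 - q.1‖ ^ 2) (τ := fun q => q.2 - t) (by positivity)
    (by positivity) (by fun_prop) (by fun_prop) (aestronglyMeasurable_future hu le_rfl)
    (by filter_upwards [ae_futureMeasure 0] with q hq using hC _ _ hq)
    (fun q => by have := sq_nonneg ‖X.2 - q.1‖; linarith)
    (by
      rw [futureMeasure_eq]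
      exact (integrable_parabolic_decay_shift hs (by positivity : 0 < X.1 ^ 2) X.2 t).restrict)
  set α := (d : ℝ) / 2 + 1 + s with hα
  obtain ⟨ht1, ht2⟩ := htime
  have hext : ∀ q : Rd d × ℝ, u q.1 q.2 * -heatKerExtDeriv α (X.1 ^ 2 + ‖X.2 - q.1‖ ^ 2) (q.2 - t) =
      if 0 < q.2 - t then u q.1 q.2 * (-((X.1 ^ 2 + ‖X.2 - q.1‖ ^ 2) / (4 * (q.2 - t) ^ 2) -
        α / (q.2 - t)) * heatKer α (X.1 ^ 2 + ‖X.2 - q.1‖ ^ 2) (q.2 - t)) else 0 := by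
    intro q
    unfold heatKerExtDeriv
    split_ifs <;> ring
  simp_rw [hext] at ht1 ht2
  rw [integral_futureMeasure_ite ht.le] at ht1
  replace ht2 := integrable_futureMeasure_ite ht.le ht2
  refine ⟨_, _, _, _, _, ht1.congr_of_eventuallyEq ?_, ?_, a2, fun i => ?_,
    fun i => (hbi i).2.1, ?_⟩
  · have : ∀ᶠ r in 𝓝 (0 : ℝ), -t < r := lt_mem_nhds (by linarith)
    filter_upwards [this] with r hr
    rw [heatPotential, ← integral_futureMeasure_ite (by linarith)]
    refine integral_congr_ae (Eventually.of_forall fun q => ?_)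
    simp only [heatKerExt, mul_ite, mul_zero, sub_sub, ← hα]
  · filter_upwards [hsmall] with r hr
    refine (a1 r hr).congr_of_eventuallyEq (Eventually.of_forall fun r => ?_)
    unfold heatPotential
    refine integral_congr_ae (Eventually.of_forall fun q => ?_)
    simp only [e₀, Prod.fst_add, Prod.smul_fst, Prod.snd_add, Prod.smul_snd, smul_zero, add_zero,
      smul_eq_mul, mul_one]
    congr 2
    ring
  · filter_upwards [hsmall] with r hr
    refine ((hbi i).1 r hr).congr_of_eventuallyEq (Eventually.of_forall fun r => ?_)
    unfold heatPotential
    refine integral_congr_ae (Eventually.of_forall fun q => ?_)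
    simp only [eX, Prod.fst_add, Prod.smul_fst, Prod.snd_add, Prod.smul_snd, smul_eq_mul]
    congr 2
    rw [show X.2 + r • EuclideanSpace.single i (1 : ℝ) - q.1 =
      (X.2 - q.1) + r • EuclideanSpace.single i (1 : ℝ) by abel, norm_add_sq_real, norm_smul,
      inner_smul_right, EuclideanSpace.inner_single_right]
    simp only [PiLp.norm_single, norm_one, mul_one, Real.norm_eq_abs, sq_abs, one_mul,
      conj_trivial]
    ring
  · simp only [add_zero, mul_zero, ne_eq, OfNat.ofNat_ne_zero, not_false_eq_true, zero_pow]
    have hsum : ∑ i, ∫ q, u q.1 q.2 * ((((X.2 - q.1) i) ^ 2 / (4 * (q.2 - t) ^ 2) -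
        1 / (2 * (q.2 - t))) * heatKer α (X.1 ^ 2 + ‖X.2 - q.1‖ ^ 2) (q.2 - t)) ∂futureMeasure d t =
        ∫ q, u q.1 q.2 * ((‖X.2 - q.1‖ ^ 2 / (4 * (q.2 - t) ^ 2) - d / (2 * (q.2 - t))) *
          heatKer α (X.1 ^ 2 + ‖X.2 - q.1‖ ^ 2) (q.2 - t)) ∂futureMeasure d t := by
      rw [← integral_finsetSum _ fun i _ => (hbi i).2.2.2.2]
      refine integral_congr_ae (Eventually.of_forall fun q => ?_)
      beta_reduce
      rw [← Finset.mul_sum, ← Finset.sum_mul, Finset.sum_sub_distrib, ← Finset.sum_div,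
        EuclideanSpace.norm_sq_eq]
      simp only [Real.norm_eq_abs, sq_abs, Finset.sum_const, Finset.card_univ, Fintype.card_fin,
        nsmul_eq_mul]
      ring
    have hsumi : Integrable (fun q => u q.1 q.2 * ((‖X.2 - q.1‖ ^ 2 / (4 * (q.2 - t) ^ 2) -
        d / (2 * (q.2 - t))) * heatKer α (X.1 ^ 2 + ‖X.2 - q.1‖ ^ 2) (q.2 - t)))
        (futureMeasure d t) := by
      refine (integrable_finsetSum Finset.univ fun i _ => (hbi i).2.2.2.2).congr
        (Eventually.of_forall fun q => ?_)
      beta_reduce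
      rw [← Finset.mul_sum, ← Finset.sum_mul, Finset.sum_sub_distrib, ← Finset.sum_div,
        EuclideanSpace.norm_sq_eq]
      simp only [Real.norm_eq_abs, sq_abs, Finset.sum_const, Finset.card_univ, Fintype.card_fin,
        nsmul_eq_mul]
      ring
    rw [hsum, ← integral_const_mul]
    refine (integral_add_four ht2 a5 hsumi (a4.const_mul _)).trans (integral_eq_zero_of_ae ?_)
    -- The integrand vanishes identically: the `Q/4τ²` terms cancel, and the `1/τ` terms balance
    -- because `α = (d+1)/2 + (1+2s)/2`.
    filter_upwards [ae_futureMeasure t] with q hq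
    have hτ : q.2 - t ≠ 0 := (sub_pos.2 hq).ne'
    simp only [Pi.zero_apply, hα]
    field_simp
    ring

end Representation

/-! ### The degenerate equation for the extension -/

section Equation

variable {s : ℝ} {u : Rd d → ℝ → ℝ} {C T : ℝ}

/-- The extension solves the degenerate backward heat equation. -/
lemma extension_pde (hs : 0 < s) (hu : ContinuousOn (fun q : Rd d × ℝ => u q.1 q.2) (univ ×ˢ Ioi 0))
    (hC : ∀ x t, 0 < t → |u x t| ≤ C) {U : ℝ × Rd d → ℝ → ℝ}
    (hU : ∀ X ∈ halfSpace d, ∀ t ∈ Ioo 0 T, U X t = backwardExtension s u X t)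
    {X : ℝ × Rd d} (hX : 0 < X.1) {t : ℝ} (ht : t ∈ Ioo 0 T)
    (hc : ContDiffAt ℝ 2 (fun Y => U Y t) X) :
    dT U X t + dirDeriv2 (fun Y => U Y t) X e₀ + ∑ i, dirDeriv2 (fun Y => U Y t) X (eX i) +
      (1 - 2 * s) / X.1 * fderiv ℝ (fun Y => U Y t) X e₀ = 0 := by
  obtain ⟨It, I00, g0, Iii, g, h1, h2, h3, h4, h5, h6⟩ := heatPotential_pde hs hu hC hX ht.1
  set A := extConst d s
  have hrep : ∀ Y : ℝ × Rd d, 0 < Y.1 → ∀ r ∈ Ioo 0 T,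
      U Y r = A * Y.1 ^ (2 * s) * heatPotential s u Y r := fun Y hY r hr => by
    rw [hU Y hY r hr, backwardExtension_eq_heatPotential hs hu hC hY hr.1]
  have hX0 : ∀ᶠ r in 𝓝 (0 : ℝ), 0 < X.1 + r :=
    (lt_mem_nhds (neg_lt_zero.2 hX)).mono fun r hr => by linarith
  -- time derivative
  have hT : dT U X t = A * X.1 ^ (2 * s) * It := by
    have h1' : HasDerivAt (fun r => heatPotential s u X r) It t := by
      have h1'' : HasDerivAt (fun r => heatPotential s u X (t + r)) It (t - t) := by
        rwa [sub_self]
      have := h1''.comp_sub_const t t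
      simpa using this
    refine HasDerivAt.deriv ((h1'.const_mul _).congr_of_eventuallyEq ?_)
    filter_upwards [isOpen_Ioo.mem_nhds ht] with r hr
    exact hrep X hX r hr
  -- tangential derivatives
  have hi : ∀ i, dirDeriv2 (fun Y => U Y t) X (eX i) = A * X.1 ^ (2 * s) * Iii i := fun i => by
    refine (dirDeriv_of_line hc ?_ ((h5 i).const_mul (A * X.1 ^ (2 * s)))).2
    filter_upwards [h4 i] with r hr
    refine (hr.const_mul _).congr_of_eventuallyEq (Eventually.of_forall fun r => ?_)
    have e : (X + r • eX i).1 = X.1 := by simp [eX]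
    beta_reduce
    rw [hrep _ (by rwa [e]) t ht, e]
  -- normal derivatives
  have hpow : ∀ p r : ℝ, 0 < X.1 + r →
      HasDerivAt (fun r => (X.1 + r) ^ p) (p * (X.1 + r) ^ (p - 1)) r := fun p r hr => by
    exact (Real.hasDerivAt_rpow_const (p := p) (Or.inl hr.ne')).comp_const_add X.1 r
  have hX00 : 0 < X.1 + (0 : ℝ) := by simpa using hX
  have hI0 : HasDerivAt (fun r : ℝ => heatPotential s u (X + r • e₀) t) (g0 0) (0 : ℝ) :=
      h2.self_of_nhds
  -- The potential solves the equation with first-order coefficient `(1+2s)/x₀`. The factor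
  -- `x₀^{2s}` changes it to `(1-2s)/x₀`, the zeroth-order terms cancelling.
  have h0 := dirDeriv_of_line (w := fun Y => U Y t) (X := X) (e := e₀)
    (g := fun r => A * (2 * s * (X.1 + r) ^ (2 * s - 1) * heatPotential s u (X + r • e₀) t +
      (X.1 + r) ^ (2 * s) * g0 r))
    (g' := A * ((2 * s * ((2 * s - 1) * X.1 ^ (2 * s - 1 - 1)) * heatPotential s u X t +
      2 * s * X.1 ^ (2 * s - 1) * g0 0) + (2 * s * X.1 ^ (2 * s - 1) * g0 0 +
        X.1 ^ (2 * s) * I00))) hc ?_ ?_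
  · obtain ⟨h01, h02⟩ := h0
    rw [hT, h01, h02]
    simp_rw [hi]
    rw [← Finset.mul_sum]
    simp only [add_zero, zero_smul]
    have e1 : X.1 ^ (2 * s - 1) = X.1 ^ (2 * s) / X.1 := Real.rpow_sub_one hX.ne' _
    have e2 : X.1 ^ (2 * s - 1 - 1) = X.1 ^ (2 * s) / X.1 / X.1 := by
      rw [Real.rpow_sub_one hX.ne', e1]
    rw [e1, e2]
    have e3 : It = -(I00 + ∑ i, Iii i + (1 + 2 * s) / X.1 * g0 0) := by linarith
    rw [e3]
    field_simp
    ring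
  · filter_upwards [h2, hX0, hX0.eventually_nhds] with r hr hr0 hr1
    have := (((hpow (2 * s) r hr0).mul hr).const_mul A)
    refine this.congr_of_eventuallyEq ?_
    filter_upwards [hr1] with r' hr'
    have e : (X + r' • e₀).1 = X.1 + r' := by simp [e₀]
    rw [hrep _ (by rwa [e]) t ht, e, Pi.mul_apply]
    ring
  · have := ((((hpow (2 * s - 1) 0 hX00).const_mul (2 * s)).mul hI0).add
      ((hpow (2 * s) 0 hX00).mul h3)).const_mul A
    simpa using this

end Equation


/-! ### The Gaussian weight and coordinates on the half-space -/

section Weight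

/-- The weight `x₀^a e^{-|X|²/4}`. -/
noncomputable def weight (d : ℕ) (a : ℝ) (Y : ℝ × Rd d) : ℝ := Y.1 ^ a * Real.exp (-sqNorm Y / 4)

/-- `∇w · ∇φ`. -/
noncomputable def gradDot (w φ : ℝ × Rd d → ℝ) (Y : ℝ × Rd d) : ℝ :=
  fderiv ℝ w Y e₀ * fderiv ℝ φ Y e₀ + ∑ i, fderiv ℝ w Y (eX i) * fderiv ℝ φ Y (eX i)

lemma isOpen_halfSpace : IsOpen (halfSpace d) := isOpen_lt continuous_const continuous_fst

lemma measurableSet_halfSpace : MeasurableSet (halfSpace d) := isOpen_halfSpace.measurableSet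

lemma halfSpace_subset : halfSpace d ⊆ closedHalfSpace d := fun Y (h : 0 < Y.1) => h.le

lemma isClosed_closedHalfSpace : IsClosed (closedHalfSpace d) :=
  isClosed_le continuous_const continuous_fst

lemma halfSpace_eq_prod : halfSpace d = Ioi 0 ×ˢ univ := by ext Y; simp [halfSpace]

lemma restrict_halfSpace : (volume : Measure (ℝ × Rd d)).restrict (halfSpace d) =
    (volume.restrict (Ioi 0)).prod volume := by
  rw [halfSpace_eq_prod, Measure.volume_eq_prod, ← Measure.prod_restrict, Measure.restrict_univ]

lemma weight_nonneg (a : ℝ) {Y : ℝ × Rd d} (hY : 0 < Y.1) : 0 ≤ weight d a Y :=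
  mul_nonneg (Real.rpow_nonneg hY.le _) (Real.exp_pos _).le

@[fun_prop]
lemma continuous_sqNorm : Continuous (sqNorm : ℝ × Rd d → ℝ) := by unfold sqNorm; fun_prop

@[fun_prop]
lemma measurable_weight (a : ℝ) : Measurable (weight d a) := by
  unfold weight
  have : Measurable (sqNorm : ℝ × Rd d → ℝ) := continuous_sqNorm.measurable
  fun_prop

lemma contDiff_sqNorm {n : WithTop ℕ∞} : ContDiff ℝ n (sqNorm : ℝ × Rd d → ℝ) :=
  (contDiff_fst.pow 2).add (contDiff_snd.norm_sq ℝ)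

lemma contDiffAt_weight (a : ℝ) {n : WithTop ℕ∞} {Y : ℝ × Rd d} (hY : 0 < Y.1) :
    ContDiffAt ℝ n (weight d a) Y :=
  (contDiffAt_fst.rpow_const_of_ne hY.ne').mul
    ((contDiff_sqNorm.neg.div_const 4).exp.contDiffAt)

/-- The logarithmic gradient of the weight is `(a/y₀, 0) - Y/2`. It is the source of the two
first-order terms of the rescaled equation, whose operator is therefore in divergence form for this
weight. -/
lemma fderiv_weight (a : ℝ) {Y : ℝ × Rd d} (hY : 0 < Y.1) (e : ℝ × Rd d) :
    fderiv ℝ (weight d a) Y e =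
      weight d a Y * (a / Y.1 * e.1 - (Y.1 * e.1 + inner ℝ Y.2 e.2) / 2) := by
  have h1 : HasFDerivAt (fun Y : ℝ × Rd d => Y.1 ^ a)
      ((a * Y.1 ^ (a - 1)) • ContinuousLinearMap.fst ℝ ℝ (Rd d)) Y :=
    (Real.hasDerivAt_rpow_const (Or.inl hY.ne')).comp_hasFDerivAt Y hasFDerivAt_fst
  have h2 : HasFDerivAt (sqNorm : ℝ × Rd d → ℝ) _ Y :=
    ((hasFDerivAt_fst (𝕜 := ℝ) (p := Y)).pow 2).add (hasFDerivAt_snd (𝕜 := ℝ) (p := Y)).norm_sq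
  have h3 := h1.mul ((h2.neg.mul_const (1 / 4)).exp)
  have h4 : (fun Y : ℝ × Rd d => Y.1 ^ a * Real.exp (-sqNorm Y * (1 / 4))) = weight d a := by
    funext Y; simp [weight, div_eq_mul_inv]
  have h5 := h3.fderiv
  rw [show ((fun Y : ℝ × Rd d => Y.1 ^ a) * fun x => Real.exp ((-sqNorm) x * (1 / 4))) =
    weight d a from h4] at h5
  rw [h5, weight, Real.rpow_sub_one hY.ne']
  simp only [add_apply, smul_apply, smul_eq_mul,
    neg_apply, ContinuousLinearMap.coe_fst', Pi.neg_apply,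
    ContinuousLinearMap.comp_apply, ContinuousLinearMap.coe_snd', innerSL_apply_apply]
  rw [show -sqNorm Y * (1 / 4) = -sqNorm Y / 4 by ring]
  simp
  ring

lemma decomp (Y : ℝ × Rd d) : Y = Y.1 • e₀ + ∑ i, Y.2 i • (eX i : ℝ × Rd d) := by
  ext j
  · simp [e₀, eX, Prod.fst_sum]
  · simp [e₀, eX, Prod.snd_sum, Finset.sum_apply, Pi.single_apply]

lemma clm_apply_self (L : ℝ × Rd d →L[ℝ] ℝ) (Y : ℝ × Rd d) :
    L Y = Y.1 * L e₀ + ∑ i, Y.2 i * L (eX i) := by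
  conv_lhs => rw [decomp Y]
  simp

end Weight

/-! ### Integration by parts away from the boundary -/

section CompactTest

lemma integral_fderiv_eq_zero {h : ℝ × Rd d → ℝ} (hc : ContDiff ℝ 1 h) (hs : HasCompactSupport h)
    (e : ℝ × Rd d) : ∫ Y, fderiv ℝ h Y e = 0 := by
  have hi : Integrable (fun Y => fderiv ℝ h Y e) :=
    ((hc.continuous_fderiv (by norm_num)).clm_apply continuous_const).integrable_of_hasCompactSupport
      (hs.fderiv_apply ℝ e)
  have := integral_mul_fderiv_eq_neg_fderiv_mul_of_integrable (μ := volume) (f := fun _ => (1 : ℝ))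
    (g := h) (v := e) (by simp) (by simpa using hi)
    (by simpa using hc.continuous.integrable_of_hasCompactSupport hs) (by fun_prop)
    (fun Y _ => (hc.differentiable (by norm_num)) Y)
  simpa using this

variable {a : ℝ} {w Θ g : ℝ × Rd d → ℝ}

lemma contDiff_of_contDiffAt_tsupport {n : WithTop ℕ∞} {h : ℝ × Rd d → ℝ}
    (hh : ∀ Y ∈ tsupport h, ContDiffAt ℝ n h Y) : ContDiff ℝ n h := by
  refine contDiff_iff_contDiffAt.2 fun Y => ?_
  by_cases hY : Y ∈ tsupport h
  · exact hh Y hY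
  · exact contDiffAt_const.congr_of_eventuallyEq (notMem_tsupport_iff_eventuallyEq.1 hY)

/-- Integration by parts against a test function with compact support in the open half-space. -/
lemma integral_weight_compact (hw : ContDiffOn ℝ 2 w (halfSpace d))
    (hΘ : ContDiffOn ℝ 1 Θ (halfSpace d)) (hc : HasCompactSupport Θ)
    (hsub : tsupport Θ ⊆ halfSpace d)
    (hg : ∀ Y ∈ halfSpace d, dirDeriv2 w Y e₀ + ∑ i, dirDeriv2 w Y (eX i) +
      a / Y.1 * fderiv ℝ w Y e₀ - fderiv ℝ w Y Y / 2 = g Y) :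
    ∫ Y, weight d a Y * (g Y * Θ Y + gradDot w Θ Y) = 0 := by
  have hwA : ∀ Y ∈ halfSpace d, ContDiffAt ℝ 2 w Y := fun Y hY =>
    hw.contDiffAt (isOpen_halfSpace.mem_nhds hY)
  have hΘA : ∀ Y ∈ halfSpace d, ContDiffAt ℝ 1 Θ Y := fun Y hY =>
    hΘ.contDiffAt (isOpen_halfSpace.mem_nhds hY)
  have hwe : ∀ e, ∀ Y ∈ halfSpace d, ContDiffAt ℝ 1 (fun Y => fderiv ℝ w Y e) Y := fun e Y hY =>
    ((hwA Y hY).fderiv_right (m := 1) (by norm_num)).clm_apply contDiffAt_const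
  -- These are the components of the vector field `weight · Θ ∇w`. The claim is that its divergence
  -- integrates to zero.
  let h : ℝ × Rd d → ℝ × Rd d → ℝ := fun e Y => weight d a Y * fderiv ℝ w Y e * Θ Y
  have hcs : ∀ e, HasCompactSupport (h e) := fun e => hc.mul_left
  have hts : ∀ e, tsupport (h e) ⊆ halfSpace d := fun e => (tsupport_mul_subset_right).trans hsub
  have hcd : ∀ e, ContDiff ℝ 1 (h e) := fun e => contDiff_of_contDiffAt_tsupport fun Y hY =>
    ((contDiffAt_weight a (hts e hY)).mul (hwe e Y (hts e hY))).mul (hΘA Y (hts e hY))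
  have hval : ∀ e, ∀ Y ∈ halfSpace d, fderiv ℝ (h e) Y e =
      weight d a Y * ((a / Y.1 * e.1 - (Y.1 * e.1 + inner ℝ Y.2 e.2) / 2) * fderiv ℝ w Y e * Θ Y +
        dirDeriv2 w Y e * Θ Y + fderiv ℝ w Y e * fderiv ℝ Θ Y e) := by
    intro e Y hY
    have h1 := ((contDiffAt_weight (n := 1) a hY).differentiableAt (by norm_num)).hasFDerivAt
    have h2 := ((hwe e Y hY).differentiableAt (by norm_num)).hasFDerivAt
    have h3 := ((hΘA Y hY).differentiableAt (by norm_num)).hasFDerivAt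
    have h4 : HasFDerivAt (h e) _ Y := (h1.mul h2).mul h3
    rw [h4.fderiv]
    simp only [add_apply, smul_apply, smul_eq_mul,
      Pi.mul_apply, fderiv_weight a hY, dirDeriv2]
    ring
  have hint : ∀ e, Integrable fun Y => fderiv ℝ (h e) Y e := fun e =>
    (((hcd e).continuous_fderiv (by norm_num)).clm_apply
      continuous_const).integrable_of_hasCompactSupport ((hcs e).fderiv_apply ℝ e)
  have hzero : ∀ e, ∫ Y, fderiv ℝ (h e) Y e = 0 := fun e => integral_fderiv_eq_zero (hcd e) (hcs e) e
  have hsum : ∫ Y, (fderiv ℝ (h e₀) Y e₀ + ∑ i, fderiv ℝ (h (eX i)) Y (eX i)) = 0 := by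
    rw [integral_add (hint _) (integrable_finsetSum _ fun i _ => hint _),
      integral_finsetSum _ fun i _ => hint _]
    simp [hzero]
  rw [← hsum]
  refine integral_congr_ae (Eventually.of_forall fun Y => ?_)
  by_cases hY : Y ∈ halfSpace d
  · beta_reduce
    rw [hval e₀ Y hY, Finset.sum_congr rfl fun i _ => hval (eX i) Y hY, ← hg Y hY,
      clm_apply_self (fderiv ℝ w Y) Y, ← Finset.mul_sum, Finset.sum_add_distrib,
      Finset.sum_add_distrib, gradDot]
    have e1 : ∀ i, inner ℝ Y.2 (EuclideanSpace.single i (1 : ℝ)) = Y.2 i := fun i => by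
      rw [EuclideanSpace.inner_single_right]; simp
    simp only [e₀, eX, e1, mul_one, mul_zero, zero_add, inner_zero_right, add_zero, zero_sub]
    rw [← Finset.sum_mul _ _ (Θ Y), ← Finset.sum_mul _ _ (Θ Y)]
    have e2 : ∑ i, -(Y.2 i / 2) * fderiv ℝ w Y (0, EuclideanSpace.single i 1) =
        -(∑ i, Y.2 i * fderiv ℝ w Y (0, EuclideanSpace.single i 1)) / 2 := by
      rw [neg_div, Finset.sum_div, ← Finset.sum_neg_distrib]
      exact Finset.sum_congr rfl fun i _ => by ring
    rw [e2]
    ring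
  · have hΘ0 : Y ∉ tsupport Θ := fun h => hY (hsub h)
    have e1 : ∀ e, fderiv ℝ (h e) Y = 0 := fun e =>
      fderiv_of_notMem_tsupport ℝ fun hh => hY (hts e hh)
    beta_reduce
    rw [gradDot, fderiv_of_notMem_tsupport ℝ hΘ0, image_eq_zero_of_notMem_tsupport hΘ0]
    simp [e1]

end CompactTest


/-! ### A smooth step function -/

section Cutoff

/-- A smooth step, `0` on `(-∞, 1]` and `1` on `[2, ∞)`. -/
noncomputable def step (r : ℝ) : ℝ := Real.smoothTransition (r - 1)

lemma contDiff_step {n : WithTop ℕ∞} (hn : n ≤ (⊤ : ℕ∞)) : ContDiff ℝ n step :=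
  (Real.smoothTransition.contDiff (n := ⊤)).of_le hn |>.comp (contDiff_id.sub contDiff_const)

lemma step_zero {r : ℝ} (h : r ≤ 1) : step r = 0 :=
  Real.smoothTransition.zero_of_nonpos (by linarith)

lemma step_one {r : ℝ} (h : 2 ≤ r) : step r = 1 :=
  Real.smoothTransition.one_of_one_le (by linarith)

lemma abs_step_le (r : ℝ) : |step r| ≤ 1 := by
  rw [step, abs_of_nonneg (Real.smoothTransition.nonneg _)]
  exact Real.smoothTransition.le_one _

lemma hasDerivAt_step (r : ℝ) : HasDerivAt step (deriv step r) r :=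
  ((contDiff_step (n := 1) (by norm_cast)).differentiable (by norm_num) r).hasDerivAt

lemma continuous_deriv_step : Continuous (deriv step) :=
  (contDiff_step (n := 1) (by norm_cast)).continuous_deriv (by norm_num)

lemma deriv_step_eq_zero {r : ℝ} (h : r ∉ Icc (1 : ℝ) 2) : deriv step r = 0 := by
  rw [mem_Icc, not_and_or, not_le, not_le] at h
  rcases h with h | h
  · have : step =ᶠ[𝓝 r] fun _ => 0 := by
      filter_upwards [gt_mem_nhds h] with x hx using step_zero (le_of_lt hx)
    rw [this.deriv_eq, deriv_const]
  · have : step =ᶠ[𝓝 r] fun _ => 1 := by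
      filter_upwards [lt_mem_nhds h] with x hx using step_one (le_of_lt hx)
    rw [this.deriv_eq, deriv_const]

lemma integrable_deriv_step : Integrable (deriv step) :=
  continuous_deriv_step.integrable_of_hasCompactSupport
    (HasCompactSupport.intro isCompact_Icc fun _ h => deriv_step_eq_zero h)

lemma integral_deriv_step : ∫ r in Ioi (0 : ℝ), deriv step r = 1 := by
  rw [integral_Ioi_of_hasDerivAt_of_tendsto' (f := step) (m := 1) (fun r _ => hasDerivAt_step r)
    integrable_deriv_step.integrableOn, step_zero (by norm_num), sub_zero]
  refine tendsto_const_nhds.congr' ?_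
  filter_upwards [eventually_ge_atTop 2] with r hr
  exact (step_one hr).symm

end Cutoff

/-! ### Concentration of a cutoff derivative on `x₀ = 0` -/

section BoundaryLimit

variable {G : ℝ × Rd d → ℝ}

lemma integrableOn_halfSpace_of_continuousOn (hG : ContinuousOn G (closedHalfSpace d))
    (hc : HasCompactSupport G) : IntegrableOn G (halfSpace d) := by
  have hK : IsCompact (closedHalfSpace d ∩ tsupport G) :=
    IsCompact.inter_left hc isClosed_closedHalfSpace
  have h1 : IntegrableOn G (closedHalfSpace d ∩ tsupport G) :=
    (hG.mono inter_subset_left).integrableOn_compact hK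
  refine (h1.of_forall_sdiff_eq_zero isClosed_closedHalfSpace.measurableSet fun Y hY => ?_).mono_set
    halfSpace_subset
  by_contra h
  exact hY.2 ⟨hY.1, subset_tsupport _ h⟩

/-- Concentration of a normal derivative of a cutoff at the boundary. -/
lemma tendsto_integral_mul_deriv_step (hG : ContinuousOn G (closedHalfSpace d))
    (hc : HasCompactSupport G) :
    Tendsto (fun ε => ∫ Y in halfSpace d, G Y * (deriv step (Y.1 / ε) / ε)) (𝓝[>] 0)
      (𝓝 (∫ y, G (0, y))) := by
  have hK : IsCompact (closedHalfSpace d ∩ tsupport G) :=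
    IsCompact.inter_left hc isClosed_closedHalfSpace
  obtain ⟨B, hB⟩ := hK.exists_bound_of_continuousOn (hG.mono inter_subset_left)
  obtain ⟨ρ, hρ⟩ := hK.isBounded.subset_closedBall 0
  have hB0 : ∀ Y ∈ closedHalfSpace d, ‖G Y‖ ≤ max B 0 := fun Y hY => by
    by_cases h : G Y = 0
    · simp [h]
    · exact (hB Y ⟨hY, subset_tsupport _ h⟩).trans (le_max_left _ _)
  have hG0 : ∀ Y ∈ closedHalfSpace d, ρ < ‖Y.2‖ → G Y = 0 := fun Y hY h => by
    by_contra hne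
    have h1 := hρ ⟨hY, subset_tsupport _ hne⟩
    rw [mem_closedBall_zero_iff] at h1
    exact absurd ((norm_snd_le Y).trans h1) (not_le.2 h)
  have hmem : ∀ {ε r : ℝ} (_ : 0 < ε) (_ : 0 < r) (y : Rd d), (ε * r, y) ∈ closedHalfSpace d :=
    fun hε hr y => (mul_pos hε hr).le
  set M := ∫ r in Ioi (0 : ℝ), |deriv step r|
  have hrep : ∀ ε : ℝ, 0 < ε →
      Integrable (fun y => ∫ r in Ioi (0 : ℝ), G (ε * r, y) * deriv step r) ∧
      ∫ Y in halfSpace d, G Y * (deriv step (Y.1 / ε) / ε) =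
        ∫ y, ∫ r in Ioi (0 : ℝ), G (ε * r, y) * deriv step r := by
    intro ε hε
    have hcont : ContinuousOn (fun Y => G Y * (deriv step (Y.1 / ε) / ε)) (closedHalfSpace d) :=
      hG.mul ((continuous_deriv_step.comp (continuous_fst.div_const ε)).div_const ε).continuousOn
    have hi := integrableOn_halfSpace_of_continuousOn hcont hc.mul_right
    rw [IntegrableOn, restrict_halfSpace] at hi
    -- Stretching the normal variable by `ε` fixes the profile `deriv step`, of integral one, and
    -- leaves `G (ε r, y)`, which tends to the boundary value.
    have hinner : ∀ y, ∫ r in Ioi (0 : ℝ), G (r, y) * (deriv step (r / ε) / ε) =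
        ∫ r in Ioi (0 : ℝ), G (ε * r, y) * deriv step r := fun y => by
      have := integral_comp_mul_left_Ioi (fun r => G (r, y) * (deriv step (r / ε) / ε)) 0 hε
      rw [mul_zero, smul_eq_mul, eq_inv_mul_iff_mul_eq₀ hε.ne', ← integral_const_mul] at this
      rw [← this]
      refine integral_congr_ae (Eventually.of_forall fun r => ?_)
      beta_reduce
      rw [mul_div_cancel_left₀ _ hε.ne']
      field_simp
    refine ⟨?_, ?_⟩
    · have := hi.integral_prod_right
      simpa only [hinner] using this
    · rw [restrict_halfSpace, integral_prod_symm _ hi]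
      simp only [hinner]
  have hlim : Tendsto (fun ε => ∫ y, ∫ r in Ioi (0 : ℝ), G (ε * r, y) * deriv step r) (𝓝[>] 0)
      (𝓝 (∫ y, G (0, y))) := by
    refine tendsto_integral_filter_of_dominated_convergence
      ((Metric.closedBall (0 : Rd d) ρ).indicator fun _ => max B 0 * M) ?_ ?_ ?_ ?_
    · filter_upwards [self_mem_nhdsWithin] with ε hε
      exact (hrep ε hε).1.aestronglyMeasurable
    · filter_upwards [self_mem_nhdsWithin] with ε (hε : 0 < ε)
      filter_upwards with y
      by_cases hy : y ∈ Metric.closedBall (0 : Rd d) ρ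
      · rw [indicator_of_mem hy, ← integral_const_mul]
        refine norm_integral_le_of_norm_le
          (integrable_deriv_step.abs.integrableOn.const_mul _) ?_
        filter_upwards [self_mem_ae_restrict measurableSet_Ioi] with r (hr : 0 < r)
        rw [norm_mul]
        exact mul_le_mul_of_nonneg_right (hB0 _ (hmem hε hr y)) (norm_nonneg _)
      · rw [indicator_of_notMem hy, norm_le_zero_iff]
        refine setIntegral_eq_zero_of_forall_eq_zero fun r (hr : 0 < r) => ?_
        rw [mem_closedBall_zero_iff, not_le] at hy
        rw [hG0 _ (hmem hε hr y) hy, zero_mul]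
    · exact (integrable_indicator_iff measurableSet_closedBall).2
        (integrableOn_const (measure_closedBall_lt_top.ne))
    · filter_upwards with y
      have h0 : ∫ r in Ioi (0 : ℝ), G (0, y) * deriv step r = G (0, y) := by
        rw [integral_const_mul, integral_deriv_step, mul_one]
      rw [← h0]
      refine tendsto_integral_filter_of_dominated_convergence
        (fun r => max B 0 * |deriv step r|) ?_ ?_
        (integrable_deriv_step.abs.integrableOn.const_mul _) ?_
      · filter_upwards [self_mem_nhdsWithin] with ε (hε : 0 < ε)
        refine ContinuousOn.aestronglyMeasurable ?_ measurableSet_Ioi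
        refine ContinuousOn.mul ?_ continuous_deriv_step.continuousOn
        refine hG.comp (f := fun r : ℝ => (ε * r, y)) (by fun_prop) fun r (hr : 0 < r) => hmem hε hr y
      · filter_upwards [self_mem_nhdsWithin] with ε (hε : 0 < ε)
        filter_upwards [self_mem_ae_restrict measurableSet_Ioi] with r (hr : 0 < r)
        rw [norm_mul]
        exact mul_le_mul_of_nonneg_right (hB0 _ (hmem hε hr y)) (norm_nonneg _)
      · filter_upwards [self_mem_ae_restrict measurableSet_Ioi] with r (hr : 0 < r)
        refine Tendsto.mul_const _ ?_
        have h1 : Tendsto (fun ε : ℝ => (ε * r, y)) (𝓝[>] 0) (𝓝[closedHalfSpace d] (0, y)) := by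
          refine tendsto_nhdsWithin_iff.2 ⟨?_, ?_⟩
          · have : Continuous fun ε : ℝ => (ε * r, y) := by fun_prop
            have := (this.tendsto 0).mono_left (nhdsWithin_le_nhds (s := Ioi 0))
            simpa using this
          · filter_upwards [self_mem_nhdsWithin] with ε (hε : 0 < ε)
            exact hmem hε hr y
        exact (hG (0, y) (le_refl (0 : ℝ))).tendsto.comp h1
  refine hlim.congr' ?_
  filter_upwards [self_mem_nhdsWithin] with ε hε
  exact (hrep ε hε).2.symm

end BoundaryLimit

/-! ### Weak form for compactly supported test functions -/

section WeakForm

variable {a : ℝ} {w φ g φb Fb : ℝ × Rd d → ℝ}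

lemma integrableOn_weight (ha : -1 < a) : IntegrableOn (weight d a) (halfSpace d) := by
  have h1 : IntegrableOn (fun r : ℝ => r ^ a * Real.exp (-(1 / 4) * r ^ 2)) (Ioi 0) :=
    integrableOn_rpow_mul_exp_neg_mul_sq (by norm_num) ha
  have h2 := h1.integrable.mul_prod (integrable_gaussian (d := d) (b := 1 / 4) (by norm_num))
  rw [IntegrableOn, restrict_halfSpace]
  refine h2.congr (Eventually.of_forall fun Y => ?_)
  simp only [weight, sqNorm]
  rw [mul_assoc, ← Real.exp_add]
  ring_nf

lemma gradDot_mul {ψ : ℝ × Rd d → ℝ} {Y : ℝ × Rd d} (hφ : DifferentiableAt ℝ φ Y)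
    (hψ : DifferentiableAt ℝ ψ Y) : gradDot w (fun Y => φ Y * ψ Y) Y =
      ψ Y * gradDot w φ Y + φ Y * gradDot w ψ Y := by
  have h : ∀ e, fderiv ℝ (fun Y => φ Y * ψ Y) Y e = φ Y * fderiv ℝ ψ Y e + ψ Y * fderiv ℝ φ Y e :=
    fun e => by
      have := (hφ.hasFDerivAt.mul hψ.hasFDerivAt).fderiv
      rw [show (fun Y => φ Y * ψ Y) = φ * ψ from rfl, this]
      simp
  simp only [gradDot, h, mul_add, Finset.mul_sum, Finset.sum_add_distrib]
  simp only [← add_assoc]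
  have e1 : ∀ i, fderiv ℝ w Y (eX i) * (φ Y * fderiv ℝ ψ Y (eX i)) =
    φ Y * (fderiv ℝ w Y (eX i) * fderiv ℝ ψ Y (eX i)) := fun i => by ring
  have e2 : ∀ i, fderiv ℝ w Y (eX i) * (ψ Y * fderiv ℝ φ Y (eX i)) =
    ψ Y * (fderiv ℝ w Y (eX i) * fderiv ℝ φ Y (eX i)) := fun i => by ring
  simp only [e1, e2]
  ring

/-- The weak formulation for test functions of compact support in the closed half-space. -/
lemma weak_form_of_hasCompactSupport (hw : ContDiffOn ℝ 2 w (halfSpace d))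
    (hφ : ContDiffOn ℝ 1 φ (halfSpace d))
    (hg : ∀ Y ∈ halfSpace d, dirDeriv2 w Y e₀ + ∑ i, dirDeriv2 w Y (eX i) +
      a / Y.1 * fderiv ℝ w Y e₀ - fderiv ℝ w Y Y / 2 = g Y)
    (hφb : ContinuousOn φb (closedHalfSpace d)) (hφe : ∀ Y ∈ halfSpace d, φb Y = φ Y)
    (hFb : ContinuousOn Fb (closedHalfSpace d))
    (hFe : ∀ Y ∈ halfSpace d, Fb Y = Y.1 ^ a * fderiv ℝ w Y e₀)
    (hc : HasCompactSupport φ) (hcb : HasCompactSupport φb)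
    (hi : IntegrableOn (fun Y => weight d a Y * (g Y * φ Y + gradDot w φ Y)) (halfSpace d)) :
    ∫ Y in halfSpace d, weight d a Y * (g Y * φ Y + gradDot w φ Y) =
      -∫ y, Real.exp (-‖y‖ ^ 2 / 4) * Fb (0, y) * φb (0, y) := by
  set G : ℝ × Rd d → ℝ := fun Y => Real.exp (-sqNorm Y / 4) * Fb Y * φb Y with hGdef
  have hGc : ContinuousOn G (closedHalfSpace d) :=
    ((Continuous.continuousOn (by fun_prop)).mul hFb).mul hφb
  have hGs : HasCompactSupport G := hcb.mul_left
  have hlim2 := tendsto_integral_mul_deriv_step hGc hGs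
  have hlim1 : Tendsto (fun ε => ∫ Y in halfSpace d,
      weight d a Y * (g Y * φ Y + gradDot w φ Y) * step (Y.1 / ε)) (𝓝[>] 0)
      (𝓝 (∫ Y in halfSpace d, weight d a Y * (g Y * φ Y + gradDot w φ Y))) := by
    refine tendsto_integral_filter_of_dominated_convergence
      (fun Y => ‖weight d a Y * (g Y * φ Y + gradDot w φ Y)‖) ?_ ?_ hi.norm ?_
    · refine Eventually.of_forall fun ε => hi.aestronglyMeasurable.mul ?_
      exact (((contDiff_step (n := 0) (by norm_cast)).continuous).comp
        (continuous_fst.div_const ε)).aestronglyMeasurable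
    · refine Eventually.of_forall fun ε => Eventually.of_forall fun Y => ?_
      rw [norm_mul]
      exact mul_le_of_le_one_right (norm_nonneg _) (abs_step_le _)
    · filter_upwards [self_mem_ae_restrict measurableSet_halfSpace] with Y (hY : 0 < Y.1)
      refine tendsto_const_nhds.congr' ?_
      have : ∀ᶠ ε in 𝓝[>] (0 : ℝ), ε < Y.1 / 2 :=
        mem_nhdsWithin_of_mem_nhds (gt_mem_nhds (by positivity))
      filter_upwards [this, self_mem_nhdsWithin] with ε h1 (h2 : 0 < ε)
      rw [step_one, mul_one]
      rw [le_div_iff₀ h2]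
      linarith
  have hsum := hlim1.add hlim2
  -- Multiplying `φ` by `step (Y.1 / ε)` pushes its support off the boundary, so the interior
  -- integration by parts applies. The derivative that falls on the cutoff is the term that
  -- concentrates into the boundary flux as `ε → 0`.
  have hzero : ∀ ε : ℝ, 0 < ε → (∫ Y in halfSpace d,
      weight d a Y * (g Y * φ Y + gradDot w φ Y) * step (Y.1 / ε)) +
      ∫ Y in halfSpace d, G Y * (deriv step (Y.1 / ε) / ε) = 0 := by
    intro ε hε
    have i1 : IntegrableOn (fun Y => weight d a Y * (g Y * φ Y + gradDot w φ Y) * step (Y.1 / ε))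
        (halfSpace d) := by
      refine hi.norm.mono' (hi.aestronglyMeasurable.mul ?_) (Eventually.of_forall fun Y => ?_)
      · exact (((contDiff_step (n := 0) (by norm_cast)).continuous).comp
          (continuous_fst.div_const ε)).aestronglyMeasurable
      · rw [norm_mul]
        exact mul_le_of_le_one_right (norm_nonneg _) (abs_step_le _)
    have i2 : IntegrableOn (fun Y => G Y * (deriv step (Y.1 / ε) / ε)) (halfSpace d) :=
      integrableOn_halfSpace_of_continuousOn (hGc.mul ((continuous_deriv_step.comp
        (continuous_fst.div_const ε)).div_const ε).continuousOn) hGs.mul_right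
    rw [← integral_add i1 i2]
    set ψ : ℝ × Rd d → ℝ := fun Y => step (Y.1 / ε) with hψ
    have hψc : ContDiff ℝ 1 ψ :=
      (contDiff_step (n := 1) (by norm_cast)).comp (contDiff_fst.div_const ε)
    have hψd : ∀ Y e, fderiv ℝ ψ Y e = deriv step (Y.1 / ε) / ε * e.1 := fun Y e => by
      have h1 : HasFDerivAt (fun Y : ℝ × Rd d => Y.1 / ε)
          (ε⁻¹ • ContinuousLinearMap.fst ℝ ℝ (Rd d)) Y := by
        simpa [div_eq_mul_inv] using
          (hasFDerivAt_fst (𝕜 := ℝ) (p := Y)).mul_const (ε⁻¹ : ℝ)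
      have h2 := (hasDerivAt_step (Y.1 / ε)).comp_hasFDerivAt Y h1
      have h3 : fderiv ℝ ψ Y = _ := h2.fderiv
      rw [h3]
      simp
      ring
    have hts : tsupport (fun Y => φ Y * ψ Y) ⊆ halfSpace d := by
      refine (tsupport_mul_subset_right).trans ?_
      have hcl : IsClosed {Y : ℝ × Rd d | ε ≤ Y.1} := isClosed_le continuous_const continuous_fst
      refine (closure_minimal (fun Y hY => ?_) hcl).trans fun Y (hY : ε ≤ Y.1) => hε.trans_le hY
      by_contra h
      exact hY (step_zero ((div_le_one hε).2 (le_of_lt (not_le.1 h))))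
    have key := integral_weight_compact (Θ := fun Y => φ Y * ψ Y) hw (hφ.mul hψc.contDiffOn)
      hc.mul_right hts hg
    rw [← setIntegral_eq_integral_of_forall_compl_eq_zero (s := halfSpace d)] at key
    · rw [← key]
      refine setIntegral_congr_fun measurableSet_halfSpace fun Y hY => ?_
      have hφd : DifferentiableAt ℝ φ Y :=
        (hφ.contDiffAt (isOpen_halfSpace.mem_nhds hY)).differentiableAt (by norm_num)
      rw [gradDot_mul hφd (hψc.differentiable (by norm_num) Y)]
      simp only [gradDot, hψd, weight, hGdef, hφe Y hY, hFe Y hY]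
      simp only [e₀, eX, mul_zero, Finset.sum_const_zero, hψ]
      ring
    · intro Y hY
      have h1 : Y ∉ tsupport fun Y => φ Y * ψ Y := fun h => hY (hts h)
      have h2 : φ Y * ψ Y = 0 :=
        image_eq_zero_of_notMem_tsupport (f := fun Y => φ Y * ψ Y) h1
      rw [gradDot, fderiv_of_notMem_tsupport ℝ h1, h2]
      simp
  have h0 : Tendsto (fun ε : ℝ => (∫ Y in halfSpace d,
      weight d a Y * (g Y * φ Y + gradDot w φ Y) * step (Y.1 / ε)) +
      ∫ Y in halfSpace d, G Y * (deriv step (Y.1 / ε) / ε)) (𝓝[>] 0) (𝓝 0) := by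
    refine tendsto_const_nhds.congr' ?_
    filter_upwards [self_mem_nhdsWithin] with ε hε
    exact (hzero ε hε).symm
  have := tendsto_nhds_unique hsum h0
  rw [eq_neg_of_add_eq_zero_left this]
  congr 1
  refine integral_congr_ae (Eventually.of_forall fun y => ?_)
  simp [hGdef, sqNorm]

end WeakForm


/-! ### Weak form for bounded test functions of finite energy -/

section WeakForm

variable {a : ℝ} {w φ g φb Fb : ℝ × Rd d → ℝ}

lemma abs_gradDot_le (w φ : ℝ × Rd d → ℝ) (Y : ℝ × Rd d) :
    |gradDot w φ Y| ≤ (gradDot w w Y + gradDot φ φ Y) / 2 := by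
  have key : ∀ x y : ℝ, |x * y| ≤ (x * x + y * y) / 2 := fun x y => by
    rw [abs_le]; constructor <;> nlinarith [sq_nonneg (x + y), sq_nonneg (x - y)]
  unfold gradDot
  calc _ ≤ |fderiv ℝ w Y e₀ * fderiv ℝ φ Y e₀| +
        ∑ i, |fderiv ℝ w Y (eX i) * fderiv ℝ φ Y (eX i)| :=
        (abs_add_le _ _).trans (add_le_add_right (Finset.abs_sum_le_sum_abs _ _) _)
    _ ≤ (fderiv ℝ w Y e₀ * fderiv ℝ w Y e₀ + fderiv ℝ φ Y e₀ * fderiv ℝ φ Y e₀) / 2 +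
        ∑ i, (fderiv ℝ w Y (eX i) * fderiv ℝ w Y (eX i) +
          fderiv ℝ φ Y (eX i) * fderiv ℝ φ Y (eX i)) / 2 :=
        add_le_add (key _ _) (Finset.sum_le_sum fun i _ => key _ _)
    _ = _ := by rw [← Finset.sum_div, Finset.sum_add_distrib]; ring

lemma continuousOn_fderiv_apply {k : WithTop ℕ∞} (hk : 1 ≤ k) (hw : ContDiffOn ℝ k w (halfSpace d))
    (e : ℝ × Rd d) : ContinuousOn (fun Y => fderiv ℝ w Y e) (halfSpace d) :=
  (hw.continuousOn_fderiv_of_isOpen isOpen_halfSpace hk).clm_apply continuousOn_const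

lemma continuousOn_gradDot (hw : ContDiffOn ℝ 1 w (halfSpace d))
    (hφ : ContDiffOn ℝ 1 φ (halfSpace d)) : ContinuousOn (gradDot w φ) (halfSpace d) := by
  have h1 := continuousOn_fderiv_apply le_rfl hw
  have h2 := continuousOn_fderiv_apply le_rfl hφ
  exact ((h1 _).mul (h2 _)).add (continuousOn_finsetSum _ fun i _ => (h1 _).mul (h2 _))

lemma integrableOn_weight_gradDot (hw : ContDiffOn ℝ 1 w (halfSpace d))
    (hφ : ContDiffOn ℝ 1 φ (halfSpace d))
    (hiw : IntegrableOn (fun Y => weight d a Y * gradDot w w Y) (halfSpace d))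
    (hiφ : IntegrableOn (fun Y => weight d a Y * gradDot φ φ Y) (halfSpace d)) :
    IntegrableOn (fun Y => weight d a Y * gradDot w φ Y) (halfSpace d) := by
  refine ((hiw.add hiφ).div_const 2).mono' ((measurable_weight a).aestronglyMeasurable.mul
    ((continuousOn_gradDot hw hφ).aestronglyMeasurable measurableSet_halfSpace)) ?_
  filter_upwards [self_mem_ae_restrict measurableSet_halfSpace] with Y hY
  rw [norm_mul, Real.norm_of_nonneg (weight_nonneg a hY), Pi.add_apply, ← mul_add, mul_div_assoc]
  exact mul_le_mul_of_nonneg_left (abs_gradDot_le w φ Y) (weight_nonneg a hY)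

lemma norm_e₀ : ‖(e₀ : ℝ × Rd d)‖ = 1 := by simp [e₀, Prod.norm_def]

lemma norm_eX (i : Fin d) : ‖(eX i : ℝ × Rd d)‖ = 1 := by simp [eX, Prod.norm_def]

/-- The weak formulation, for bounded test functions of finite energy. -/
lemma weak_form (ha : -1 < a) (hw : ContDiffOn ℝ 2 w (halfSpace d))
    (hφ : ContDiffOn ℝ 1 φ (halfSpace d))
    (hg : ∀ Y ∈ halfSpace d, dirDeriv2 w Y e₀ + ∑ i, dirDeriv2 w Y (eX i) +
      a / Y.1 * fderiv ℝ w Y e₀ - fderiv ℝ w Y Y / 2 = g Y)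
    (hφb : ContinuousOn φb (closedHalfSpace d)) (hφe : ∀ Y ∈ halfSpace d, φb Y = φ Y)
    (hFb : ContinuousOn Fb (closedHalfSpace d))
    (hFe : ∀ Y ∈ halfSpace d, Fb Y = Y.1 ^ a * fderiv ℝ w Y e₀)
    {C CF : ℝ} (hC : ∀ Y ∈ halfSpace d, |φ Y| ≤ C)
    (hCb : ∀ y, |φb (0, y)| ≤ C) (hCF : ∀ y, |Fb (0, y)| ≤ CF)
    (hig : IntegrableOn (fun Y => weight d a Y * g Y) (halfSpace d))
    (hiw : IntegrableOn (fun Y => weight d a Y * gradDot w w Y) (halfSpace d))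
    (hiφ : IntegrableOn (fun Y => weight d a Y * gradDot φ φ Y) (halfSpace d)) :
    ∫ Y in halfSpace d, weight d a Y * (g Y * φ Y + gradDot w φ Y) =
      -∫ y, Real.exp (-‖y‖ ^ 2 / 4) * Fb (0, y) * φb (0, y) := by
  have hw1 : ContDiffOn ℝ 1 w (halfSpace d) := hw.of_le (by norm_num)
  have higφ : IntegrableOn (fun Y => weight d a Y * g Y * φ Y) (halfSpace d) := by
    refine hig.mul_bdd (c := C) (hφ.continuousOn.aestronglyMeasurable measurableSet_halfSpace) ?_
    filter_upwards [self_mem_ae_restrict measurableSet_halfSpace] with Y hY using hC Y hY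
  have hiwφ := integrableOn_weight_gradDot hw1 hφ hiw hiφ
  -- The dilates `ζ n` of this bump are `1` on the ball of radius `n + 1` and have derivative of
  -- order `1/(n+1)`. The extra term `φ ∇w·∇ζ n` therefore disappears in the limit, because `φ` is
  -- bounded and `∇w` is integrable against the weight.
  let f : ContDiffBump (0 : ℝ × Rd d) := ⟨1, 2, one_pos, one_lt_two⟩
  have hfc : ContDiff ℝ 1 f := f.contDiff
  obtain ⟨M, hM⟩ : ∃ M, ∀ Y, ‖fderiv ℝ f Y‖ ≤ M :=
    (hfc.continuous_fderiv (by norm_num)).bounded_above_of_compact_support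
      (f.hasCompactSupport.fderiv ℝ)
  have hM0 : 0 ≤ M := (norm_nonneg _).trans (hM 0)
  let c : ℕ → ℝ := fun n => 1 / ((n : ℝ) + 1)
  have hc0 : ∀ n, 0 < c n := fun n => by positivity
  let ζ : ℕ → ℝ × Rd d → ℝ := fun n Y => f (c n • Y)
  have hζc : ∀ n, ContDiff ℝ 1 (ζ n) := fun n => hfc.comp (contDiff_const_smul (c n))
  have hζs : ∀ n, HasCompactSupport (ζ n) := fun n =>
    f.hasCompactSupport.comp_smul (hc0 n).ne'
  have hζ1 : ∀ n Y, |ζ n Y| ≤ 1 := fun n Y => by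
    rw [abs_of_nonneg f.nonneg]; exact f.le_one
  have hζd : ∀ n Y e, ‖e‖ = 1 → |fderiv ℝ (ζ n) Y e| ≤ c n * M := fun n Y e he => by
    have h1 : fderiv ℝ (ζ n) Y = c n • fderiv ℝ f (c n • Y) := fderiv_comp_smul (c n)
    rw [h1, smul_apply, smul_eq_mul, abs_mul, abs_of_pos (hc0 n)]
    refine mul_le_mul_of_nonneg_left ?_ (hc0 n).le
    refine ((fderiv ℝ f (c n • Y)).le_opNorm e).trans ?_
    rw [he, mul_one]
    exact hM _
  have hlimc : Tendsto c atTop (𝓝 0) := tendsto_one_div_add_atTop_nhds_zero_nat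
  have hζlim : ∀ Y, Tendsto (fun n => ζ n Y) atTop (𝓝 1) := fun Y => by
    have h1 : Tendsto (fun n => f (c n • Y)) atTop (𝓝 (f ((0 : ℝ) • Y))) :=
      (f.contDiff (n := 0)).continuous.continuousAt.tendsto.comp (hlimc.smul_const Y)
    rwa [zero_smul, f.one_of_mem_closedBall (Metric.mem_closedBall_self zero_le_one)] at h1
  set W : ℝ × Rd d → ℝ := fun Y => |fderiv ℝ w Y e₀| + ∑ i, |fderiv ℝ w Y (eX i)| with hW
  have hgz : ∀ n Y, |gradDot w (ζ n) Y| ≤ c n * M * W Y := fun n Y => by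
    unfold gradDot
    calc _ ≤ |fderiv ℝ w Y e₀ * fderiv ℝ (ζ n) Y e₀| +
          ∑ i, |fderiv ℝ w Y (eX i) * fderiv ℝ (ζ n) Y (eX i)| :=
          (abs_add_le _ _).trans (add_le_add_right (Finset.abs_sum_le_sum_abs _ _) _)
      _ ≤ |fderiv ℝ w Y e₀| * (c n * M) + ∑ i, |fderiv ℝ w Y (eX i)| * (c n * M) := by
          refine add_le_add ?_ (Finset.sum_le_sum fun i _ => ?_)
          · rw [abs_mul]
            exact mul_le_mul_of_nonneg_left (hζd n Y _ norm_e₀) (abs_nonneg _)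
          · rw [abs_mul]
            exact mul_le_mul_of_nonneg_left (hζd n Y _ (norm_eX i)) (abs_nonneg _)
      _ = _ := by rw [← Finset.sum_mul, hW]; ring
  -- The weight has finite mass because `a > -1`, so square integrability of the gradient gives
  -- integrability, through `|x| ≤ 1 + x²`.
  have hWi : IntegrableOn (fun Y => weight d a Y * W Y) (halfSpace d) := by
    have hdom := ((integrableOn_weight (d := d) ha).mul_const ((1 + d : ℝ))).add hiw
    refine hdom.mono' ((measurable_weight a).aestronglyMeasurable.mul
      (ContinuousOn.aestronglyMeasurable ?_ measurableSet_halfSpace)) ?_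
    · have h1 := continuousOn_fderiv_apply le_rfl hw1
      exact (h1 _).abs.add (continuousOn_finsetSum _ fun i _ => (h1 _).abs)
    · filter_upwards [self_mem_ae_restrict measurableSet_halfSpace] with Y hY
      have hW0 : 0 ≤ W Y := by positivity
      rw [norm_mul, Real.norm_of_nonneg (weight_nonneg a hY), Real.norm_of_nonneg hW0,
        Pi.add_apply, ← mul_add]
      refine mul_le_mul_of_nonneg_left ?_ (weight_nonneg a hY)
      have key : ∀ x : ℝ, |x| ≤ 1 + x * x := fun x => by
        rw [← abs_mul_abs_self x]; nlinarith [sq_nonneg (|x| - 1)]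
      rw [hW, gradDot]
      have h2 := Finset.sum_le_sum fun i (_ : i ∈ Finset.univ) => key (fderiv ℝ w Y (eX i))
      rw [Finset.sum_add_distrib] at h2
      simp only [Finset.sum_const, Finset.card_univ, Fintype.card_fin, nsmul_eq_mul,
        mul_one] at h2
      have := key (fderiv ℝ w Y e₀)
      linarith
  have hbd1 : ∀ n, ∀ Y ∈ halfSpace d, ‖weight d a Y * (φ Y * gradDot w (ζ n) Y)‖ ≤
      c n * (C * M * (weight d a Y * W Y)) := fun n Y hY => by
    have hW0 : 0 ≤ W Y := by positivity
    have hC0 : 0 ≤ C := (abs_nonneg _).trans (hC Y hY)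
    rw [norm_mul, Real.norm_of_nonneg (weight_nonneg a hY), norm_mul]
    calc _ ≤ weight d a Y * (C * (c n * M * W Y)) := by
          refine mul_le_mul_of_nonneg_left ?_ (weight_nonneg a hY)
          exact mul_le_mul (hC Y hY) (hgz n Y) (abs_nonneg _) hC0
      _ = _ := by ring
  have hm1 : ∀ n, AEStronglyMeasurable (fun Y => weight d a Y * (φ Y * gradDot w (ζ n) Y))
      (volume.restrict (halfSpace d)) := fun n =>
    (measurable_weight a).aestronglyMeasurable.mul
      ((hφ.continuousOn.mul (continuousOn_gradDot hw1
        (hζc n).contDiffOn)).aestronglyMeasurable measurableSet_halfSpace)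
  have hi1 : ∀ n, IntegrableOn (fun Y => weight d a Y * (φ Y * gradDot w (ζ n) Y))
      (halfSpace d) := fun n => by
    refine ((hWi.const_mul (C * M)).const_mul (c n)).mono' (hm1 n) ?_
    filter_upwards [self_mem_ae_restrict measurableSet_halfSpace] with Y hY using hbd1 n Y hY
  have hiA : IntegrableOn (fun Y => weight d a Y * (g Y * φ Y + gradDot w φ Y)) (halfSpace d) := by
    refine (higφ.add hiwφ).congr (Eventually.of_forall fun Y => ?_)
    simp only [Pi.add_apply]; ring
  have hζm : ∀ n, AEStronglyMeasurable (ζ n) (volume.restrict (halfSpace d)) := fun n =>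
    (hζc n).continuous.aestronglyMeasurable
  have hiAζ : ∀ n, IntegrableOn
      (fun Y => weight d a Y * (g Y * φ Y + gradDot w φ Y) * ζ n Y) (halfSpace d) := fun n =>
    hiA.mul_bdd (c := 1) (hζm n) (Eventually.of_forall fun Y => hζ1 n Y)
  have hprod : ∀ n, ∀ Y ∈ halfSpace d,
      weight d a Y * (g Y * (φ Y * ζ n Y) + gradDot w (fun Y => φ Y * ζ n Y) Y) =
      weight d a Y * (g Y * φ Y + gradDot w φ Y) * ζ n Y +
        weight d a Y * (φ Y * gradDot w (ζ n) Y) := fun n Y hY => by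
    rw [gradDot_mul ((hφ.contDiffAt (isOpen_halfSpace.mem_nhds hY)).differentiableAt (by norm_num))
      ((hζc n).differentiable (by norm_num) Y)]
    ring
  have hstep : ∀ n, (∫ Y in halfSpace d, weight d a Y * (g Y * φ Y + gradDot w φ Y) * ζ n Y) +
      ∫ Y in halfSpace d, weight d a Y * (φ Y * gradDot w (ζ n) Y) =
      -∫ y, Real.exp (-‖y‖ ^ 2 / 4) * Fb (0, y) * (φb (0, y) * ζ n (0, y)) := fun n => by
    rw [← integral_add (hiAζ n) (hi1 n)]
    rw [← weak_form_of_hasCompactSupport (φ := fun Y => φ Y * ζ n Y)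
      (φb := fun Y => φb Y * ζ n Y) (a := a) hw (hφ.mul (hζc n).contDiffOn) hg
      (hφb.mul (hζc n).continuous.continuousOn) (fun Y hY => by rw [hφe Y hY]) hFb hFe
      (hζs n).mul_left (hζs n).mul_left]
    · exact setIntegral_congr_fun measurableSet_halfSpace fun Y hY => (hprod n Y hY).symm
    · exact ((hiAζ n).add (hi1 n)).congr_fun (fun Y hY => (hprod n Y hY).symm)
        measurableSet_halfSpace
  have hlimA : Tendsto (fun n => ∫ Y in halfSpace d,
      weight d a Y * (g Y * φ Y + gradDot w φ Y) * ζ n Y) atTop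
      (𝓝 (∫ Y in halfSpace d, weight d a Y * (g Y * φ Y + gradDot w φ Y))) := by
    refine tendsto_integral_of_dominated_convergence _ (fun n => (hiAζ n).aestronglyMeasurable)
      hiA.norm (fun n => Eventually.of_forall fun Y => ?_) (Eventually.of_forall fun Y => ?_)
    · rw [norm_mul]
      exact mul_le_of_le_one_right (norm_nonneg _) (hζ1 n Y)
    · simpa using (hζlim Y).const_mul (weight d a Y * (g Y * φ Y + gradDot w φ Y))
  have hlimB : Tendsto (fun n => ∫ Y in halfSpace d,
      weight d a Y * (φ Y * gradDot w (ζ n) Y)) atTop (𝓝 0) := by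
    have h0 : Tendsto (fun n => c n * ∫ Y in halfSpace d, C * M * (weight d a Y * W Y)) atTop
        (𝓝 0) := by simpa using hlimc.mul_const _
    refine squeeze_zero_norm (fun n => ?_) h0
    rw [← integral_const_mul]
    refine norm_integral_le_of_norm_le ((hWi.const_mul (C * M)).const_mul (c n)) ?_
    filter_upwards [self_mem_ae_restrict measurableSet_halfSpace] with Y hY using hbd1 n Y hY
  have hcont : ∀ f : ℝ × Rd d → ℝ, ContinuousOn f (closedHalfSpace d) →
      Continuous fun y => f (0, y) := fun f hf => by
    rw [← continuousOn_univ]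
    exact hf.comp (by fun_prop) fun y _ => le_refl (0 : ℝ)
  have hlimC : Tendsto (fun n => -∫ y, Real.exp (-‖y‖ ^ 2 / 4) * Fb (0, y) *
      (φb (0, y) * ζ n (0, y))) atTop
      (𝓝 (-∫ y, Real.exp (-‖y‖ ^ 2 / 4) * Fb (0, y) * φb (0, y))) := by
    refine Tendsto.neg ?_
    have hgauss := (integrable_gaussian (d := d) (b := 1 / 4) (by norm_num)).mul_const (CF * C)
    refine tendsto_integral_of_dominated_convergence _ (fun n => ?_) hgauss
      (fun n => Eventually.of_forall fun y => ?_) (Eventually.of_forall fun y => ?_)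
    · have h1 := hcont Fb hFb
      have h2 := hcont φb hφb
      have h3 := hcont (ζ n) (hζc n).continuous.continuousOn
      exact (((Continuous.mul (by fun_prop) h1)).mul (h2.mul h3)).aestronglyMeasurable
    · rw [norm_mul, norm_mul, norm_mul, Real.norm_of_nonneg (Real.exp_pos _).le,
        show -‖y‖ ^ 2 / 4 = -(1 / 4) * ‖y‖ ^ 2 by ring, mul_assoc]
      refine mul_le_mul_of_nonneg_left ?_ (Real.exp_pos _).le
      have hCF0 : 0 ≤ CF := (abs_nonneg _).trans (hCF y)
      have hC0 : 0 ≤ C := (abs_nonneg _).trans (hCb y)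
      refine mul_le_mul (hCF y) ?_ (by positivity) hCF0
      exact (mul_le_of_le_one_right (norm_nonneg _) (hζ1 n _)).trans (hCb y)
    · have := ((hζlim (0, y)).const_mul (φb (0, y))).const_mul
        (Real.exp (-‖y‖ ^ 2 / 4) * Fb (0, y))
      simpa using this
  have h1 := hlimA.add hlimB
  rw [add_zero] at h1
  simp only [hstep] at h1
  exact tendsto_nhds_unique h1 hlimC

end WeakForm


/-! ### Weighted trace inequalities -/

section Trace

/-- The choice `l = x / P` balances the two terms; this recovers the Cauchy-Schwarz inequality from
a family of Young inequalities. -/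
lemma sq_le_mul_of_forall_le {x P Q : ℝ} (hP : 0 < P) (hQ : 0 ≤ Q) (hx : 0 ≤ x)
    (h : ∀ l : ℝ, 0 < l → x ≤ (l * P + l⁻¹ * Q) / 2) : x ^ 2 ≤ P * Q := by
  rcases hx.eq_or_lt with rfl | hx
  · have := mul_nonneg hP.le hQ; simpa using this
  · have := h (x / P) (by positivity)
    rw [div_mul_cancel₀ _ hP.ne', inv_div] at this
    have h2 : x ≤ P / x * Q := by linarith
    rw [div_mul_eq_mul_div, le_div_iff₀ hx] at h2
    nlinarith

/-- The Cauchy-Schwarz inequality with a weight. -/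
lemma sq_integral_abs_le {Ω : Type*} [MeasurableSpace Ω] {μ : Measure Ω} {f ρ : Ω → ℝ}
    (hρ : ∀ᵐ x ∂μ, 0 < ρ x) (hf : Integrable f μ) (h1 : Integrable (fun x => (ρ x)⁻¹) μ)
    (h2 : Integrable (fun x => ρ x * f x ^ 2) μ) :
    (∫ x, |f x| ∂μ) ^ 2 ≤ (∫ x, (ρ x)⁻¹ ∂μ) * ∫ x, ρ x * f x ^ 2 ∂μ := by
  by_cases hμ : μ = 0
  · simp [hμ]
  have hP : 0 < ∫ x, (ρ x)⁻¹ ∂μ := by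
    rw [integral_pos_iff_support_of_nonneg_ae (hρ.mono fun x hx => (inv_pos.2 hx).le) h1]
    refine pos_iff_ne_zero.2 fun h0 => hμ ?_
    rw [← Measure.measure_univ_eq_zero]
    refine le_antisymm ((measure_mono_ae ?_).trans_eq h0) bot_le
    filter_upwards [hρ] with x hx _ using (inv_pos.2 hx).ne'
  have hQ : 0 ≤ ∫ x, ρ x * f x ^ 2 ∂μ :=
    integral_nonneg_of_ae (hρ.mono fun x hx => mul_nonneg hx.le (sq_nonneg _))
  refine sq_le_mul_of_forall_le hP hQ (integral_nonneg fun x => abs_nonneg _) fun l hl => ?_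
  rw [← integral_const_mul, ← integral_const_mul, ← integral_add (h1.const_mul _) (h2.const_mul _),
    ← integral_div]
  refine integral_mono_ae hf.abs (((h1.const_mul _).add (h2.const_mul _)).div_const 2) ?_
  filter_upwards [hρ] with x hx
  have key : 0 ≤ (l * (ρ x)⁻¹ - |f x|) ^ 2 := sq_nonneg _
  have e : l * (ρ x)⁻¹ + l⁻¹ * (ρ x * f x ^ 2) - 2 * |f x| =
      (l * (ρ x)⁻¹ - |f x|) ^ 2 * (l⁻¹ * ρ x) := by
    rw [sub_sq, sq_abs]
    field_simp
    ring
  have : 0 ≤ (l * (ρ x)⁻¹ - |f x|) ^ 2 * (l⁻¹ * ρ x) := by positivity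
  rw [le_div_iff₀ two_pos]
  linarith

/-- The weighted trace inequality on an interval. -/
lemma trace_interval {a k B : ℝ} (ha : -1 < a) (ha1 : a < 1) (hk : 0 < k) {Z Z' : ℝ → ℝ}
    (hZ : ContinuousOn Z (Ici 0)) (hd : ∀ r, 0 < r → HasDerivAt Z (Z' r) r)
    (hZ' : ContinuousOn Z' (Ioi 0)) (hB : ∀ r ∈ Ioc 0 k, |r ^ a * Z' r| ≤ B) :
    Z 0 ^ 2 ≤ 2 * (1 + a) * k ^ (-(1 + a)) * (∫ r in Ioc 0 k, r ^ a * Z r ^ 2) +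
      2 / (1 - a) * k ^ (1 - a) * ∫ r in Ioc 0 k, r ^ a * Z' r ^ 2 := by
  have hpow : ∀ {b : ℝ}, -1 < b → IntegrableOn (fun r : ℝ => r ^ b) (Ioc 0 k) := fun hb =>
    (intervalIntegrable_iff_integrableOn_Ioc_of_le hk.le).1
      (intervalIntegral.intervalIntegrable_rpow' hb)
  have hpowi : ∀ {b : ℝ}, -1 < b → ∫ r in Ioc 0 k, r ^ b = k ^ (b + 1) / (b + 1) := fun {b} hb => by
    rw [← intervalIntegral.integral_of_le hk.le, integral_rpow (Or.inl hb),
      Real.zero_rpow (by linarith), sub_zero]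
  have hsub : Ioc 0 k ⊆ Ioi (0 : ℝ) := fun r hr => hr.1
  have mZ' : AEStronglyMeasurable Z' (volume.restrict (Ioc 0 k)) :=
    (hZ'.mono hsub).aestronglyMeasurable measurableSet_Ioc
  have mp : ∀ b : ℝ, AEStronglyMeasurable (fun r : ℝ => r ^ b) (volume.restrict (Ioc 0 k)) :=
    fun b => (Measurable.aestronglyMeasurable (by fun_prop))
  have hB' : ∀ r ∈ Ioc 0 k, |Z' r| ≤ B * r ^ (-a) := fun r hr => by
    have hr0 : 0 < r ^ a := Real.rpow_pos_of_pos hr.1 _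
    have := hB r hr
    rw [abs_mul, abs_of_pos hr0] at this
    rw [Real.rpow_neg hr.1.le, ← div_eq_mul_inv, le_div_iff₀ hr0]
    linarith
  have i1 : IntegrableOn Z' (Ioc 0 k) := by
    refine ((hpow (b := -a) (by linarith)).const_mul B).mono' mZ' ?_
    filter_upwards [self_mem_ae_restrict measurableSet_Ioc] with r hr using hB' r hr
  have i2 : IntegrableOn (fun r => r ^ a * Z' r ^ 2) (Ioc 0 k) := by
    refine ((hpow (b := -a) (by linarith)).const_mul (B * B)).mono' ((mp a).mul (mZ'.pow 2)) ?_
    filter_upwards [self_mem_ae_restrict measurableSet_Ioc] with r hr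
    have hB0 : 0 ≤ B := (abs_nonneg _).trans (hB r hr)
    rw [show r ^ a * Z' r ^ 2 = (r ^ a * Z' r) * Z' r by ring, norm_mul, mul_assoc]
    exact mul_le_mul (hB r hr) (hB' r hr) (abs_nonneg _) hB0
  obtain ⟨BZ, hBZ⟩ := isCompact_Icc.exists_bound_of_continuousOn
    (hZ.mono (fun r (hr : r ∈ Icc 0 k) => hr.1))
  have i3 : IntegrableOn (fun r => r ^ a * Z r ^ 2) (Ioc 0 k) := by
    refine (hpow ha).mul_bdd (c := BZ ^ 2)
      (((hZ.mono fun r (hr : r ∈ Ioc 0 k) => hr.1.le).aestronglyMeasurable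
        measurableSet_Ioc).pow 2) ?_
    filter_upwards [self_mem_ae_restrict measurableSet_Ioc] with r hr
    rw [norm_pow]
    exact pow_le_pow_left₀ (norm_nonneg _) (hBZ r ⟨hr.1.le, hr.2⟩) 2
  set E := ∫ r in Ioc 0 k, r ^ a * Z' r ^ 2 with hE
  -- Cauchy-Schwarz with weight `r^a`; the dual factor `∫ r^{-a}` over `(0,k]` is finite because `a
  -- < 1`.
  have hCS : (∫ r in Ioc 0 k, |Z' r|) ^ 2 ≤ k ^ (1 - a) / (1 - a) * E := by
    have hρ : ∀ᵐ r ∂volume.restrict (Ioc 0 k), 0 < r ^ a := by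
      filter_upwards [self_mem_ae_restrict measurableSet_Ioc] with r hr
        using Real.rpow_pos_of_pos hr.1 _
    have hinv : ∀ r ∈ Ioc 0 k, (r ^ a)⁻¹ = r ^ (-a) := fun r hr => (Real.rpow_neg hr.1.le _).symm
    have := sq_integral_abs_le hρ i1
      ((hpow (b := -a) (by linarith)).congr_fun (fun r hr => (hinv r hr).symm) measurableSet_Ioc) i2
    rwa [setIntegral_congr_fun measurableSet_Ioc hinv, hpowi (by linarith),
      show -a + 1 = 1 - a by ring] at this
  -- The value at `0` is compared with the value at every `r ≤ k`, and the result is then averaged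
  -- against `r^a`. The gradient term comes out with the factor `k^{1-a}`, which is small for small
  -- `k`; the price is the large factor `k^{-(1+a)}` on the mass term.
  have hpt : ∀ r ∈ Ioc 0 k, Z 0 ^ 2 ≤ 2 * Z r ^ 2 + 2 * (k ^ (1 - a) / (1 - a) * E) := by
    intro r hr
    have hii : IntervalIntegrable Z' volume 0 r :=
      (intervalIntegrable_iff_integrableOn_Ioc_of_le hr.1.le).2
        (i1.mono_set (Ioc_subset_Ioc_right hr.2))
    have hftc := intervalIntegral.integral_eq_sub_of_hasDerivAt_of_le hr.1.le
      (hZ.mono fun x (hx : x ∈ Icc 0 r) => hx.1) (fun x hx => hd x hx.1) hii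
    have hle : |Z r - Z 0| ≤ ∫ r in Ioc 0 k, |Z' r| := by
      rw [← hftc, intervalIntegral.integral_of_le hr.1.le]
      refine (abs_integral_le_integral_abs).trans ?_
      exact setIntegral_mono_set i1.abs (Eventually.of_forall fun _ => abs_nonneg _)
        (Ioc_subset_Ioc_right hr.2).eventuallyLE
    have h2 : (Z r - Z 0) ^ 2 ≤ k ^ (1 - a) / (1 - a) * E := by
      rw [← sq_abs]
      exact (pow_le_pow_left₀ (abs_nonneg _) hle 2).trans hCS
    nlinarith [sq_nonneg (2 * Z r - Z 0)]
  have hint : k ^ (a + 1) / (a + 1) * Z 0 ^ 2 ≤ 2 * (∫ r in Ioc 0 k, r ^ a * Z r ^ 2) +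
      k ^ (a + 1) / (a + 1) * (2 * (k ^ (1 - a) / (1 - a) * E)) := by
    rw [← hpowi ha, ← integral_mul_const, ← integral_mul_const, ← integral_const_mul,
      ← integral_add (i3.const_mul 2) ((hpow ha).mul_const _)]
    refine setIntegral_mono_on ((hpow ha).mul_const _)
      ((i3.const_mul 2).add ((hpow ha).mul_const _)) measurableSet_Ioc fun r hr => ?_
    have hr0 : 0 ≤ r ^ a := Real.rpow_nonneg hr.1.le _
    have := mul_le_mul_of_nonneg_left (hpt r hr) hr0
    linarith
  have hka : 0 < k ^ (a + 1) := Real.rpow_pos_of_pos hk _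
  have ha1' : 0 < a + 1 := by linarith
  have h1a : 1 - a ≠ 0 := by linarith
  rw [show -(1 + a) = -(a + 1) by ring, Real.rpow_neg hk.le]
  have hmul := mul_le_mul_of_nonneg_left hint
    (by positivity : 0 ≤ (a + 1) * (k ^ (a + 1))⁻¹)
  have e1 : (a + 1) * (k ^ (a + 1))⁻¹ * (k ^ (a + 1) / (a + 1) * Z 0 ^ 2) = Z 0 ^ 2 := by
    field_simp
  rw [e1] at hmul
  refine hmul.trans_eq ?_
  field_simp
  ring

/-- The weighted trace inequality on the half-space. -/
lemma trace_halfSpace {a k : ℝ} (ha : -1 < a) (ha1 : a < 1) (hk : 0 < k) (hk1 : k ≤ 1)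
    {Z Zb Fb : ℝ × Rd d → ℝ} (hZ : ContDiffOn ℝ 1 Z (halfSpace d))
    (hZb : ContinuousOn Zb (closedHalfSpace d)) (hZe : ∀ Y ∈ halfSpace d, Zb Y = Z Y)
    (hFb : ContinuousOn Fb (closedHalfSpace d))
    (hFe : ∀ Y ∈ halfSpace d, Fb Y = Y.1 ^ a * fderiv ℝ Z Y e₀)
    (hi0 : Integrable fun y : Rd d => Real.exp (-‖y‖ ^ 2 / 4) * Zb (0, y) ^ 2)
    (hi1 : IntegrableOn (fun Y => weight d a Y * Z Y ^ 2) (halfSpace d))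
    (hi2 : IntegrableOn (fun Y => weight d a Y * fderiv ℝ Z Y e₀ ^ 2) (halfSpace d)) :
    ∫ y, Real.exp (-‖y‖ ^ 2 / 4) * Zb (0, y) ^ 2 ≤
      Real.exp (1 / 4) * (2 * (1 + a) * k ^ (-(1 + a))) *
        (∫ Y in halfSpace d, weight d a Y * Z Y ^ 2) +
      Real.exp (1 / 4) * (2 / (1 - a) * k ^ (1 - a)) *
        ∫ Y in halfSpace d, weight d a Y * fderiv ℝ Z Y e₀ ^ 2 := by
  set c1 := 2 * (1 + a) * k ^ (-(1 + a)) with hc1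
  set c2 := 2 / (1 - a) * k ^ (1 - a) with hc2
  have hc10 : 0 ≤ c1 := by
    have : 0 ≤ 1 + a := by linarith
    positivity
  have hc20 : 0 ≤ c2 := by
    have : 0 ≤ 1 - a := by linarith
    positivity
  rw [IntegrableOn, restrict_halfSpace] at hi1 hi2
  rw [restrict_halfSpace, integral_prod_symm _ hi1, integral_prod_symm _ hi2,
    ← integral_const_mul, ← integral_const_mul,
    ← integral_add (hi1.integral_prod_right.const_mul _) (hi2.integral_prod_right.const_mul _)]
  refine integral_mono_ae hi0 ((hi1.integral_prod_right.const_mul _).add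
    (hi2.integral_prod_right.const_mul _)) ?_
  filter_upwards [hi1.prod_left_ae, hi2.prod_left_ae] with y hy1 hy2
  have hder : ∀ r : ℝ, 0 < r → HasDerivAt (fun r => Zb (r, y)) (fderiv ℝ Z (r, y) e₀) r := by
    intro r hr
    have h1 : HasFDerivAt Z (fderiv ℝ Z (r, y)) (r, y) :=
      ((hZ.contDiffAt (isOpen_halfSpace.mem_nhds hr)).differentiableAt (by norm_num)).hasFDerivAt
    have h2 : HasDerivAt (fun r : ℝ => (r, y)) (e₀ : ℝ × Rd d) r :=
      (hasDerivAt_id' r).prodMk (hasDerivAt_const r y)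
    refine (h1.comp_hasDerivAt r h2).congr_of_eventuallyEq ?_
    filter_upwards [lt_mem_nhds hr] with r' hr'
    exact hZe (r', y) hr'
  have hcZ : ContinuousOn (fun r => Zb (r, y)) (Ici 0) :=
    hZb.comp (by fun_prop) fun r hr => hr
  have hcZ' : ContinuousOn (fun r => fderiv ℝ Z (r, y) e₀) (Ioi 0) :=
    (continuousOn_fderiv_apply le_rfl hZ e₀).comp (f := fun r : ℝ => (r, y)) (by fun_prop)
      fun r hr => hr
  obtain ⟨B, hB⟩ := isCompact_Icc.exists_bound_of_continuousOn
    (hFb.comp (f := fun r : ℝ => (r, y)) (s := Icc 0 k) (by fun_prop) fun r hr => hr.1)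
  have htr := trace_interval ha ha1 hk hcZ hder hcZ' (B := B) fun r hr => by
    have h3 := hB r ⟨hr.1.le, hr.2⟩
    rwa [Function.comp_apply, hFe (r, y) hr.1] at h3
  -- Since `k ≤ 1`, on the strip `0 < r ≤ k` the boundary Gaussian exceeds the interior one by a
  -- factor of at most `e^{1/4}`, hence the constant.
  have hcomp : ∀ f : ℝ → ℝ, (∀ r, 0 < r → 0 ≤ f r) →
      Integrable (fun r => weight d a (r, y) * f r) (volume.restrict (Ioi 0)) →
      Real.exp (-‖y‖ ^ 2 / 4) * ∫ r in Ioc 0 k, r ^ a * f r ≤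
        Real.exp (1 / 4) * ∫ r in Ioi 0, weight d a (r, y) * f r := by
    intro f hf hi
    rw [← integral_const_mul, ← integral_const_mul]
    have hnn : ∀ᵐ r ∂volume.restrict (Ioi (0 : ℝ)),
        0 ≤ Real.exp (1 / 4) * (weight d a (r, y) * f r) := by
      filter_upwards [self_mem_ae_restrict measurableSet_Ioi] with r (hr : 0 < r)
      exact mul_nonneg (Real.exp_pos _).le
        (mul_nonneg (weight_nonneg (Y := (r, y)) a hr) (hf r hr))
    refine le_trans ?_ (setIntegral_mono_set (s := Ioc 0 k) (hi.const_mul _) hnn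
      (LE.le.eventuallyLE fun r hr => hr.1))
    refine integral_mono_of_nonneg ?_ ((hi.const_mul _).mono_measure
      (Measure.restrict_mono (fun r hr => hr.1) le_rfl)) ?_
    · filter_upwards [self_mem_ae_restrict measurableSet_Ioc] with r hr
      exact mul_nonneg (Real.exp_pos _).le (mul_nonneg (Real.rpow_nonneg hr.1.le _) (hf r hr.1))
    · filter_upwards [self_mem_ae_restrict measurableSet_Ioc] with r hr
      have hra : 0 ≤ r ^ a * f r := mul_nonneg (Real.rpow_nonneg hr.1.le _) (hf r hr.1)
      have hexp : Real.exp (-‖y‖ ^ 2 / 4) ≤ Real.exp (1 / 4) * Real.exp (-sqNorm (r, y) / 4) := by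
        rw [← Real.exp_add, Real.exp_le_exp, sqNorm]
        have : r ^ 2 ≤ 1 := by nlinarith [hr.1, hr.2]
        simp only
        linarith
      calc Real.exp (-‖y‖ ^ 2 / 4) * (r ^ a * f r) ≤
          Real.exp (1 / 4) * Real.exp (-sqNorm (r, y) / 4) * (r ^ a * f r) := by gcongr
        _ = _ := by simp only [weight]; ring
  have hZeq : ∀ r ∈ Ioc 0 k, r ^ a * Zb (r, y) ^ 2 = r ^ a * Z (r, y) ^ 2 := fun r hr => by
    rw [hZe (r, y) hr.1]
  rw [setIntegral_congr_fun measurableSet_Ioc hZeq] at htr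
  have k1 := hcomp (fun r => Z (r, y) ^ 2) (fun r _ => sq_nonneg _) hy1
  have k2 := hcomp (fun r => fderiv ℝ Z (r, y) e₀ ^ 2) (fun r _ => sq_nonneg _) hy2
  beta_reduce at k1 k2
  calc _ ≤ Real.exp (-‖y‖ ^ 2 / 4) * (c1 * (∫ r in Ioc 0 k, r ^ a * Z (r, y) ^ 2) +
        c2 * ∫ r in Ioc 0 k, r ^ a * fderiv ℝ Z (r, y) e₀ ^ 2) := by gcongr
    _ = c1 * (Real.exp (-‖y‖ ^ 2 / 4) * ∫ r in Ioc 0 k, r ^ a * Z (r, y) ^ 2) +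
        c2 * (Real.exp (-‖y‖ ^ 2 / 4) * ∫ r in Ioc 0 k, r ^ a * fderiv ℝ Z (r, y) e₀ ^ 2) := by
          ring
    _ ≤ c1 * (Real.exp (1 / 4) * ∫ r in Ioi 0, weight d a (r, y) * Z (r, y) ^ 2) +
        c2 * (Real.exp (1 / 4) * ∫ r in Ioi 0, weight d a (r, y) * fderiv ℝ Z (r, y) e₀ ^ 2) := by
          gcongr
    _ = _ := by ring

end Trace

/-! ### The energy identity through increments -/

section Energy

open scoped InnerProductSpace

/-- Differentiability of an energy along a gradient flow, in terms of increments. -/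
lemma hasDerivAt_energy {H : Type*} [NormedAddCommGroup H] [InnerProductSpace ℝ H] {V Vt : ℝ → H}
    {β S : ℝ → ℝ → ℝ} {Ψ Q : ℝ → ℝ} {t₀ L δ A : ℝ} (hL : 0 ≤ L) (hA : 0 ≤ A) (hδ : 0 ≤ δ)
    (hLδ : L * δ ≤ 1 / 2)
    (hV : HasDerivAt V (Vt t₀) t₀) (hVt : ContinuousAt Vt t₀)
    (hsymm : ∀ᶠ t in 𝓝 t₀, β t t₀ = β t₀ t)
    (h1 : ∀ᶠ t in 𝓝 t₀, β t t = t * ⟪Vt t, V t⟫_ℝ + S t t)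
    (h2 : ∀ᶠ t in 𝓝 t₀, β t t₀ = t * ⟪Vt t, V t₀⟫_ℝ + S t t₀)
    (h3 : ∀ᶠ t in 𝓝 t₀, β t₀ t = t₀ * ⟪Vt t₀, V t⟫_ℝ + S t₀ t)
    (hS1 : ∀ᶠ t in 𝓝 t₀, |S t t - S t t₀ - S t₀ t + S t₀ t₀| ≤ L * Q t)
    (hS2 : ∀ᶠ t in 𝓝 t₀,
      |(S t t - S t t₀ + S t₀ t - S t₀ t₀) / 2 - (Ψ t - Ψ t₀)| ≤ L * Q t)
    (hQ : ∀ᶠ t in 𝓝 t₀, Q t ≤ δ * (β t t - 2 * β t₀ t + β t₀ t₀) + A * ‖V t - V t₀‖ ^ 2) :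
    HasDerivAt (fun t => β t t / 2 - Ψ t) (t₀ * ‖Vt t₀‖ ^ 2) t₀ := by
  have h0 : β t₀ t₀ = t₀ * ⟪Vt t₀, V t₀⟫_ℝ + S t₀ t₀ := h1.self_of_nhds
  set D : ℝ → H := fun t => t • Vt t - t₀ • Vt t₀ with hD
  have hD0 : Tendsto D (𝓝 t₀) (𝓝 0) := by
    have : ContinuousAt D t₀ := (continuousAt_id.smul hVt).sub continuousAt_const
    have h := this.tendsto
    simpa [hD] using h
  have hZO : (fun t => V t - V t₀) =O[𝓝 t₀] fun t => t - t₀ := hV.isBigO_sub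
  have hrem : (fun t => V t - V t₀ - (t - t₀) • Vt t₀) =o[𝓝 t₀] fun t => t - t₀ :=
    hasDerivAt_iff_isLittleO.1 hV
  -- `D` tends to zero by continuity of the derivative and the increment of `V` is `O(t - t₀)`, so
  -- the product is of smaller order. Every error term is reduced to this one, to the squared
  -- increment, or to the Taylor remainder of `V`.
  have hDZ : (fun t => ‖D t‖ * ‖V t - V t₀‖) =o[𝓝 t₀] fun t => t - t₀ := by
    have hDo : (fun t => ‖D t‖) =o[𝓝 t₀] fun _ => (1 : ℝ) :=
      (Asymptotics.isLittleO_one_iff ℝ).2 (by simpa using hD0.norm)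
    simpa using hDo.mul_isBigO hZO.norm_left
  have hZZ : (fun t => ‖V t - V t₀‖ ^ 2) =o[𝓝 t₀] fun t => t - t₀ := by
    have hZo : (fun t => ‖V t - V t₀‖) =o[𝓝 t₀] fun _ => (1 : ℝ) := by
      refine (Asymptotics.isLittleO_one_iff ℝ).2 ?_
      have := (hV.continuousAt.sub (continuousAt_const (y := V t₀))).norm.tendsto
      simpa using this
    simpa [sq] using hZo.mul_isBigO hZO.norm_left
  rw [hasDerivAt_iff_isLittleO]
  have hbound : (fun t => (2 * L * δ + 1) * (‖D t‖ * ‖V t - V t₀‖) +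
      (2 * L * δ * (L * A) + L * A) * ‖V t - V t₀‖ ^ 2 +
      ‖t₀ • Vt t₀‖ * ‖V t - V t₀ - (t - t₀) • Vt t₀‖) =o[𝓝 t₀] fun t => t - t₀ :=
    ((hDZ.const_mul_left _).add (hZZ.const_mul_left _)).add (hrem.norm_left.const_mul_left _)
  refine (Asymptotics.IsBigO.of_bound 1 ?_).trans_isLittleO hbound
  filter_upwards [hsymm, h1, h2, h3, hS1, hS2, hQ] with t hsymm h1 h2 h3 hS1 hS2 hQ
  set Z := V t - V t₀ with hZ
  have hDi : |⟪D t, Z⟫_ℝ| ≤ ‖D t‖ * ‖Z‖ := abs_real_inner_le_norm _ _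
  -- The quadratic form of the increment, expressed by the weak identities alone: no derivative of
  -- `V` is ever used as a test function.
  have hN : β t t - 2 * β t₀ t + β t₀ t₀ =
      ⟪D t, Z⟫_ℝ + (S t t - S t t₀ - S t₀ t + S t₀ t₀) := by
    rw [two_mul]
    nth_rewrite 1 [← hsymm]
    rw [h1, h2, h3, h0, hD, hZ]
    simp only [inner_sub_left, inner_sub_right, real_inner_smul_left]
    ring
  set N := β t t - 2 * β t₀ t + β t₀ t₀
  -- Absorption: `hS1` and `hQ` bound the boundary part by `L δ N + L A ‖Z‖²`, and `L δ ≤ 1/2` lets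
  -- half of `N` move to the left. As `N` carries no sign assumption, the case of negative `N` is
  -- separate.
  have hN1 : N ≤ 2 * (‖D t‖ * ‖Z‖) + 2 * (L * A) * ‖Z‖ ^ 2 ∨ N ≤ 0 := by
    by_cases hNpos : 0 ≤ N
    · left
      have e1 := (abs_le.1 hDi).2
      have e2 := (abs_le.1 hS1).2
      have e3 := mul_le_mul_of_nonneg_left hQ hL
      have e4 := mul_le_mul_of_nonneg_right hLδ hNpos
      linarith
    · right; linarith
  have hLQ : L * Q t ≤ 2 * L * δ * (‖D t‖ * ‖Z‖) + (2 * L * δ * (L * A) + L * A) * ‖Z‖ ^ 2 := by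
    have e3 := mul_le_mul_of_nonneg_left hQ hL
    have e4 : N ≤ 2 * (‖D t‖ * ‖Z‖) + 2 * (L * A) * ‖Z‖ ^ 2 := by
      rcases hN1 with h | h
      · exact h
      · exact h.trans (by positivity)
    have e5 := mul_le_mul_of_nonneg_left e4 (mul_nonneg hL hδ)
    linarith
  -- Written with `t Vt(t) + t₀ Vt(t₀) = D + 2 t₀ Vt(t₀)`: the main term is `⟨t₀ Vt(t₀), Z⟩`, and
  -- the last bracket is the trapezoidal defect controlled by `hS2`.
  have hmain : β t t / 2 - Ψ t - (β t₀ t₀ / 2 - Ψ t₀) - (t - t₀) * (t₀ * ‖Vt t₀‖ ^ 2) =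
      ⟪D t, Z⟫_ℝ / 2 + ⟪t₀ • Vt t₀, Z - (t - t₀) • Vt t₀⟫_ℝ +
      ((S t t - S t t₀ + S t₀ t - S t₀ t₀) / 2 - (Ψ t - Ψ t₀)) := by
    have e : β t t - β t₀ t₀ = (β t t - β t t₀) + (β t₀ t - β t₀ t₀) := by rw [hsymm]; ring
    have e' : β t t / 2 - Ψ t - (β t₀ t₀ / 2 - Ψ t₀) = (β t t - β t₀ t₀) / 2 - (Ψ t - Ψ t₀) := by
      ring
    rw [e', e, h1, h2, h3, h0, hD, hZ, ← real_inner_self_eq_norm_sq]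
    simp only [inner_sub_left, inner_sub_right, real_inner_smul_left, real_inner_smul_right]
    ring
  rw [smul_eq_mul, hmain, one_mul, Real.norm_eq_abs, Real.norm_eq_abs]
  refine le_trans ?_ (le_abs_self _)
  have hr : |⟪t₀ • Vt t₀, Z - (t - t₀) • Vt t₀⟫_ℝ| ≤
      ‖t₀ • Vt t₀‖ * ‖Z - (t - t₀) • Vt t₀‖ := abs_real_inner_le_norm _ _
  calc _ ≤ |⟪D t, Z⟫_ℝ / 2| + |⟪t₀ • Vt t₀, Z - (t - t₀) • Vt t₀⟫_ℝ| +
        |(S t t - S t t₀ + S t₀ t - S t₀ t₀) / 2 - (Ψ t - Ψ t₀)| := abs_add_three _ _ _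
    _ ≤ ‖D t‖ * ‖Z‖ + ‖t₀ • Vt t₀‖ * ‖Z - (t - t₀) • Vt t₀‖ +
        (2 * L * δ * (‖D t‖ * ‖Z‖) + (2 * L * δ * (L * A) + L * A) * ‖Z‖ ^ 2) := by
        refine add_le_add (add_le_add ?_ hr) (hS2.trans hLQ)
        rw [abs_div, abs_two]
        have := abs_nonneg ⟪D t, Z⟫_ℝ
        linarith
    _ = _ := by ring

end Energy

/-! ### Lipschitz and trapezoidal bounds for `|x|^{p-1} x` -/

section Nonlinearity

variable {p : ℝ}

lemma hasDerivAt_powerNonlinearity (hp : 1 < p) (x : ℝ) :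
    HasDerivAt (fun x : ℝ => |x| ^ (p - 1) * x) (p * |x| ^ (p - 1)) x := by
  rcases eq_or_ne x 0 with rfl | hx
  · rw [abs_zero, Real.zero_rpow (by linarith), mul_zero, hasDerivAt_iff_isLittleO]
    simp only [sub_zero, mul_zero, smul_zero]
    have h : (fun x : ℝ => |x| ^ (p - 1)) =o[𝓝 0] fun _ => (1 : ℝ) := by
      refine (Asymptotics.isLittleO_one_iff ℝ).2 ?_
      have : Continuous fun x : ℝ => |x| ^ (p - 1) :=
        continuous_abs.rpow_const fun _ => Or.inr (by linarith)
      have h := this.tendsto 0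
      rwa [abs_zero, Real.zero_rpow (by linarith)] at h
    simpa using h.mul_isBigO (Asymptotics.isBigO_refl (fun x : ℝ => x) (𝓝 0))
  · have h1 : HasDerivAt (fun x : ℝ => |x| ^ (p - 1)) (SignType.sign x * (p - 1) *
        |x| ^ (p - 1 - 1)) x := (hasDerivAt_abs hx).rpow_const (Or.inl (abs_ne_zero.2 hx))
    refine (h1.mul (hasDerivAt_id' x)).congr_deriv ?_
    rw [Real.rpow_sub_one (abs_ne_zero.2 hx)]
    have h2 : (SignType.sign x : ℝ) * x = |x| := sign_mul_self x
    have h3 : |x| ≠ 0 := abs_ne_zero.2 hx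
    rw [show (SignType.sign x : ℝ) * (p - 1) * (|x| ^ (p - 1) / |x|) * x =
      ((SignType.sign x : ℝ) * x) * (p - 1) * (|x| ^ (p - 1) / |x|) by ring, h2]
    field_simp
    ring

lemma powerNonlinearity_lipschitz (hp : 1 < p) {M x y : ℝ} (hx : |x| ≤ M) (hy : |y| ≤ M) :
    |(|x| ^ (p - 1) * x) - (|y| ^ (p - 1) * y)| ≤ p * M ^ (p - 1) * |x - y| := by
  have := (convex_Icc (-M) M).norm_image_sub_le_of_norm_hasDerivWithin_le
    (f := fun x : ℝ => |x| ^ (p - 1) * x) (f' := fun x => p * |x| ^ (p - 1))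
    (C := p * M ^ (p - 1)) (fun z _ => (hasDerivAt_powerNonlinearity hp z).hasDerivWithinAt)
    (fun z hz => by
      have hz' : |z| ≤ M := abs_le.2 hz
      rw [Real.norm_of_nonneg (by positivity)]
      have := Real.rpow_le_rpow (abs_nonneg z) hz' (by linarith : 0 ≤ p - 1)
      nlinarith) (abs_le.1 hy) (abs_le.1 hx)
  simpa using this

lemma hasDerivAt_powerPotential (hp : 1 < p) (x : ℝ) :
    HasDerivAt (fun x : ℝ => |x| ^ (p + 1) / (p + 1)) (|x| ^ (p - 1) * x) x := by
  refine ((hasDerivAt_abs_rpow x (p := p + 1) (by linarith)).div_const (p + 1)).congr_deriv ?_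
  rw [show p + 1 - 2 = p - 1 by ring]
  field_simp

/-- The trapezoidal rule for the power nonlinearity. -/
lemma powerNonlinearity_trapezoid (hp : 1 < p) {M x y : ℝ} (hx : |x| ≤ M) (hy : |y| ≤ M) :
    |((|x| ^ (p - 1) * x) + (|y| ^ (p - 1) * y)) / 2 * (x - y) -
      (|x| ^ (p + 1) / (p + 1) - |y| ^ (p + 1) / (p + 1))| ≤ p * M ^ (p - 1) * (x - y) ^ 2 := by
  have hM : 0 ≤ M := (abs_nonneg _).trans hx
  set f : ℝ → ℝ := fun x => |x| ^ (p - 1) * x with hf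
  set c := (f x + f y) / 2
  -- The trapezoidal error is the increment of `c z - |z|^{p+1}/(p+1)` from `y` to `x`. Its
  -- derivative `c - f z` is the mean of `f x - f z` and `f y - f z`, each at most the Lipschitz
  -- constant times `|x - y|`.
  have h := (convex_uIcc x y).norm_image_sub_le_of_norm_hasDerivWithin_le
    (f := fun z : ℝ => c * z - |z| ^ (p + 1) / (p + 1)) (f' := fun z => c - f z)
    (C := p * M ^ (p - 1) * |x - y|) (x := y) (y := x)
    (fun z _ => ((((hasDerivAt_id' z).const_mul c).congr_deriv (mul_one c)).sub
      (hasDerivAt_powerPotential hp z)).hasDerivWithinAt)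
    (fun z hz => by
      have hzM : |z| ≤ M := by
        rcases le_total x y with hxy | hxy
        · rw [uIcc_of_le hxy] at hz
          exact abs_le.2 ⟨(abs_le.1 hx).1.trans hz.1, hz.2.trans (abs_le.1 hy).2⟩
        · rw [uIcc_of_ge hxy] at hz
          exact abs_le.2 ⟨(abs_le.1 hy).1.trans hz.1, hz.2.trans (abs_le.1 hx).2⟩
      have hzx : |x - z| ≤ |x - y| := by
        rw [abs_sub_comm x z]; exact (abs_sub_left_of_mem_uIcc hz).trans_eq (abs_sub_comm _ _)
      have hzy : |y - z| ≤ |x - y| := by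
        rw [abs_sub_comm y z, abs_sub_comm x y]
        rw [uIcc_comm] at hz
        exact (abs_sub_left_of_mem_uIcc hz).trans_eq (abs_sub_comm _ _)
      have l1 := powerNonlinearity_lipschitz hp hx hzM
      have l2 := powerNonlinearity_lipschitz hp hy hzM
      have hL : 0 ≤ p * M ^ (p - 1) := by positivity
      have e : c - f z = ((f x - f z) + (f y - f z)) / 2 := by simp only [c]; ring
      rw [e, Real.norm_eq_abs, abs_div, abs_two, div_le_iff₀ two_pos]
      refine (abs_add_le _ _).trans ?_
      have m1 := mul_le_mul_of_nonneg_left hzx hL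
      have m2 := mul_le_mul_of_nonneg_left hzy hL
      calc |f x - f z| + |f y - f z| ≤ p * M ^ (p - 1) * |x - z| + p * M ^ (p - 1) * |y - z| :=
            add_le_add l1 l2
        _ ≤ _ := by linarith)
    right_mem_uIcc left_mem_uIcc
  rw [Real.norm_eq_abs, Real.norm_eq_abs, mul_assoc, abs_mul_abs_self] at h
  refine le_trans (le_of_eq ?_) (h.trans_eq (by ring))
  congr 1
  ring

end Nonlinearity


/-! ### Convergence and differentiability in `L²` -/

section L2

open scoped InnerProductSpace

variable {Ω : Type*} [MeasurableSpace Ω] {μ : Measure Ω} {f g : Ω → ℝ}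

open Classical in
/-- The class in `L²` of a square integrable function (and `0` for other functions). -/
noncomputable def L2of (μ : Measure Ω) (f : Ω → ℝ) : Lp ℝ 2 μ :=
  if h : MemLp f 2 μ then h.toLp f else 0

lemma L2of_eq (h : MemLp f 2 μ) : L2of μ f = h.toLp f := dif_pos h

lemma inner_L2of (hf : MemLp f 2 μ) (hg : MemLp g 2 μ) :
    ⟪L2of μ f, L2of μ g⟫_ℝ = ∫ x, f x * g x ∂μ := by
  rw [L2of_eq hf, L2of_eq hg, L2.inner_def]
  refine integral_congr_ae ?_
  filter_upwards [hf.coeFn_toLp, hg.coeFn_toLp] with x h1 h2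
  rw [h1, h2]
  simp [mul_comm]

lemma norm_sq_L2of (hf : MemLp f 2 μ) : ‖L2of μ f‖ ^ 2 = ∫ x, f x ^ 2 ∂μ := by
  rw [← real_inner_self_eq_norm_sq, inner_L2of hf hf]
  simp only [sq]

lemma L2of_sub (hf : MemLp f 2 μ) (hg : MemLp g 2 μ) :
    L2of μ (f - g) = L2of μ f - L2of μ g := by
  rw [L2of_eq hf, L2of_eq hg, L2of_eq (hf.sub hg), MemLp.toLp_sub]

lemma L2of_smul (c : ℝ) (hf : MemLp f 2 μ) : L2of μ (c • f) = c • L2of μ f := by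
  rw [L2of_eq hf, L2of_eq (hf.const_smul c), MemLp.toLp_const_smul]

/-- Made for a Scheffé-type argument: the first term is handled by convergence of the norms, while
the bracket is at most `8 y²` and vanishes as `x → y`, so it is handled by dominated convergence. -/
lemma sq_sub_le (x y : ℝ) :
    (x - y) ^ 2 ≤
      2 * (x ^ 2 - y ^ 2) + (4 * max (y ^ 2 - x ^ 2) 0 + min ((x - y) ^ 2) (4 * y ^ 2)) := by
  have h1 := le_max_left (y ^ 2 - x ^ 2) 0
  have h2 := le_max_right (y ^ 2 - x ^ 2) 0
  rcases le_total ((x - y) ^ 2) (4 * y ^ 2) with h | h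
  · rw [min_eq_left h]; linarith
  · rw [min_eq_right h]; nlinarith [sq_nonneg (x + y)]

/-- Pointwise convergence and convergence of the norms imply convergence in `L²`. -/
lemma tendsto_L2of {ι : Type*} {l : Filter ι} [l.IsCountablyGenerated] {F : ι → Ω → ℝ}
    (hF : ∀ᶠ i in l, MemLp (F i) 2 μ) (hf : MemLp f 2 μ)
    (hp : ∀ᵐ x ∂μ, Tendsto (fun i => F i x) l (𝓝 (f x)))
    (hn : Tendsto (fun i => ∫ x, F i x ^ 2 ∂μ) l (𝓝 (∫ x, f x ^ 2 ∂μ))) :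
    Tendsto (fun i => L2of μ (F i)) l (𝓝 (L2of μ f)) := by
  have hfi := hf.integrable_sq
  set R : ι → Ω → ℝ := fun i x =>
    4 * max (f x ^ 2 - F i x ^ 2) 0 + min ((F i x - f x) ^ 2) (4 * f x ^ 2) with hR
  have hRm : ∀ᶠ i in l, AEStronglyMeasurable (R i) μ := hF.mono fun i hi => by
    have h1 := hi.aestronglyMeasurable
    have h2 := hf.aestronglyMeasurable
    exact ((((h2.pow 2).sub (h1.pow 2)).sup aestronglyMeasurable_const).const_mul 4).add
      (((h1.sub h2).pow 2).inf ((h2.pow 2).const_mul 4))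
  have hRb : ∀ i x, ‖R i x‖ ≤ 8 * f x ^ 2 := fun i x => by
    have e1 : max (f x ^ 2 - F i x ^ 2) 0 ≤ f x ^ 2 :=
      max_le (by linarith [sq_nonneg (F i x)]) (sq_nonneg _)
    have e2 := min_le_right ((F i x - f x) ^ 2) (4 * f x ^ 2)
    have e3 := le_max_right (f x ^ 2 - F i x ^ 2) 0
    have e4 : 0 ≤ min ((F i x - f x) ^ 2) (4 * f x ^ 2) := le_min (sq_nonneg _) (by positivity)
    rw [Real.norm_of_nonneg (by positivity)]
    linarith
  have hR0 : Tendsto (fun i => ∫ x, R i x ∂μ) l (𝓝 0) := by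
    have := tendsto_integral_filter_of_dominated_convergence (μ := μ) (l := l) (F := R)
      (f := fun _ => (0 : ℝ)) _ hRm (Eventually.of_forall fun i => Eventually.of_forall (hRb i))
      (hfi.const_mul 8) (by
        filter_upwards [hp] with x hx
        have h1 : Tendsto (fun i => max (f x ^ 2 - F i x ^ 2) 0) l (𝓝 (max (f x ^ 2 - f x ^ 2) 0)) :=
          (tendsto_const_nhds.sub (hx.pow 2)).max tendsto_const_nhds
        have h2 : Tendsto (fun i => min ((F i x - f x) ^ 2) (4 * f x ^ 2)) l
            (𝓝 (min ((f x - f x) ^ 2) (4 * f x ^ 2))) :=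
          ((hx.sub tendsto_const_nhds).pow 2).min tendsto_const_nhds
        have h3 := (h1.const_mul 4).add h2
        have e4 : min (0 : ℝ) (4 * f x ^ 2) = 0 := min_eq_left (by positivity)
        simpa [e4] using h3)
    simpa using this
  rw [tendsto_iff_norm_sub_tendsto_zero]
  have hlim : Tendsto (fun i => 2 * (∫ x, F i x ^ 2 ∂μ - ∫ x, f x ^ 2 ∂μ) + ∫ x, R i x ∂μ) l
      (𝓝 0) := by
    have := ((hn.sub_const (∫ x, f x ^ 2 ∂μ)).const_mul 2).add hR0
    simpa using this
  have hsq : Tendsto (fun i => ‖L2of μ (F i) - L2of μ f‖ ^ 2) l (𝓝 0) := by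
    refine squeeze_zero' (Eventually.of_forall fun i => by positivity) ?_ hlim
    filter_upwards [hF, hRm] with i hi hRmi
    rw [← L2of_sub hi hf, norm_sq_L2of (hi.sub hf)]
    have hRi : Integrable (R i) μ := (hfi.const_mul 8).mono' hRmi (Eventually.of_forall (hRb i))
    have hi2 := hi.integrable_sq
    have hs : Integrable (fun x => 2 * (F i x ^ 2 - f x ^ 2)) μ := (hi2.sub hfi).const_mul 2
    rw [← integral_sub hi2 hfi, ← integral_const_mul, ← integral_add hs hRi]
    refine integral_mono (hi.sub hf).integrable_sq (hs.add hRi) fun x => ?_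
    exact sq_sub_le (F i x) (f x)
  have := hsq.sqrt
  simpa [Real.sqrt_sq] using this

/-- Differentiability in `L²` from pointwise differentiability and continuity in `L²` of the
derivative. -/
lemma hasDerivAt_L2of [SFinite μ] {V a : ℝ → Ω → ℝ} {t₀ : ℝ} {I : Set ℝ} (hI : I ∈ 𝓝 t₀)
    (hd : ∀ᵐ x ∂μ, ∀ s ∈ I, HasDerivAt (fun s => V s x) (a s x) s)
    (hc : ∀ᵐ x ∂μ, ContinuousOn (fun s => a s x) I)
    (hm : AEStronglyMeasurable (fun q : Ω × ℝ => a q.2 q.1) (μ.prod (volume.restrict I)))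
    (hV : ∀ s ∈ I, MemLp (V s) 2 μ) (ha : ∀ s ∈ I, MemLp (a s) 2 μ)
    (hcont : ContinuousAt (fun s => L2of μ (a s)) t₀) :
    HasDerivAt (fun s => L2of μ (V s)) (L2of μ (a t₀)) t₀ := by
  rw [hasDerivAt_iff_isLittleO, Asymptotics.isLittleO_iff]
  intro c hc0
  obtain ⟨ε, hε, hball⟩ := Metric.mem_nhds_iff.1 (inter_mem hI
    (hcont.preimage_mem_nhds (Metric.closedBall_mem_nhds _ hc0)))
  filter_upwards [Metric.ball_mem_nhds t₀ hε] with t ht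
  have h0 := mem_of_mem_nhds hI
  have ha0 := ha t₀ h0
  have htI : t ∈ I := (hball ht).1
  have hsub : uIcc t₀ t ⊆ Metric.ball t₀ ε := by
    have hoc : OrdConnected (Metric.ball t₀ ε) := by rw [Real.ball_eq_Ioo]; exact ordConnected_Ioo
    exact hoc.uIcc_subset (Metric.mem_ball_self hε) ht
  have hsubI : uIcc t₀ t ⊆ I := fun s hs => (hball (hsub hs)).1
  have hsubI' : uIoc t₀ t ⊆ I := uIoc_subset_uIcc.trans hsubI
  have hnorm : ∀ s ∈ uIoc t₀ t, ∫⁻ x, ENNReal.ofReal ((a s x - a t₀ x) ^ 2) ∂μ ≤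
      ENNReal.ofReal (c ^ 2) := fun s hs => by
    have has := ha s (hsubI' hs)
    have hi : Integrable (fun x => (a s x - a t₀ x) ^ 2) μ := (has.sub ha0).integrable_sq
    rw [← ofReal_integral_eq_lintegral_ofReal hi
      (Eventually.of_forall fun x => sq_nonneg _)]
    refine ENNReal.ofReal_le_ofReal ?_
    have h1 : ‖L2of μ (a s) - L2of μ (a t₀)‖ ≤ c := by
      have := (hball (hsub (uIoc_subset_uIcc hs))).2
      simpa [dist_eq_norm] using this
    have h2 := norm_sq_L2of (has.sub ha0)
    rw [L2of_sub has ha0] at h2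
    rw [show ∫ x, (a s x - a t₀ x) ^ 2 ∂μ = ∫ x, (a s - a t₀) x ^ 2 ∂μ from rfl, ← h2]
    exact pow_le_pow_left₀ (norm_nonneg _) h1 2
  -- Pointwise this remainder is the integral of `a s - a t₀` over `s` between `t₀` and `t`.
  -- Cauchy-Schwarz in `s` followed by Tonelli bounds its `L²` norm by `c |t - t₀|`, because `hnorm`
  -- holds for every such `s`.
  set R : Ω → ℝ := V t - V t₀ - (t - t₀) • a t₀ with hR
  have hRm : MemLp R 2 μ := ((hV t htI).sub (hV t₀ h0)).sub (ha0.const_smul _)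
  have hRe : L2of μ (V t) - L2of μ (V t₀) - (t - t₀) • L2of μ (a t₀) = L2of μ R := by
    rw [hR, L2of_sub ((hV t htI).sub (hV t₀ h0)) (ha0.const_smul _), L2of_smul _ ha0,
      L2of_sub (hV t htI) (hV t₀ h0)]
  have hvol : (volume.restrict (uIoc t₀ t)).real univ = |t - t₀| := by
    rw [measureReal_restrict_apply_univ, Measure.real, Real.volume_uIoc,
      ENNReal.toReal_ofReal (abs_nonneg _)]
  have hpt : ∀ᵐ x ∂μ, ENNReal.ofReal (R x ^ 2) ≤ ENNReal.ofReal |t - t₀| *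
      ∫⁻ s in uIoc t₀ t, ENNReal.ofReal ((a s x - a t₀ x) ^ 2) := by
    filter_upwards [hd, hc] with x hdx hcx
    have hcx' : ContinuousOn (fun s => a s x - a t₀ x) (uIcc t₀ t) :=
      (hcx.mono hsubI).sub continuousOn_const
    have hftc := intervalIntegral.integral_eq_sub_of_hasDerivAt (a := t₀) (b := t)
      (f := fun s => V s x - s * a t₀ x) (f' := fun s => a s x - a t₀ x)
      (fun s hs => (hdx s (hsubI hs)).sub
        (((hasDerivAt_id' s).mul_const (a t₀ x)).congr_deriv (one_mul _)))
      hcx'.intervalIntegrable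
    have hRx : R x = ∫ s in t₀..t, (a s x - a t₀ x) := by
      rw [hftc]; simp [hR]; ring
    have i1 : Integrable (fun s => a s x - a t₀ x) (volume.restrict (uIoc t₀ t)) :=
      (hcx'.integrableOn_compact isCompact_uIcc).mono_set uIoc_subset_uIcc
    have i2 : Integrable (fun s => (a s x - a t₀ x) ^ 2) (volume.restrict (uIoc t₀ t)) :=
      ((hcx'.pow 2).integrableOn_compact isCompact_uIcc).mono_set uIoc_subset_uIcc
    have hcs := sq_integral_abs_le (ρ := fun _ => (1 : ℝ)) (Eventually.of_forall fun _ => one_pos)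
      i1 (integrableOn_const (by simp [Real.volume_uIoc])) (by simpa using i2)
    simp only [inv_one, integral_const, smul_eq_mul, mul_one, one_mul, hvol] at hcs
    rw [← ofReal_integral_eq_lintegral_ofReal i2 (Eventually.of_forall fun x => sq_nonneg _),
      ← ENNReal.ofReal_mul (abs_nonneg _)]
    refine ENNReal.ofReal_le_ofReal (le_trans ?_ hcs)
    rw [hRx, ← sq_abs, ← Real.norm_eq_abs]
    simp only [← Real.norm_eq_abs]
    refine pow_le_pow_left₀ (norm_nonneg _) ?_ 2
    exact intervalIntegral.norm_integral_le_integral_norm_uIoc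
  have hmeas : AEMeasurable (Function.uncurry fun (x : Ω) (s : ℝ) =>
      ENNReal.ofReal ((a s x - a t₀ x) ^ 2)) (μ.prod (volume.restrict (uIoc t₀ t))) := by
    have hm' : AEStronglyMeasurable (fun q : Ω × ℝ => a q.2 q.1)
        (μ.prod (volume.restrict (uIoc t₀ t))) :=
      hm.mono_measure (Measure.prod_mono le_rfl (Measure.restrict_mono hsubI' le_rfl))
    exact ((hm'.sub ha0.aestronglyMeasurable.comp_fst).aemeasurable.pow_const 2).ennreal_ofReal
  have hle : ∫⁻ x, ENNReal.ofReal (R x ^ 2) ∂μ ≤ ENNReal.ofReal ((c * |t - t₀|) ^ 2) := by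
    calc ∫⁻ x, ENNReal.ofReal (R x ^ 2) ∂μ ≤
          ∫⁻ x, (ENNReal.ofReal |t - t₀| *
            ∫⁻ s in uIoc t₀ t, ENNReal.ofReal ((a s x - a t₀ x) ^ 2)) ∂μ := lintegral_mono_ae hpt
      _ = ENNReal.ofReal |t - t₀| *
          ∫⁻ s in uIoc t₀ t, (∫⁻ x, ENNReal.ofReal ((a s x - a t₀ x) ^ 2) ∂μ) := by
          rw [lintegral_const_mul' _ _ ENNReal.ofReal_ne_top, lintegral_lintegral_swap hmeas]
      _ ≤ ENNReal.ofReal |t - t₀| * ∫⁻ s in uIoc t₀ t, ENNReal.ofReal (c ^ 2) := by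
          refine mul_le_mul_right ?_ _
          exact setLIntegral_mono' measurableSet_uIoc hnorm
      _ = _ := by
          rw [setLIntegral_const, Real.volume_uIoc, ← ENNReal.ofReal_mul (sq_nonneg c),
            ← ENNReal.ofReal_mul (abs_nonneg _)]
          congr 1
          ring
  rw [hRe, Real.norm_eq_abs, ← abs_of_nonneg (norm_nonneg (L2of μ R)),
    ← abs_of_nonneg (by positivity : 0 ≤ c * |t - t₀|)]
  refine sq_le_sq.1 ?_
  rw [norm_sq_L2of hRm, ← ENNReal.ofReal_le_ofReal_iff (sq_nonneg _),
    ofReal_integral_eq_lintegral_ofReal hRm.integrable_sq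
      (Eventually.of_forall fun x => sq_nonneg _)]
  exact hle

end L2

/-! ### The weighted measure on the half-space -/

section WeightedMeasure

variable {a : ℝ}

/-- The measure `x₀^a e^{-|X|²/4} dX` on the half-space. -/
noncomputable def weightMeasure (d : ℕ) (a : ℝ) : Measure (ℝ × Rd d) :=
  (volume.restrict (halfSpace d)).withDensity fun Y => ENNReal.ofReal (weight d a Y)

lemma integral_weightMeasure (f : ℝ × Rd d → ℝ) :
    ∫ Y, f Y ∂weightMeasure d a = ∫ Y in halfSpace d, weight d a Y * f Y := by
  rw [weightMeasure, integral_withDensity_eq_integral_toReal_smul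
    (measurable_weight a).ennreal_ofReal (Eventually.of_forall fun _ => ENNReal.ofReal_lt_top)]
  refine setIntegral_congr_fun measurableSet_halfSpace fun Y hY => ?_
  rw [ENNReal.toReal_ofReal (weight_nonneg a hY), smul_eq_mul]

lemma integrable_weightMeasure {f : ℝ × Rd d → ℝ} :
    Integrable f (weightMeasure d a) ↔
      IntegrableOn (fun Y => weight d a Y * f Y) (halfSpace d) := by
  rw [weightMeasure, integrable_withDensity_iff_integrable_smul'
    (measurable_weight a).ennreal_ofReal (Eventually.of_forall fun _ => ENNReal.ofReal_lt_top)]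
  refine integrable_congr ?_
  filter_upwards [self_mem_ae_restrict measurableSet_halfSpace] with Y hY
  rw [ENNReal.toReal_ofReal (weight_nonneg a hY), smul_eq_mul]

lemma weightMeasure_ac : weightMeasure d a ≪ volume.restrict (halfSpace d) :=
  withDensity_absolutelyContinuous _ _

instance : SFinite (weightMeasure d a) := by unfold weightMeasure; infer_instance

lemma ae_weightMeasure : ∀ᵐ Y ∂weightMeasure d a, Y ∈ halfSpace d :=
  weightMeasure_ac.ae_le (self_mem_ae_restrict measurableSet_halfSpace)

lemma memLp_weightMeasure {f : ℝ × Rd d → ℝ} (hf : ContinuousOn f (halfSpace d))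
    (hi : IntegrableOn (fun Y => weight d a Y * f Y ^ 2) (halfSpace d)) :
    MemLp f 2 (weightMeasure d a) :=
  (memLp_two_iff_integrable_sq ((hf.aestronglyMeasurable measurableSet_halfSpace).mono_ac
    weightMeasure_ac)).2 (integrable_weightMeasure.2 hi)

end WeightedMeasure


/-! ### Coordinate derivatives as Fréchet derivatives -/

section Coordinates

variable {U : ℝ × Rd d → ℝ → ℝ} {X : ℝ × Rd d} {t : ℝ}

lemma dX0_eq_fderiv (h : DifferentiableAt ℝ (fun Y => U Y t) X) :
    dX0 U X t = fderiv ℝ (fun Y => U Y t) X e₀ := by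
  have h1 : HasDerivAt (fun r : ℝ => ((r, X.2) : ℝ × Rd d)) e₀ X.1 :=
    (hasDerivAt_id X.1).prodMk (hasDerivAt_const X.1 X.2)
  exact (HasFDerivAt.comp_hasDerivAt (f := fun r : ℝ => ((r, X.2) : ℝ × Rd d)) X.1
    (l := fun Y => U Y t) h.hasFDerivAt h1).deriv

lemma inner_gradx (h : DifferentiableAt ℝ (fun Y => U Y t) X) (y : Rd d) :
    inner ℝ y (gradx U X t) = fderiv ℝ (fun Y => U Y t) X (0, y) := by
  have h1 : HasFDerivAt (fun x : Rd d => ((X.1, x) : ℝ × Rd d))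
      (ContinuousLinearMap.inr ℝ ℝ (Rd d)) X.2 := hasFDerivAt_prodMk_right _ _
  have h2 : HasFDerivAt (fun x : Rd d => U (X.1, x) t) _ X.2 :=
    HasFDerivAt.comp (f := fun x : Rd d => ((X.1, x) : ℝ × Rd d)) X.2 h.hasFDerivAt h1
  rw [gradx, inner_gradient_right, h2.fderiv]
  simp

lemma sqGrad_eq_gradDot (h : DifferentiableAt ℝ (fun Y => U Y t) X) :
    sqGrad U X t = gradDot (fun Y => U Y t) (fun Y => U Y t) X := by
  rw [sqGrad, gradDot, dX0_eq_fderiv h, EuclideanSpace.norm_sq_eq]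
  congr 1
  · ring
  · refine Finset.sum_congr rfl fun i _ => ?_
    have := inner_gradx h (EuclideanSpace.single i 1)
    rw [EuclideanSpace.inner_single_left] at this
    simp only [map_one, one_mul] at this
    rw [this, Real.norm_eq_abs, sq_abs, sq]
    rfl

lemma euler_eq_fderiv (h : DifferentiableAt ℝ (fun Y => U Y t) X) :
    euler U X t = fderiv ℝ (fun Y => U Y t) X X := by
  rw [euler, dX0_eq_fderiv h, inner_gradx h]
  have e : X = X.1 • (e₀ : ℝ × Rd d) + (0, X.2) := by ext <;> simp [e₀]
  conv_rhs => arg 2; rw [e]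
  simp

end Coordinates

/-! ### Trace and flux of `U(·, t)` -/

section BoundaryValues

variable {s p T TM : ℝ} {u : Rd d → ℝ → ℝ} {U : ℝ × Rd d → ℝ → ℝ}

lemma contDiffOn_slice {k : WithTop ℕ∞}
    (h : ContDiffOn ℝ k (fun q : (ℝ × Rd d) × ℝ => U q.1 q.2) (halfSpace d ×ˢ Ioo 0 T)) {t : ℝ}
    (ht : t ∈ Ioo 0 T) : ContDiffOn ℝ k (fun Y => U Y t) (halfSpace d) :=
  h.comp (f := fun Y : ℝ × Rd d => (Y, t)) (by fun_prop) fun _ hY => ⟨hY, ht⟩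

lemma tendsto_vertical {g : ℝ × Rd d → ℝ} (hg : ContinuousOn g (closedHalfSpace d)) (x : Rd d) :
    Tendsto (fun r : ℝ => g (r, x)) (𝓝[>] 0) (𝓝 (g (0, x))) := by
  have h0 : ((0 : ℝ), x) ∈ closedHalfSpace d := le_refl (0 : ℝ)
  refine (hg _ h0).tendsto.comp (tendsto_nhdsWithin_iff.2 ⟨?_, ?_⟩)
  · have : Continuous fun r : ℝ => (r, x) := by fun_prop
    exact (this.tendsto 0).mono_left nhdsWithin_le_nhds
  · filter_upwards [self_mem_nhdsWithin] with r (hr : 0 < r) using hr.le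

/-- Traces of `U` and of its weighted normal derivative on `x₀ = 0`. -/
lemma exists_boundary_extension (hs0 : 0 < s) (hs1 : s < 1) (hTM : T < TM)
    (hu : IsBackwardSolution s p TM u) (huB : ClassB s p T u)
    (hU : ∀ X ∈ halfSpace d, ∀ t ∈ Ioo 0 TM, U X t = backwardExtension s u X t)
    (hUC : ClassC s p T U) {t : ℝ} (ht : t ∈ Ioo 0 T) :
    ∃ g F : ℝ × Rd d → ℝ, ContinuousOn g (closedHalfSpace d) ∧
      ContinuousOn F (closedHalfSpace d) ∧ (∀ X ∈ halfSpace d, g X = U X t) ∧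
      (∀ X ∈ halfSpace d, F X = X.1 ^ (1 - 2 * s) * fderiv ℝ (fun Y => U Y t) X e₀) ∧
      (∀ x, g (0, x) = u x t) ∧
      ∀ x, F (0, x) = -(etaConst s * (|u x t| ^ (p - 1) * u x t)) := by
  obtain ⟨g, hgc, hge⟩ := hUC.continuous
  obtain ⟨F, hFc, hFe⟩ := hUC.flux_continuous
  obtain ⟨C, hC⟩ := huB.bounded
  obtain ⟨ε, hε, C', hH⟩ := huB.holder
  have htT : t ∈ Ioc 0 T := ⟨ht.1, ht.2.le⟩
  have htM : t ∈ Ioo 0 TM := ⟨ht.1, ht.2.trans hTM⟩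
  have huc := continuousOn_of_holder (by positivity) hH
  have hsl := contDiffOn_slice
    (hUC.contDiff.mono (prod_mono subset_rfl Ioo_subset_Ioc_self)) ht
  have hdiff : ∀ X ∈ halfSpace d, DifferentiableAt ℝ (fun Y => U Y t) X := fun X hX =>
    (hsl.contDiffAt (isOpen_halfSpace.mem_nhds hX)).differentiableAt (by norm_num)
  have hgc' : ContinuousOn (fun X => g (X, t)) (closedHalfSpace d) :=
    hgc.comp (f := fun Y : ℝ × Rd d => (Y, t)) (by fun_prop) fun _ hY => ⟨hY, htT⟩
  have hFc' : ContinuousOn (fun X => F (X, t)) (closedHalfSpace d) :=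
    hFc.comp (f := fun Y : ℝ × Rd d => (Y, t)) (by fun_prop) fun _ hY => ⟨hY, htT⟩
  -- The class provides continuous boundary values without identifying them. On each vertical line
  -- the asymptotics of `U - u` determine both: the trace is `u`, and the flux is a multiple of the
  -- fractional operator, hence of the nonlinearity.
  have key : ∀ x, F ((0, x), t) = 2 * s * -(poissonConst s * backwardFracHeat s u x t) ∧
      g ((0, x), t) = u x t := fun x => by
    have h1 := tendsto_backwardExtension_sub_div hs0 hs1 huc hC x ht.1 (hu x t htM).1
    have h2 := flux_eq_of_tendsto (s := s) (w := fun r => U (r, x) t) (b := u x t)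
      (G := F ((0, x), t)) (L := -(poissonConst s * backwardFracHeat s u x t)) hs0
      (fun r hr => by
        have hr' : ((r, x) : ℝ × Rd d) ∈ halfSpace d := hr
        exact (hdiff _ hr').comp (f := fun r : ℝ => ((r, x) : ℝ × Rd d)) r (by fun_prop))
      (by
        refine (tendsto_vertical hFc' x).congr' ?_
        filter_upwards [self_mem_nhdsWithin] with r hr
        exact hFe (r, x) hr t htT)
      (by
        refine h1.congr' ?_
        filter_upwards [self_mem_nhdsWithin] with r hr
        rw [hU (r, x) hr t htM])
    refine ⟨h2.1, tendsto_nhds_unique (tendsto_vertical hgc' x) (h2.2.congr' ?_)⟩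
    filter_upwards [self_mem_nhdsWithin] with r hr
    exact (hge (r, x) hr t htT).symm
  refine ⟨fun X => g (X, t), fun X => F (X, t), hgc', hFc', fun X hX => hge X hX t htT,
    fun X hX => ?_, fun x => (key x).2, fun x => ?_⟩
  · beta_reduce
    rw [hFe X hX t htT, ← dX0_eq_fderiv (hdiff X hX)]
  · beta_reduce
    rw [(key x).1, etaConst_eq, (hu x t htM).2]; ring

end BoundaryValues

/-! ### Integrals of `L¹`-continuous families against bounded factors -/

section ContinuousInL1

variable {α : Type*} [MeasurableSpace α] {μ : Measure α}

/-- Split `F_t k_t` into `(F_t - F_{t₀}) k_t`, small in `L¹` because `k` is bounded, and `F_{t₀}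
k_t`, to which dominated convergence applies. -/
lemma tendsto_integral_mul_of_continuousInLp {F k : α → ℝ → ℝ} {S : Set ℝ} {t₀ M : ℝ}
    (hF : ContinuousInLp F 1 μ S) (hS : S ∈ 𝓝 t₀)
    (hkm : ∀ᶠ t in 𝓝 t₀, AEStronglyMeasurable (fun y => k y t) μ)
    (hkb : ∀ᶠ t in 𝓝 t₀, ∀ᵐ y ∂μ, |k y t| ≤ M)
    (hkc : ∀ᵐ y ∂μ, ContinuousAt (k y) t₀) :
    Tendsto (fun t => ∫ y, F y t * k y t ∂μ) (𝓝 t₀) (𝓝 (∫ y, F y t₀ * k y t₀ ∂μ)) := by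
  have h0 : t₀ ∈ S := mem_of_mem_nhds hS
  have hF0 : Integrable (fun y => F y t₀) μ := memLp_one_iff_integrable.1 (hF.1 t₀ h0)
  have h1 : Tendsto (fun t => ∫ y, F y t₀ * k y t ∂μ) (𝓝 t₀) (𝓝 (∫ y, F y t₀ * k y t₀ ∂μ)) := by
    refine tendsto_integral_filter_of_dominated_convergence (fun y => ‖F y t₀‖ * M) ?_ ?_
      (hF0.norm.mul_const M) ?_
    · filter_upwards [hkm] with t ht using hF0.aestronglyMeasurable.mul ht
    · filter_upwards [hkb] with t ht
      filter_upwards [ht] with y hy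
      rw [norm_mul]
      exact mul_le_mul_of_nonneg_left hy (norm_nonneg _)
    · filter_upwards [hkc] with y hy using hy.tendsto.const_mul _
  have h2 : Tendsto (fun t => ∫ y, (F y t - F y t₀) * k y t ∂μ) (𝓝 t₀) (𝓝 0) := by
    have h3 := hF.2 t₀ h0
    rw [nhdsWithin_eq_nhds.2 hS] at h3
    have h4 := (ENNReal.tendsto_toReal ENNReal.zero_ne_top).comp h3
    have h5 := h4.mul_const M
    simp only [ENNReal.toReal_zero, zero_mul] at h5
    refine squeeze_zero_norm' ?_ h5
    filter_upwards [hkb, hS] with t ht htS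
    have hFt : Integrable (fun y => F y t) μ := memLp_one_iff_integrable.1 (hF.1 t htS)
    have hd : Integrable (fun y => F y t - F y t₀) μ := hFt.sub hF0
    calc ‖∫ y, (F y t - F y t₀) * k y t ∂μ‖ ≤ ∫ y, ‖F y t - F y t₀‖ * M ∂μ := by
          refine norm_integral_le_of_norm_le (hd.norm.mul_const M) ?_
          filter_upwards [ht] with y hy
          rw [norm_mul]
          exact mul_le_mul_of_nonneg_left hy (norm_nonneg _)
      _ = _ := by
          rw [integral_mul_const, integral_norm_eq_lintegral_enorm hd.aestronglyMeasurable,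
            Function.comp, eLpNorm_one_eq_lintegral_enorm]
  have := h2.add h1
  rw [zero_add] at this
  refine this.congr' ?_
  filter_upwards [hkb, hkm, hS] with t hb hm htS
  have hFt : Integrable (fun y => F y t) μ := memLp_one_iff_integrable.1 (hF.1 t htS)
  have i0 : Integrable (fun y => F y t₀ * k y t) μ := hF0.mul_bdd (c := M) hm hb
  have i1 : Integrable (fun y => F y t * k y t) μ := hFt.mul_bdd (c := M) hm hb
  have i2 : Integrable (fun y => (F y t - F y t₀) * k y t) μ := by
    simp only [sub_mul]
    exact i1.sub i0
  rw [← integral_add i2 i0]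
  refine integral_congr_ae (Eventually.of_forall fun y => ?_)
  ring

end ContinuousInL1

/-! ### Dilations of the half-space -/

section Dilation

lemma smul_mem_halfSpace {R : ℝ} (hR : 0 < R) {Y : ℝ × Rd d} (hY : Y ∈ halfSpace d) :
    R • Y ∈ halfSpace d := by
  exact mul_pos hR hY

lemma smul_mem_closedHalfSpace {R : ℝ} (hR : 0 < R) {Y : ℝ × Rd d} (hY : Y ∈ closedHalfSpace d) :
    R • Y ∈ closedHalfSpace d := by
  exact mul_nonneg hR.le hY

lemma smul_mem_halfSpace_iff {R : ℝ} (hR : 0 < R) {Y : ℝ × Rd d} :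
    R • Y ∈ halfSpace d ↔ Y ∈ halfSpace d := by
  simp [halfSpace, hR]

lemma finrank_half : Module.finrank ℝ (ℝ × Rd d) = d + 1 := by
  simp [Module.finrank_prod, add_comm]

lemma indicator_halfSpace_dilation (f : ℝ × Rd d → ℝ) {R : ℝ} (hR : 0 < R) :
    (fun Y => (halfSpace d).indicator f (R • Y)) =
      (halfSpace d).indicator fun Y => f (R • Y) := by
  ext Y
  by_cases hY : Y ∈ halfSpace d
  · rw [indicator_of_mem hY, indicator_of_mem ((smul_mem_halfSpace_iff hR).2 hY)]
  · rw [indicator_of_notMem hY, indicator_of_notMem (mt (smul_mem_halfSpace_iff hR).1 hY)]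

lemma integral_halfSpace_dilation (f : ℝ × Rd d → ℝ) {R : ℝ} (hR : 0 < R) :
    ∫ Y in halfSpace d, f (R • Y) * R ^ (d + 1) = ∫ X in halfSpace d, f X := by
  have h := Measure.integral_comp_smul_of_nonneg (volume : Measure (ℝ × Rd d))
    ((halfSpace d).indicator f) R (hR := hR.le)
  rw [finrank_half, integral_indicator measurableSet_halfSpace] at h
  rw [indicator_halfSpace_dilation f hR, integral_indicator measurableSet_halfSpace] at h
  rw [integral_mul_const, h, smul_eq_mul]
  field_simp

lemma integrableOn_halfSpace_dilation (f : ℝ × Rd d → ℝ) {R : ℝ} (hR : 0 < R) :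
    IntegrableOn (fun Y => f (R • Y)) (halfSpace d) ↔ IntegrableOn f (halfSpace d) := by
  rw [← integrable_indicator_iff measurableSet_halfSpace,
    ← integrable_indicator_iff measurableSet_halfSpace, ← indicator_halfSpace_dilation f hR]
  exact integrable_comp_smul_iff volume _ hR.ne'

end Dilation


/-! ### Self-similar variables -/

section SelfSimilar

variable {s p κ T : ℝ} {u : Rd d → ℝ → ℝ} {U : ℝ × Rd d → ℝ → ℝ} {t : ℝ}

/-- `t^κ U(√t Y, t)`. -/
noncomputable def profile (κ : ℝ) (U : ℝ × Rd d → ℝ → ℝ) (t : ℝ) (Y : ℝ × Rd d) : ℝ :=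
  t ^ κ * U (√t • Y) t

/-- The time derivative of the rescaled function `t^{s/(p-1)} U(√t Y, t)`. -/
noncomputable def profileDeriv (s p : ℝ) (U : ℝ × Rd d → ℝ → ℝ) (t : ℝ) (Y : ℝ × Rd d) : ℝ :=
  t ^ (s / (p - 1) - 1) / 2 * scalingField s p U (√t • Y) t

lemma fderiv_profile (κ : ℝ) (U : ℝ × Rd d → ℝ → ℝ) (t : ℝ) (Y e : ℝ × Rd d) :
    fderiv ℝ (profile κ U t) Y e = t ^ κ * √t * fderiv ℝ (fun X => U X t) (√t • Y) e := by
  have h : profile κ U t = t ^ κ • fun Y => (fun X => U X t) (√t • Y) := rfl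
  have h' := fderiv_comp_smul (f := fun X => U X t) (x := Y) √t
  rw [h, fderiv_const_smul_field, Pi.smul_apply, h']
  simp [mul_assoc]

lemma gradDot_profile (ht : 0 < t) (κ : ℝ) (U : ℝ × Rd d → ℝ → ℝ) (Y : ℝ × Rd d) :
    gradDot (profile κ U t) (profile κ U t) Y =
      t ^ (2 * κ + 1) * gradDot (fun X => U X t) (fun X => U X t) (√t • Y) := by
  have h : t ^ (2 * κ + 1) = (t ^ κ * √t) * (t ^ κ * √t) := by
    rw [Real.rpow_add ht, Real.rpow_one, two_mul, Real.rpow_add ht]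
    nth_rewrite 3 [← Real.mul_self_sqrt ht.le]
    ring
  simp only [gradDot, fderiv_profile, h, mul_add, Finset.mul_sum]
  congr 1
  · ring
  · exact Finset.sum_congr rfl fun i _ => by ring

lemma dirDeriv2_profile (ht : 0 < t) (κ : ℝ) (U : ℝ × Rd d → ℝ → ℝ) (Y e : ℝ × Rd d) :
    dirDeriv2 (profile κ U t) Y e = t ^ (κ + 1) * dirDeriv2 (fun X => U X t) (√t • Y) e := by
  have h : (fun Y => fderiv ℝ (profile κ U t) Y e) =
      (t ^ κ * √t) • fun Y => (fun X => fderiv ℝ (fun X => U X t) X e) (√t • Y) := by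
    ext Y
    exact fderiv_profile κ U t Y e
  have h' := fderiv_comp_smul (f := fun X => fderiv ℝ (fun X => U X t) X e) (x := Y) √t
  rw [dirDeriv2, h, fderiv_const_smul_field, Pi.smul_apply, h', dirDeriv2,
    Real.rpow_add ht, Real.rpow_one]
  simp only [smul_apply, smul_eq_mul]
  linear_combination t ^ κ * fderiv ℝ (fun X => fderiv ℝ (fun X => U X t) X e) (√t • Y) e *
    Real.mul_self_sqrt ht.le

lemma sqNorm_smul (R : ℝ) (Y : ℝ × Rd d) : sqNorm (R • Y) = R ^ 2 * sqNorm Y := by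
  simp only [sqNorm, Prod.smul_fst, Prod.smul_snd, smul_eq_mul, norm_smul, mul_pow,
    Real.norm_eq_abs, sq_abs]
  ring

/-- The normalizing constant of `𝒢`. -/
noncomputable def fundConst (d : ℕ) (s : ℝ) : ℝ :=
  1 / ((4 * Real.pi) ^ ((d : ℝ) / 2) * Real.Gamma s)

lemma fundConst_pos (d : ℕ) (hs0 : 0 < s) : 0 < fundConst d s := by
  have := Real.Gamma_pos_of_pos hs0
  unfold fundConst
  positivity

lemma sqrt_pow_eq_rpow (ht : 0 < t) (n : ℕ) : √t ^ n = t ^ ((n : ℝ) / 2) := by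
  rw [Real.sqrt_eq_rpow, ← Real.rpow_natCast, ← Real.rpow_mul ht.le]
  congr 1
  ring

/-- The Jacobian `√t^{d+1}` and the factor `√t^{1-2s}` from the weight multiply to `t^{d/2+1-s}`,
the denominator of `𝒢`. Hence the rescaled weight does not depend on time. -/
lemma density_dilation (ht : 0 < t) {Y : ℝ × Rd d} (hY : Y ∈ halfSpace d) (h : ℝ) :
    (√t • Y).1 ^ (1 - 2 * s) * h * scaledG d s p (√t • Y) t * √t ^ (d + 1) =
      fundConst d s * (weight d (1 - 2 * s) Y * (t ^ (2 * (s / (p - 1)) + 1) * h)) := by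
  have h1 : √t ^ (1 - 2 * s) * √t ^ (d + 1) = t ^ ((d : ℝ) / 2 + 1 - s) := by
    rw [sqrt_pow_eq_rpow ht, Real.sqrt_eq_rpow, ← Real.rpow_mul ht.le, ← Real.rpow_add ht]
    congr 1
    push_cast
    ring
  have h2 : -sqNorm (√t • Y) / (4 * t) = -sqNorm Y / 4 := by
    rw [sqNorm_smul, Real.sq_sqrt ht.le]
    field_simp
  have h3 : t ^ ((d : ℝ) / 2 + 1 - s) ≠ 0 := (Real.rpow_pos_of_pos ht _).ne'
  have hY' : 0 ≤ Y.1 := le_of_lt hY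
  rw [scaledG, fundSol, h2, weight, Prod.smul_fst, smul_eq_mul,
    Real.mul_rpow (Real.sqrt_nonneg t) hY', fundConst, mul_div_assoc 2 s]
  calc _ = (√t ^ (1 - 2 * s) * √t ^ (d + 1)) / t ^ ((d : ℝ) / 2 + 1 - s) *
        (1 / ((4 * Real.pi) ^ ((d : ℝ) / 2) * Real.Gamma s) *
        (Y.1 ^ (1 - 2 * s) * Real.exp (-sqNorm Y / 4) * (t ^ (2 * (s / (p - 1)) + 1) * h))) := by
        ring
    _ = _ := by rw [h1, div_self h3, one_mul]

lemma integral_density {k h : ℝ × Rd d → ℝ} (ht : 0 < t)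
    (hk : ∀ X, k X = X.1 ^ (1 - 2 * s) * h X * scaledG d s p X t) :
    ∫ X in halfSpace d, k X = fundConst d s *
      ∫ Y in halfSpace d, weight d (1 - 2 * s) Y *
        (t ^ (2 * (s / (p - 1)) + 1) * h (√t • Y)) := by
  rw [← integral_halfSpace_dilation k (Real.sqrt_pos.2 ht), ← integral_const_mul]
  refine setIntegral_congr_fun measurableSet_halfSpace fun Y hY => ?_
  rw [hk, density_dilation ht hY]

lemma integrableOn_density {k h : ℝ × Rd d → ℝ} (hs0 : 0 < s) (ht : 0 < t)
    (hk : ∀ X, k X = X.1 ^ (1 - 2 * s) * h X * scaledG d s p X t) :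
    IntegrableOn (fun Y => weight d (1 - 2 * s) Y *
        (t ^ (2 * (s / (p - 1)) + 1) * h (√t • Y))) (halfSpace d) ↔
      IntegrableOn k (halfSpace d) := by
  have hR := Real.sqrt_pos.2 ht
  rw [← integrableOn_halfSpace_dilation k hR]
  have h1 : EqOn (fun Y => k (√t • Y)) (fun Y => (fundConst d s / √t ^ (d + 1)) *
      (weight d (1 - 2 * s) Y * (t ^ (2 * (s / (p - 1)) + 1) * h (√t • Y)))) (halfSpace d) :=
    fun Y hY => by
      have h0 : √t ^ (d + 1) ≠ 0 := by positivity
      beta_reduce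
      rw [div_mul_eq_mul_div, ← density_dilation ht hY, ← hk, mul_div_cancel_right₀ _ h0]
  rw [integrableOn_congr_fun h1 measurableSet_halfSpace]
  have h2 : fundConst d s / √t ^ (d + 1) ≠ 0 :=
    (div_pos (fundConst_pos d hs0) (by positivity)).ne'
  exact (integrable_const_mul_iff (isUnit_iff_ne_zero.2 h2) _).symm

/-- On the boundary the Jacobian is only `√t^d`. The powers still match because `κ(p+1) = 2κ + s`
for `κ = s/(p-1)`. -/
lemma boundaryDensity_dilation (hp : 1 < p) (ht : 0 < t) (y : Rd d) :
    boundaryDensity s p u t (√t • y) * √t ^ d =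
      fundConst d s * (Real.exp (-‖y‖ ^ 2 / 4) * |t ^ (s / (p - 1)) * u (√t • y) t| ^ (p + 1)) := by
  have hp1 : p - 1 ≠ 0 := by linarith
  have h1 : t ^ (2 * s / (p - 1) + 1) * t ^ ((d : ℝ) / 2) =
      t ^ (s / (p - 1) * (p + 1)) * t ^ ((d : ℝ) / 2 + 1 - s) := by
    rw [← Real.rpow_add ht, ← Real.rpow_add ht]
    congr 1
    field_simp
    ring
  have h2 : -sqNorm (((0 : ℝ), √t • y) : ℝ × Rd d) / (4 * t) = -‖y‖ ^ 2 / 4 := by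
    simp only [sqNorm, norm_smul, mul_pow, Real.norm_eq_abs, sq_abs, Real.sq_sqrt ht.le]
    field_simp
    ring
  have h3 : t ^ ((d : ℝ) / 2 + 1 - s) ≠ 0 := (Real.rpow_pos_of_pos ht _).ne'
  rw [boundaryDensity, scaledGBdry, fundSol, h2, abs_mul,
    abs_of_nonneg (Real.rpow_nonneg ht.le _),
    Real.mul_rpow (Real.rpow_nonneg ht.le _) (abs_nonneg _), ← Real.rpow_mul ht.le,
    sqrt_pow_eq_rpow ht, fundConst]
  calc _ = (t ^ (2 * s / (p - 1) + 1) * t ^ ((d : ℝ) / 2)) / t ^ ((d : ℝ) / 2 + 1 - s) *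
        (1 / ((4 * Real.pi) ^ ((d : ℝ) / 2) * Real.Gamma s) *
          (Real.exp (-‖y‖ ^ 2 / 4) * |u (√t • y) t| ^ (p + 1))) := by ring
    _ = _ := by rw [h1, mul_div_cancel_right₀ _ h3]; ring

lemma integral_boundaryDensity (hp : 1 < p) (ht : 0 < t) :
    ∫ x, boundaryDensity s p u t x = fundConst d s *
      ∫ y : Rd d, Real.exp (-‖y‖ ^ 2 / 4) * |t ^ (s / (p - 1)) * u (√t • y) t| ^ (p + 1) := by
  have hR := Real.sqrt_pos.2 ht
  have h := Measure.integral_comp_smul_of_nonneg volume (boundaryDensity s p u t) (√t)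
    (hR := hR.le)
  rw [← integral_const_mul]
  simp only [← boundaryDensity_dilation hp ht]
  rw [integral_mul_const, h, finrank_euclideanSpace_fin, smul_eq_mul]
  field_simp

lemma integrable_boundaryDensity (hp : 1 < p) (ht : 0 < t)
    (h : Integrable fun y : Rd d =>
      Real.exp (-‖y‖ ^ 2 / 4) * |t ^ (s / (p - 1)) * u (√t • y) t| ^ (p + 1)) :
    Integrable (boundaryDensity s p u t) := by
  have hR := Real.sqrt_pos.2 ht
  rw [← integrable_comp_smul_iff volume _ hR.ne']
  refine (h.const_mul (fundConst d s / √t ^ d)).congr (Eventually.of_forall fun y => ?_)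
  have h0 : √t ^ d ≠ 0 := by positivity
  beta_reduce
  rw [div_mul_eq_mul_div, ← boundaryDensity_dilation hp ht, mul_div_cancel_right₀ _ h0]

section Smooth

variable (hU : ContDiffOn ℝ 2 (fun q : (ℝ × Rd d) × ℝ => U q.1 q.2) (halfSpace d ×ˢ Ioo 0 T))

include hU

lemma hasFDerivAt_joint {X : ℝ × Rd d} (hX : X ∈ halfSpace d) (ht : t ∈ Ioo 0 T) :
    HasFDerivAt (fun q : (ℝ × Rd d) × ℝ => U q.1 q.2)
      (fderiv ℝ (fun q : (ℝ × Rd d) × ℝ => U q.1 q.2) (X, t)) (X, t) :=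
  ((hU.contDiffAt ((isOpen_halfSpace.prod isOpen_Ioo).mem_nhds ⟨hX, ht⟩)).differentiableAt
    (by norm_num)).hasFDerivAt

lemma differentiableAt_slice {X : ℝ × Rd d} (hX : X ∈ halfSpace d) (ht : t ∈ Ioo 0 T) :
    DifferentiableAt ℝ (fun Y => U Y t) X :=
  ((contDiffOn_slice hU ht).contDiffAt (isOpen_halfSpace.mem_nhds hX)).differentiableAt
    (by norm_num)

lemma fderiv_joint_apply {X : ℝ × Rd d} (hX : X ∈ halfSpace d) (ht : t ∈ Ioo 0 T)
    (e : ℝ × Rd d) (c : ℝ) :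
    fderiv ℝ (fun q : (ℝ × Rd d) × ℝ => U q.1 q.2) (X, t) (e, c) =
      fderiv ℝ (fun Y => U Y t) X e + c * dT U X t := by
  have hL := hasFDerivAt_joint hU hX ht
  have h1 := HasFDerivAt.comp (f := fun Y : ℝ × Rd d => (Y, t)) X hL (hasFDerivAt_prodMk_left X t)
  have h2 := HasFDerivAt.comp_hasDerivAt (f := fun r : ℝ => (X, r)) t hL
    ((hasDerivAt_const t X).prodMk (hasDerivAt_id t))
  have e1 : fderiv ℝ (fun Y => U Y t) X e =
      fderiv ℝ (fun q : (ℝ × Rd d) × ℝ => U q.1 q.2) (X, t) (e, 0) := by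
    rw [show (fun Y => U Y t) = (fun q : (ℝ × Rd d) × ℝ => U q.1 q.2) ∘ fun Y => (Y, t) from rfl,
      h1.fderiv]
    simp
  have e2 : dT U X t = fderiv ℝ (fun q : (ℝ × Rd d) × ℝ => U q.1 q.2) (X, t) (0, 1) := h2.deriv
  rw [e1, e2, ← smul_eq_mul, ← map_smul, ← map_add]
  simp

/-- The scaling field is the derivative of `U` along the generator `(X, 2t)` of parabolic dilations
plus a zeroth-order term. In this form its joint continuity follows from that of the first
derivatives of `U`. -/
lemma scalingField_eq {X : ℝ × Rd d} (hX : X ∈ halfSpace d) (ht : t ∈ Ioo 0 T) :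
    scalingField s p U X t =
      fderiv ℝ (fun q : (ℝ × Rd d) × ℝ => U q.1 q.2) (X, t) (X, 2 * t) +
        2 * s / (p - 1) * U X t := by
  rw [scalingField, euler_eq_fderiv (differentiableAt_slice hU hX ht),
    fderiv_joint_apply hU hX ht]

lemma contDiffOn_profile (κ : ℝ) (ht : t ∈ Ioo 0 T) :
    ContDiffOn ℝ 2 (profile κ U t) (halfSpace d) :=
  contDiffOn_const.mul ((contDiffOn_slice hU ht).comp (f := fun Y : ℝ × Rd d => √t • Y)
    (by fun_prop) fun _ hY => smul_mem_halfSpace (Real.sqrt_pos.2 ht.1) hY)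

/-- The curve `(√t Y, t)` has velocity `(X/2t, 1)` at `X = √t Y`, a multiple of the generator of
parabolic dilations; the prefactor `t^κ` supplies the zeroth-order term. -/
lemma hasDerivAt_profile {Y : ℝ × Rd d} (hY : Y ∈ halfSpace d) (ht : t ∈ Ioo 0 T) :
    HasDerivAt (fun r => profile (s / (p - 1)) U r Y) (profileDeriv s p U t Y) t := by
  have ht0 := ht.1
  have hX := smul_mem_halfSpace (Real.sqrt_pos.2 ht0) hY
  have h1 : HasDerivAt (fun r : ℝ => √r • Y) ((1 / (2 * √t)) • Y) t :=
    (Real.hasDerivAt_sqrt ht0.ne').smul_const Y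
  have h2 := HasFDerivAt.comp_hasDerivAt (f := fun r : ℝ => (√r • Y, r)) t
    (hasFDerivAt_joint hU hX ht) (h1.prodMk (hasDerivAt_id t))
  have h3 := (Real.hasDerivAt_rpow_const (p := s / (p - 1)) (Or.inl ht0.ne')).mul h2
  refine h3.congr_deriv ?_
  have hr : (1 / (2 * √t)) • Y = (1 / (2 * t)) • (√t • Y) := by
    rw [smul_smul]
    congr 1
    nth_rewrite 2 [← Real.mul_self_sqrt ht0.le]
    have := Real.sqrt_pos.2 ht0
    field_simp
  rw [fderiv_joint_apply hU hX ht, profileDeriv, scalingField,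
    euler_eq_fderiv (differentiableAt_slice hU hX ht), hr, map_smul, smul_eq_mul]
  have e : t ^ (s / (p - 1)) = t ^ (s / (p - 1) - 1) * t := by
    rw [Real.rpow_sub_one ht0.ne']; field_simp
  rw [e]
  simp only [Function.comp]
  field_simp
  ring

lemma continuousOn_profileDeriv :
    ContinuousOn (fun q : (ℝ × Rd d) × ℝ => profileDeriv s p U q.2 q.1)
      (halfSpace d ×ˢ Ioo 0 T) := by
  have hf := hU.continuousOn_fderiv_of_isOpen (isOpen_halfSpace.prod isOpen_Ioo) (by norm_num)
  have h1 : ContinuousOn (fun q : (ℝ × Rd d) × ℝ => scalingField s p U q.1 q.2)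
      (halfSpace d ×ˢ Ioo 0 T) := by
    refine ContinuousOn.congr (f := fun q : (ℝ × Rd d) × ℝ =>
      fderiv ℝ (fun q : (ℝ × Rd d) × ℝ => U q.1 q.2) q (q.1, 2 * q.2) +
        2 * s / (p - 1) * U q.1 q.2) ?_ fun q hq => scalingField_eq hU hq.1 hq.2
    exact (hf.clm_apply (by fun_prop)).add (continuousOn_const.mul hU.continuousOn)
  refine ContinuousOn.mul ?_ (h1.comp (f := fun q : (ℝ × Rd d) × ℝ => (√q.2 • q.1, q.2))
    (by fun_prop) fun q hq => ⟨smul_mem_halfSpace (Real.sqrt_pos.2 hq.2.1) hq.1, hq.2⟩)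
  refine ContinuousOn.div_const (ContinuousOn.rpow_const continuousOn_snd fun q hq => ?_) 2
  exact Or.inl hq.2.1.ne'

/-- This is `t^{κ+1}` times the equation for `U`. The identity `t ∂ₜw = t^κ (X·∇U/2 + t ∂ₜU + κ U)`
trades `∂ₜU` for `∂ₜw`, and this produces the drift and the term `κ w`. -/
lemma profile_equation {C TM : ℝ} (hs0 : 0 < s) (hTM : T < TM)
    (hu : ContinuousOn (fun q : Rd d × ℝ => u q.1 q.2) (univ ×ˢ Ioi 0))
    (hC : ∀ x t, 0 < t → |u x t| ≤ C)
    (hUe : ∀ X ∈ halfSpace d, ∀ t ∈ Ioo 0 TM, U X t = backwardExtension s u X t)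
    (ht : t ∈ Ioo 0 T) {Y : ℝ × Rd d} (hY : Y ∈ halfSpace d) :
    dirDeriv2 (profile (s / (p - 1)) U t) Y e₀ +
      ∑ i, dirDeriv2 (profile (s / (p - 1)) U t) Y (eX i) +
      (1 - 2 * s) / Y.1 * fderiv ℝ (profile (s / (p - 1)) U t) Y e₀ -
      fderiv ℝ (profile (s / (p - 1)) U t) Y Y / 2 =
    s / (p - 1) * profile (s / (p - 1)) U t Y - t * profileDeriv s p U t Y := by
  have ht0 := ht.1
  have hR := Real.sqrt_pos.2 ht0
  have hX := smul_mem_halfSpace hR hY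
  have hY0 : 0 < Y.1 := hY
  have h := extension_pde hs0 hu hC hUe hX ⟨ht.1, ht.2.trans hTM⟩
    ((contDiffOn_slice hU ht).contDiffAt (isOpen_halfSpace.mem_nhds hX))
  have e1 : t ^ (s / (p - 1) + 1) = t ^ (s / (p - 1) - 1) * (t * t) := by
    rw [Real.rpow_add_one ht0.ne', Real.rpow_sub_one ht0.ne']; field_simp
  have e2 : t ^ (s / (p - 1)) = t ^ (s / (p - 1) - 1) * t := by
    rw [Real.rpow_sub_one ht0.ne']; field_simp
  have e3 : √t * fderiv ℝ (fun X => U X t) (√t • Y) Y =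
      fderiv ℝ (fun X => U X t) (√t • Y) (√t • Y) := by rw [map_smul, smul_eq_mul]
  simp only [dirDeriv2_profile ht0, fderiv_profile, ← Finset.mul_sum]
  rw [mul_assoc (t ^ (s / (p - 1))) _ (fderiv ℝ (fun X => U X t) (√t • Y) Y), e3, profile,
    profileDeriv, scalingField, euler_eq_fderiv (differentiableAt_slice hU hX ht), e1, e2]
  have e4 : √t / Y.1 = t / (√t • Y).1 := by
    rw [Prod.smul_fst, smul_eq_mul]
    nth_rewrite 2 [← Real.mul_self_sqrt ht0.le]
    field_simp
  have e5 : (1 - 2 * s) / Y.1 * (t ^ (s / (p - 1) - 1) * t * √t *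
      fderiv ℝ (fun X => U X t) (√t • Y) e₀) = t ^ (s / (p - 1) - 1) * (t * t) *
        ((1 - 2 * s) / (√t • Y).1 * fderiv ℝ (fun X => U X t) (√t • Y) e₀) := by
    calc _ = (1 - 2 * s) * (t ^ (s / (p - 1) - 1) * t) * (√t / Y.1) *
        fderiv ℝ (fun X => U X t) (√t • Y) e₀ := by ring
      _ = _ := by rw [e4]; ring
  rw [e5]
  linear_combination t ^ (s / (p - 1) - 1) * (t * t) * h

end Smooth

end SelfSimilar


/-! ### The rescaled boundary value problem and its energy identity -/

section Flow

open scoped InnerProductSpace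

variable {a κ η p M : ℝ} {I : Set ℝ} {w wt : ℝ → ℝ × Rd d → ℝ} {v : ℝ → Rd d → ℝ}

/-- A bounded finite-energy solution `w`, with time derivative `wt` and trace `v` on `y₀ = 0`, of
the extension problem in self-similar variables
`Δw + (a / y₀) ∂₀w - Y·∇w / 2 = κ w - t ∂ₜw`, `y₀^a ∂₀w = -η |w|^{p-1} w` at `y₀ = 0`. -/
structure RescaledFlow (a κ η p M : ℝ) (I : Set ℝ) (w wt : ℝ → ℝ × Rd d → ℝ)
    (v : ℝ → Rd d → ℝ) : Prop where
  contDiff : ∀ t ∈ I, ContDiffOn ℝ 2 (w t) (halfSpace d)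
  equation : ∀ t ∈ I, ∀ Y ∈ halfSpace d, dirDeriv2 (w t) Y e₀ + ∑ i, dirDeriv2 (w t) Y (eX i) +
    a / Y.1 * fderiv ℝ (w t) Y e₀ - fderiv ℝ (w t) Y Y / 2 = κ * w t Y - t * wt t Y
  boundary : ∀ t ∈ I, ∃ g F : ℝ × Rd d → ℝ, ContinuousOn g (closedHalfSpace d) ∧
    ContinuousOn F (closedHalfSpace d) ∧ (∀ Y ∈ halfSpace d, g Y = w t Y) ∧
    (∀ Y ∈ halfSpace d, F Y = Y.1 ^ a * fderiv ℝ (w t) Y e₀) ∧ (∀ y, g (0, y) = v t y) ∧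
    ∀ y, F (0, y) = -(η * (|v t y| ^ (p - 1) * v t y))
  bounded : ∀ t ∈ I, ∀ Y ∈ halfSpace d, |w t Y| ≤ M
  trace_bounded : ∀ t ∈ I, ∀ y, |v t y| ≤ M
  trace_continuous : ∀ t ∈ I, Continuous (v t)
  memLp : ∀ t ∈ I, MemLp (w t) 2 (weightMeasure d a)
  memLp_deriv : ∀ t ∈ I, MemLp (wt t) 2 (weightMeasure d a)
  integrable_grad : ∀ t ∈ I,
    IntegrableOn (fun Y => weight d a Y * gradDot (w t) (w t) Y) (halfSpace d)

/-- The quadratic part of the energy. -/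
noncomputable def dirichletForm (a κ : ℝ) (f g : ℝ × Rd d → ℝ) : ℝ :=
  ∫ Y in halfSpace d, weight d a Y * (gradDot f g Y + κ * (f Y * g Y))

lemma gradDot_comm (f g : ℝ × Rd d → ℝ) (Y : ℝ × Rd d) : gradDot f g Y = gradDot g f Y := by
  simp only [gradDot, mul_comm]

lemma dirichletForm_comm (a κ : ℝ) (f g : ℝ × Rd d → ℝ) :
    dirichletForm a κ f g = dirichletForm a κ g f := by
  simp only [dirichletForm, gradDot_comm f g, mul_comm (f _) (g _)]

lemma integrable_gaussian_mul {f : Rd d → ℝ} (hf : Continuous f) {B : ℝ} (hB : ∀ y, |f y| ≤ B) :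
    Integrable fun y : Rd d => Real.exp (-‖y‖ ^ 2 / 4) * f y := by
  have h := integrable_gaussian (d := d) (b := 1 / 4) (by norm_num)
  have e : (fun y : Rd d => Real.exp (-(1 / 4) * ‖y‖ ^ 2)) =
      fun y => Real.exp (-‖y‖ ^ 2 / 4) := by
    ext y; congr 1; ring
  rw [e] at h
  exact h.mul_bdd (c := B) hf.aestronglyMeasurable (Eventually.of_forall hB)

lemma integrableOn_weight_mul {f g : ℝ × Rd d → ℝ} (hf : MemLp f 2 (weightMeasure d a))
    (hg : MemLp g 2 (weightMeasure d a)) :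
    IntegrableOn (fun Y => weight d a Y * (f Y * g Y)) (halfSpace d) :=
  integrable_weightMeasure.1 (hf.integrable_mul hg)

lemma isFiniteMeasure_weightMeasure (ha : -1 < a) : IsFiniteMeasure (weightMeasure d a) := by
  have h : Integrable (fun _ : ℝ × Rd d => (1 : ℝ)) (weightMeasure d a) := by
    refine integrable_weightMeasure.2 ?_
    simpa using integrableOn_weight ha
  exact (integrable_const_iff_isFiniteMeasure one_ne_zero).1 h

lemma continuous_powerNonlinearity (hp : 1 < p) : Continuous fun x : ℝ => |x| ^ (p - 1) * x :=
  (continuous_abs.rpow_const fun _ => Or.inr (by linarith)).mul continuous_id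

lemma integral_sub_sub_add {α : Type*} [MeasurableSpace α] {μ : Measure α}
    {f₁ f₂ f₃ f₄ : α → ℝ} (h₁ : Integrable f₁ μ) (h₂ : Integrable f₂ μ) (h₃ : Integrable f₃ μ)
    (h₄ : Integrable f₄ μ) : ∫ y, (f₁ y - f₂ y - f₃ y + f₄ y) ∂μ =
      ∫ y, f₁ y ∂μ - ∫ y, f₂ y ∂μ - ∫ y, f₃ y ∂μ + ∫ y, f₄ y ∂μ := by
  rw [integral_add (f := fun y => f₁ y - f₂ y - f₃ y) ((h₁.sub h₂).sub h₃) h₄,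
    integral_sub (f := fun y => f₁ y - f₂ y) (h₁.sub h₂) h₃, integral_sub h₁ h₂]

lemma abs_powerNonlinearity_le (hp : 1 < p) {x : ℝ} (hx : |x| ≤ M) :
    |(|x| ^ (p - 1) * x)| ≤ M ^ (p - 1) * M := by
  have hM := (abs_nonneg x).trans hx
  rw [abs_mul, abs_of_nonneg (Real.rpow_nonneg (abs_nonneg x) _)]
  exact mul_le_mul (Real.rpow_le_rpow (abs_nonneg x) hx (by linarith)) hx (abs_nonneg x)
    (Real.rpow_nonneg hM _)

lemma gradDot_sub {f g : ℝ × Rd d → ℝ} {Y : ℝ × Rd d} (hf : DifferentiableAt ℝ f Y)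
    (hg : DifferentiableAt ℝ g Y) : gradDot (f - g) (f - g) Y =
      gradDot f f Y - 2 * gradDot g f Y + gradDot g g Y := by
  simp only [gradDot, fderiv_sub hf hg, sub_apply]
  have e : ∑ i, (fderiv ℝ f Y (eX i) - fderiv ℝ g Y (eX i)) *
      (fderiv ℝ f Y (eX i) - fderiv ℝ g Y (eX i)) =
      ∑ i, fderiv ℝ f Y (eX i) * fderiv ℝ f Y (eX i) -
      2 * ∑ i, fderiv ℝ g Y (eX i) * fderiv ℝ f Y (eX i) +
      ∑ i, fderiv ℝ g Y (eX i) * fderiv ℝ g Y (eX i) := by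
    rw [Finset.mul_sum, ← Finset.sum_sub_distrib, ← Finset.sum_add_distrib]
    exact Finset.sum_congr rfl fun i _ => by ring
  rw [e]
  ring

lemma sq_fderiv_le_gradDot (f : ℝ × Rd d → ℝ) (Y : ℝ × Rd d) :
    fderiv ℝ f Y e₀ ^ 2 ≤ gradDot f f Y := by
  have := Finset.sum_nonneg fun (i : Fin d) (_ : i ∈ Finset.univ) =>
    mul_self_nonneg (fderiv ℝ f Y (eX i))
  rw [gradDot, sq]
  linarith

namespace RescaledFlow

lemma integrable_trace_power (h : RescaledFlow a κ η p M I w wt v) (hp : 1 < p) {t : ℝ}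
    (ht : t ∈ I) : Integrable fun y : Rd d => Real.exp (-‖y‖ ^ 2 / 4) * |v t y| ^ (p + 1) := by
  refine integrable_gaussian_mul (f := fun y => |v t y| ^ (p + 1)) (B := M ^ (p + 1)) ?_ fun y => ?_
  · exact (h.trace_continuous t ht).abs.rpow_const fun _ => Or.inr (by linarith)
  · rw [abs_of_nonneg (by positivity)]
    exact Real.rpow_le_rpow (abs_nonneg _) (h.trace_bounded t ht y) (by linarith)

lemma integrable_trace_pair (h : RescaledFlow a κ η p M I w wt v) (hp : 1 < p) {t r : ℝ}
    (ht : t ∈ I) (hr : r ∈ I) : Integrable fun y : Rd d =>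
      Real.exp (-‖y‖ ^ 2 / 4) * ((|v t y| ^ (p - 1) * v t y) * v r y) := by
  refine integrable_gaussian_mul (f := fun y => (|v t y| ^ (p - 1) * v t y) * v r y)
    (B := M ^ (p - 1) * M * M) ?_ fun y => ?_
  · exact ((continuous_powerNonlinearity hp).comp (h.trace_continuous t ht)).mul
      (h.trace_continuous r hr)
  · have hM := (abs_nonneg _).trans (h.trace_bounded t ht y)
    rw [abs_mul]
    exact mul_le_mul (abs_powerNonlinearity_le hp (h.trace_bounded t ht y))
      (h.trace_bounded r hr y) (abs_nonneg _) (by positivity)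

lemma integrable_trace_sq (h : RescaledFlow a κ η p M I w wt v) {t r : ℝ}
    (ht : t ∈ I) (hr : r ∈ I) : Integrable fun y : Rd d =>
      Real.exp (-‖y‖ ^ 2 / 4) * (v t y - v r y) ^ 2 := by
  refine integrable_gaussian_mul (f := fun y => (v t y - v r y) ^ 2) (B := (2 * M) ^ 2) ?_
    fun y => ?_
  · exact ((h.trace_continuous t ht).sub (h.trace_continuous r hr)).pow 2
  · rw [abs_pow]
    refine pow_le_pow_left₀ (abs_nonneg _) ((abs_sub _ _).trans ?_) 2
    linarith [h.trace_bounded t ht y, h.trace_bounded r hr y]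

lemma integrableOn_gradDot (h : RescaledFlow a κ η p M I w wt v) {t r : ℝ} (ht : t ∈ I)
    (hr : r ∈ I) : IntegrableOn (fun Y => weight d a Y * gradDot (w t) (w r) Y) (halfSpace d) :=
  integrableOn_weight_gradDot ((h.contDiff t ht).of_le (by norm_num))
    ((h.contDiff r hr).of_le (by norm_num)) (h.integrable_grad t ht) (h.integrable_grad r hr)

lemma integrableOn_dirichletForm (h : RescaledFlow a κ η p M I w wt v) {t r : ℝ} (ht : t ∈ I)
    (hr : r ∈ I) : IntegrableOn
      (fun Y => weight d a Y * (gradDot (w t) (w r) Y + κ * (w t Y * w r Y))) (halfSpace d) := by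
  refine ((h.integrableOn_gradDot ht hr).add ((integrableOn_weight_mul (h.memLp t ht)
    (h.memLp r hr)).const_mul κ)).congr (Eventually.of_forall fun Y => ?_)
  simp only [Pi.add_apply]
  ring

/-- The weak formulation of the equation at time `t`, tested with the solution at time `r`. -/
lemma dirichletForm_eq (h : RescaledFlow a κ η p M I w wt v) (ha : -1 < a) (hp : 1 < p)
    {t r : ℝ} (ht : t ∈ I) (hr : r ∈ I) :
    dirichletForm a κ (w t) (w r) =
      t * ⟪L2of (weightMeasure d a) (wt t), L2of (weightMeasure d a) (w r)⟫_ℝ +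
      η * ∫ y, Real.exp (-‖y‖ ^ 2 / 4) * ((|v t y| ^ (p - 1) * v t y) * v r y) := by
  obtain ⟨g, F, -, hFc, -, hFe, -, hF0⟩ := h.boundary t ht
  obtain ⟨g', F', hgc, -, hge, -, hg0, -⟩ := h.boundary r hr
  have := isFiniteMeasure_weightMeasure (d := d) ha
  have hig : MemLp (fun Y => κ * w t Y - t * wt t Y) 2 (weightMeasure d a) :=
    ((h.memLp t ht).const_mul κ).sub ((h.memLp_deriv t ht).const_mul t)
  have hwf := weak_form ha (h.contDiff t ht) ((h.contDiff r hr).of_le (by norm_num))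
    (h.equation t ht) hgc hge hFc hFe (h.bounded r hr)
    (fun y => by rw [hg0]; exact h.trace_bounded r hr y)
    (CF := |η| * (M ^ (p - 1) * M))
    (fun y => by
      rw [hF0, abs_neg, abs_mul]
      exact mul_le_mul_of_nonneg_left (abs_powerNonlinearity_le hp (h.trace_bounded t ht y))
        (abs_nonneg _))
    (integrable_weightMeasure.1 (hig.integrable one_le_two))
    (h.integrable_grad t ht) (h.integrable_grad r hr)
  have e1 : -∫ y : Rd d, Real.exp (-‖y‖ ^ 2 / 4) * F (0, y) * g' (0, y) =
      η * ∫ y, Real.exp (-‖y‖ ^ 2 / 4) * ((|v t y| ^ (p - 1) * v t y) * v r y) := by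
    rw [← integral_neg, ← integral_const_mul]
    congr 1
    ext y
    rw [hF0, hg0]
    ring
  have e2 : ∫ Y in halfSpace d, weight d a Y *
      ((κ * w t Y - t * wt t Y) * w r Y + gradDot (w t) (w r) Y) =
      dirichletForm a κ (w t) (w r) -
        t * ⟪L2of (weightMeasure d a) (wt t), L2of (weightMeasure d a) (w r)⟫_ℝ := by
    rw [inner_L2of (h.memLp_deriv t ht) (h.memLp r hr), integral_weightMeasure,
      ← integral_const_mul, dirichletForm, ← integral_sub (h.integrableOn_dirichletForm ht hr)
      ((integrableOn_weight_mul (h.memLp_deriv t ht) (h.memLp r hr)).const_mul t)]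
    congr 1
    ext Y
    ring
  rw [e1, e2] at hwf
  linarith

lemma differentiableAt (h : RescaledFlow a κ η p M I w wt v) {t : ℝ} (ht : t ∈ I)
    {Y : ℝ × Rd d} (hY : Y ∈ halfSpace d) : DifferentiableAt ℝ (w t) Y :=
  ((h.contDiff t ht).contDiffAt (isOpen_halfSpace.mem_nhds hY)).differentiableAt (by norm_num)

lemma dirichletForm_integrand_sub (h : RescaledFlow a κ η p M I w wt v) {t r : ℝ} (ht : t ∈ I)
    (hr : r ∈ I) {Y : ℝ × Rd d} (hY : Y ∈ halfSpace d) :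
    weight d a Y * (gradDot (w t - w r) (w t - w r) Y + κ * ((w t - w r) Y * (w t - w r) Y)) =
      weight d a Y * (gradDot (w t) (w t) Y + κ * (w t Y * w t Y)) -
      2 * (weight d a Y * (gradDot (w r) (w t) Y + κ * (w r Y * w t Y))) +
      weight d a Y * (gradDot (w r) (w r) Y + κ * (w r Y * w r Y)) := by
  rw [gradDot_sub (h.differentiableAt ht hY) (h.differentiableAt hr hY)]
  simp only [Pi.sub_apply]
  ring

lemma integrableOn_dirichletForm_sub (h : RescaledFlow a κ η p M I w wt v) {t r : ℝ}
    (ht : t ∈ I) (hr : r ∈ I) : IntegrableOn (fun Y => weight d a Y *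
      (gradDot (w t - w r) (w t - w r) Y + κ * ((w t - w r) Y * (w t - w r) Y)))
      (halfSpace d) :=
  (((h.integrableOn_dirichletForm ht ht).sub
    ((h.integrableOn_dirichletForm hr ht).const_mul 2)).add
    (h.integrableOn_dirichletForm hr hr)).congr_fun
    (fun _ hY => (h.dirichletForm_integrand_sub ht hr hY).symm) measurableSet_halfSpace

lemma dirichletForm_sub (h : RescaledFlow a κ η p M I w wt v) {t r : ℝ} (ht : t ∈ I)
    (hr : r ∈ I) :
    dirichletForm a κ (w t - w r) (w t - w r) = dirichletForm a κ (w t) (w t) -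
      2 * dirichletForm a κ (w r) (w t) + dirichletForm a κ (w r) (w r) := by
  have i1 := h.integrableOn_dirichletForm ht ht
  have i2 := (h.integrableOn_dirichletForm hr ht).const_mul 2
  have i3 := h.integrableOn_dirichletForm hr hr
  unfold dirichletForm
  rw [← integral_const_mul, ← integral_sub i1 i2]
  refine Eq.trans ?_ (integral_add (i1.sub i2) i3)
  exact setIntegral_congr_fun measurableSet_halfSpace fun Y hY =>
    h.dirichletForm_integrand_sub ht hr hY

/-- The trace inequality for the increment `w t - w r`: its normal derivative is controlled by the
Dirichlet form since `κ ≥ 0`. The parameter `k` stays free so that the first coefficient can be made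
small. -/
lemma trace_le (h : RescaledFlow a κ η p M I w wt v) (ha : -1 < a) (ha1 : a < 1) (hκ : 0 ≤ κ)
    {k : ℝ} (hk : 0 < k) (hk1 : k ≤ 1) {t r : ℝ} (ht : t ∈ I) (hr : r ∈ I) :
    ∫ y, Real.exp (-‖y‖ ^ 2 / 4) * (v t y - v r y) ^ 2 ≤
      Real.exp (1 / 4) * (2 / (1 - a) * k ^ (1 - a)) *
        (dirichletForm a κ (w t) (w t) - 2 * dirichletForm a κ (w r) (w t) +
          dirichletForm a κ (w r) (w r)) +
      Real.exp (1 / 4) * (2 * (1 + a) * k ^ (-(1 + a))) *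
        ‖L2of (weightMeasure d a) (w t) - L2of (weightMeasure d a) (w r)‖ ^ 2 := by
  obtain ⟨g, F, hgc, hFc, hge, hFe, hg0, -⟩ := h.boundary t ht
  obtain ⟨g', F', hgc', hFc', hge', hFe', hg0', -⟩ := h.boundary r hr
  have hZ : ContDiffOn ℝ 1 (w t - w r) (halfSpace d) :=
    ((h.contDiff t ht).sub (h.contDiff r hr)).of_le (by norm_num)
  have hm : MemLp (w t - w r) 2 (weightMeasure d a) := (h.memLp t ht).sub (h.memLp r hr)
  have hi1 : IntegrableOn (fun Y => weight d a Y * (w t - w r) Y ^ 2) (halfSpace d) :=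
    integrable_weightMeasure.1 hm.integrable_sq
  have hiZ := h.integrableOn_dirichletForm_sub ht hr
  have hle : ∀ Y ∈ halfSpace d, weight d a Y * fderiv ℝ (w t - w r) Y e₀ ^ 2 ≤
      weight d a Y *
        (gradDot (w t - w r) (w t - w r) Y + κ * ((w t - w r) Y * (w t - w r) Y)) :=
    fun Y hY => by
      refine mul_le_mul_of_nonneg_left ?_ (weight_nonneg a hY)
      have := sq_fderiv_le_gradDot (w t - w r) Y
      have := mul_nonneg hκ (mul_self_nonneg ((w t - w r) Y))
      linarith
  have hi2 : IntegrableOn (fun Y => weight d a Y * fderiv ℝ (w t - w r) Y e₀ ^ 2)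
      (halfSpace d) := by
    refine Integrable.mono' hiZ ((measurable_weight a).aestronglyMeasurable.mul
      (((continuousOn_fderiv_apply le_rfl hZ e₀).aestronglyMeasurable
        measurableSet_halfSpace).pow 2)) ?_
    filter_upwards [self_mem_ae_restrict measurableSet_halfSpace] with Y hY
    rw [Real.norm_of_nonneg (mul_nonneg (weight_nonneg a hY) (sq_nonneg _))]
    exact hle Y hY
  have htr := trace_halfSpace ha ha1 hk hk1 hZ (hgc.sub hgc')
    (fun Y hY => by simp only [Pi.sub_apply, hge Y hY, hge' Y hY]) (hFc.sub hFc')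
    (fun Y hY => by
      simp only [Pi.sub_apply, hFe Y hY, hFe' Y hY,
        fderiv_sub (h.differentiableAt ht hY) (h.differentiableAt hr hY), sub_apply]
      ring)
    (by simpa only [Pi.sub_apply, hg0, hg0'] using h.integrable_trace_sq ht hr) hi1 hi2
  simp only [Pi.sub_apply, hg0, hg0'] at htr
  have e1 : ∫ Y in halfSpace d, weight d a Y * (w t Y - w r Y) ^ 2 =
      ‖L2of (weightMeasure d a) (w t) - L2of (weightMeasure d a) (w r)‖ ^ 2 := by
    rw [← L2of_sub (h.memLp t ht) (h.memLp r hr), norm_sq_L2of hm, integral_weightMeasure]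
    rfl
  rw [e1] at htr
  rw [← h.dirichletForm_sub ht hr]
  have e2 := setIntegral_mono_on hi2 hiZ measurableSet_halfSpace hle
  have e3 : 0 ≤ Real.exp (1 / 4) * (2 / (1 - a) * k ^ (1 - a)) := by
    have : 0 < 1 - a := by linarith
    positivity
  have e4 := mul_le_mul_of_nonneg_left e2 e3
  unfold dirichletForm
  linarith

/-- The combination is bilinear in disguise: its integrand is `(f(v_t) - f(v_r)) (v_t - v_r)` for
`f(x) = |x|^{p-1} x`, and `f` is Lipschitz on `[-M, M]`. -/
lemma trace_form_le (h : RescaledFlow a κ η p M I w wt v) (hη : 0 ≤ η) (hp : 1 < p) {t r : ℝ}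
    (ht : t ∈ I) (hr : r ∈ I) {S : ℝ → ℝ → ℝ} (hS : ∀ t r, S t r =
      η * ∫ y : Rd d, Real.exp (-‖y‖ ^ 2 / 4) * ((|v t y| ^ (p - 1) * v t y) * v r y)) :
    |S t t - S t r - S r t + S r r| ≤ η * (p * M ^ (p - 1)) *
      ∫ y, Real.exp (-‖y‖ ^ 2 / 4) * (v t y - v r y) ^ 2 := by
  have i1 := h.integrable_trace_pair hp ht ht
  have i2 := h.integrable_trace_pair hp ht hr
  have i3 := h.integrable_trace_pair hp hr ht
  have i4 := h.integrable_trace_pair hp hr hr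
  have e : S t t - S t r - S r t + S r r = η * ∫ y, (Real.exp (-‖y‖ ^ 2 / 4) *
      ((|v t y| ^ (p - 1) * v t y) * v t y) - Real.exp (-‖y‖ ^ 2 / 4) *
      ((|v t y| ^ (p - 1) * v t y) * v r y) - Real.exp (-‖y‖ ^ 2 / 4) *
      ((|v r y| ^ (p - 1) * v r y) * v t y) + Real.exp (-‖y‖ ^ 2 / 4) *
      ((|v r y| ^ (p - 1) * v r y) * v r y)) := by
    rw [integral_sub_sub_add i1 i2 i3 i4]
    simp only [hS]
    ring
  rw [e, abs_mul, abs_of_nonneg hη, mul_assoc, ← integral_const_mul]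
  refine mul_le_mul_of_nonneg_left ?_ hη
  rw [← Real.norm_eq_abs]
  refine norm_integral_le_of_norm_le ((h.integrable_trace_sq ht hr).const_mul _)
    (Eventually.of_forall fun y => ?_)
  have hl := powerNonlinearity_lipschitz hp (h.trace_bounded t ht y) (h.trace_bounded r hr y)
  rw [Real.norm_eq_abs]
  calc _ = |Real.exp (-‖y‖ ^ 2 / 4) * (((|v t y| ^ (p - 1) * v t y) -
        (|v r y| ^ (p - 1) * v r y)) * (v t y - v r y))| := by congr 1; ring
    _ = Real.exp (-‖y‖ ^ 2 / 4) * (|(|v t y| ^ (p - 1) * v t y) -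
        (|v r y| ^ (p - 1) * v r y)| * |v t y - v r y|) := by
        rw [abs_mul, abs_mul, Real.abs_exp]
    _ ≤ Real.exp (-‖y‖ ^ 2 / 4) * (p * M ^ (p - 1) * |v t y - v r y| * |v t y - v r y|) := by
        gcongr
    _ = _ := by rw [mul_assoc (p * M ^ (p - 1)), abs_mul_abs_self]; ring

/-- The left side is the Gaussian integral of the pointwise error of the trapezoidal rule for `f`
between `v_r` and `v_t`, which is quadratic in `v_t - v_r`. -/
lemma trace_trapezoid_le (h : RescaledFlow a κ η p M I w wt v) (hη : 0 ≤ η) (hp : 1 < p)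
    {t r : ℝ} (ht : t ∈ I) (hr : r ∈ I) {S : ℝ → ℝ → ℝ} (hS : ∀ t r, S t r =
      η * ∫ y : Rd d, Real.exp (-‖y‖ ^ 2 / 4) * ((|v t y| ^ (p - 1) * v t y) * v r y)) :
    |(S t t - S t r + S r t - S r r) / 2 -
      (η / (p + 1) * (∫ y : Rd d, Real.exp (-‖y‖ ^ 2 / 4) * |v t y| ^ (p + 1)) -
        η / (p + 1) * ∫ y : Rd d, Real.exp (-‖y‖ ^ 2 / 4) * |v r y| ^ (p + 1))| ≤
      η * (p * M ^ (p - 1)) * ∫ y, Real.exp (-‖y‖ ^ 2 / 4) * (v t y - v r y) ^ 2 := by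
  have i1 := h.integrable_trace_pair hp ht ht
  have i2 := h.integrable_trace_pair hp ht hr
  have i3 := h.integrable_trace_pair hp hr ht
  have i4 := h.integrable_trace_pair hp hr hr
  have i5 := (h.integrable_trace_power hp ht).div_const (p + 1)
  have i6 := (h.integrable_trace_power hp hr).div_const (p + 1)
  have e : (S t t - S t r + S r t - S r r) / 2 -
      (η / (p + 1) * (∫ y : Rd d, Real.exp (-‖y‖ ^ 2 / 4) * |v t y| ^ (p + 1)) -
        η / (p + 1) * ∫ y : Rd d, Real.exp (-‖y‖ ^ 2 / 4) * |v r y| ^ (p + 1)) =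
      η * ∫ y, ((Real.exp (-‖y‖ ^ 2 / 4) *
      ((|v t y| ^ (p - 1) * v t y) * v t y) - Real.exp (-‖y‖ ^ 2 / 4) *
      ((|v t y| ^ (p - 1) * v t y) * v r y) + Real.exp (-‖y‖ ^ 2 / 4) *
      ((|v r y| ^ (p - 1) * v r y) * v t y) - Real.exp (-‖y‖ ^ 2 / 4) *
      ((|v r y| ^ (p - 1) * v r y) * v r y)) / 2 -
      (Real.exp (-‖y‖ ^ 2 / 4) * |v t y| ^ (p + 1) / (p + 1) -
        Real.exp (-‖y‖ ^ 2 / 4) * |v r y| ^ (p + 1) / (p + 1))) := by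
    have e1 := integral_sub_sub_add i1 i2 i4 i3
    have e2 := integral_sub_sub_add ((((i1.sub i2).sub i4).add i3).div_const 2) i5
      (integrable_zero _ _ _) i6
    simp only [Pi.sub_apply, Pi.add_apply, Pi.zero_apply, integral_div, integral_zero, e1,
      sub_zero] at e2
    simp only [hS]
    refine Eq.trans ?_ (congrArg (η * ·) (e2.symm.trans (integral_congr_ae
      (Eventually.of_forall fun y => by ring))))
    ring
  rw [e, abs_mul, abs_of_nonneg hη, mul_assoc, ← integral_const_mul]
  refine mul_le_mul_of_nonneg_left ?_ hη
  rw [← Real.norm_eq_abs]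
  refine norm_integral_le_of_norm_le ((h.integrable_trace_sq ht hr).const_mul _)
    (Eventually.of_forall fun y => ?_)
  have hl := powerNonlinearity_trapezoid hp (h.trace_bounded t ht y) (h.trace_bounded r hr y)
  rw [Real.norm_eq_abs]
  calc _ = |Real.exp (-‖y‖ ^ 2 / 4) * (((|v t y| ^ (p - 1) * v t y) +
        (|v r y| ^ (p - 1) * v r y)) / 2 * (v t y - v r y) -
        (|v t y| ^ (p + 1) / (p + 1) - |v r y| ^ (p + 1) / (p + 1)))| := by congr 1; ring
    _ ≤ Real.exp (-‖y‖ ^ 2 / 4) * (p * M ^ (p - 1) * (v t y - v r y) ^ 2) := by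
        rw [abs_mul, Real.abs_exp]
        gcongr
    _ = _ := by ring

/-- The energy identity in self-similar variables. -/
theorem hasDerivAt (h : RescaledFlow a κ η p M I w wt v) (ha : -1 < a) (ha1 : a < 1)
    (hκ : 0 ≤ κ) (hη : 0 ≤ η) (hp : 1 < p) (hM : 0 ≤ M) {t₀ : ℝ} (hI : I ∈ 𝓝 t₀)
    (hV : HasDerivAt (fun t => L2of (weightMeasure d a) (w t))
      (L2of (weightMeasure d a) (wt t₀)) t₀)
    (hVt : ContinuousAt (fun t => L2of (weightMeasure d a) (wt t)) t₀) :
    HasDerivAt (fun t => dirichletForm a κ (w t) (w t) / 2 -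
        η / (p + 1) * ∫ y : Rd d, Real.exp (-‖y‖ ^ 2 / 4) * |v t y| ^ (p + 1))
      (t₀ * ∫ Y in halfSpace d, weight d a Y * wt t₀ Y ^ 2) t₀ := by
  have h0 := mem_of_mem_nhds hI
  have hL : 0 ≤ η * (p * M ^ (p - 1)) := by
    have : 0 ≤ p := by linarith
    positivity
  have ha2 : 0 < 1 - a := by linarith
  -- The width `k` of the strip is fixed here, so thin that the boundary term can be absorbed by the
  -- Dirichlet form. This is possible because `k^{1-a} → 0` for `a < 1`.
  obtain ⟨k, hk, hk1, hkL⟩ : ∃ k : ℝ, 0 < k ∧ k ≤ 1 ∧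
      η * (p * M ^ (p - 1)) * (Real.exp (1 / 4) * (2 / (1 - a) * k ^ (1 - a))) ≤ 1 / 2 := by
    have hc : Tendsto (fun k : ℝ => η * (p * M ^ (p - 1)) *
        (Real.exp (1 / 4) * (2 / (1 - a) * k ^ (1 - a)))) (𝓝[>] 0) (𝓝 0) := by
      have h1 := (Real.continuousAt_rpow_const 0 (1 - a) (Or.inr ha2.le)).tendsto
      rw [Real.zero_rpow ha2.ne'] at h1
      have h2 := (((h1.const_mul (2 / (1 - a))).const_mul (Real.exp (1 / 4))).const_mul
        (η * (p * M ^ (p - 1)))).mono_left (nhdsWithin_le_nhds (s := Ioi 0))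
      simpa using h2
    have h3 := hc.eventually_le_const (by norm_num : (0 : ℝ) < 1 / 2)
    have h4 : ∀ᶠ k : ℝ in 𝓝[>] 0, k ≤ 1 :=
      (eventually_le_nhds one_pos).filter_mono nhdsWithin_le_nhds
    obtain ⟨k, ⟨h5, h6⟩, h7⟩ := ((h3.and h4).and self_mem_nhdsWithin).exists
    exact ⟨k, h7, h6, h5⟩
  have key := hasDerivAt_energy (t₀ := t₀) (V := fun t => L2of (weightMeasure d a) (w t))
    (Vt := fun t => L2of (weightMeasure d a) (wt t))
    (β := fun t r => dirichletForm a κ (w t) (w r))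
    (S := fun t r => η * ∫ y : Rd d, Real.exp (-‖y‖ ^ 2 / 4) *
      ((|v t y| ^ (p - 1) * v t y) * v r y))
    (Ψ := fun t => η / (p + 1) * ∫ y : Rd d, Real.exp (-‖y‖ ^ 2 / 4) * |v t y| ^ (p + 1))
    (Q := fun t => ∫ y, Real.exp (-‖y‖ ^ 2 / 4) * (v t y - v t₀ y) ^ 2)
    (δ := Real.exp (1 / 4) * (2 / (1 - a) * k ^ (1 - a)))
    (A := Real.exp (1 / 4) * (2 * (1 + a) * k ^ (-(1 + a))))
    hL (by have : 0 < 1 + a := by linarith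
           positivity) (by positivity) hkL hV hVt
    (Eventually.of_forall fun t => dirichletForm_comm a κ _ _)
    (by filter_upwards [hI] with t ht using h.dirichletForm_eq ha hp ht ht)
    (by filter_upwards [hI] with t ht using h.dirichletForm_eq ha hp ht h0)
    (by filter_upwards [hI] with t ht using h.dirichletForm_eq ha hp h0 ht)
    (by filter_upwards [hI] with t ht using h.trace_form_le hη hp ht h0 fun _ _ => rfl)
    (by filter_upwards [hI] with t ht using h.trace_trapezoid_le hη hp ht h0 fun _ _ => rfl)
    (by filter_upwards [hI] with t ht using h.trace_le ha ha1 hκ hk hk1 ht h0)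
  rw [norm_sq_L2of (h.memLp_deriv t₀ h0), integral_weightMeasure] at key
  exact key

end RescaledFlow

end Flow


/-! ### Integrability and continuity of the energy densities -/

section Densities

variable {s p T TM : ℝ} {u : Rd d → ℝ → ℝ} {U : ℝ × Rd d → ℝ → ℝ} {t : ℝ}

/-- The time-dependent factor of `𝒢_s`. -/
noncomputable def scaledGCoeff (d : ℕ) (s p t : ℝ) : ℝ :=
  t ^ (2 * s / (p - 1) + 1) * (fundConst d s * (1 / t ^ ((d : ℝ) / 2 + 1 - s)))

lemma scaledG_eq (X : ℝ × Rd d) (t : ℝ) :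
    scaledG d s p X t = scaledGCoeff d s p t * Real.exp (-sqNorm X / (4 * t)) := by
  unfold scaledG fundSol scaledGCoeff fundConst
  ring

lemma sqNorm_nonneg (X : ℝ × Rd d) : 0 ≤ sqNorm X := by
  unfold sqNorm; positivity

lemma scaledGCoeff_nonneg (hs0 : 0 < s) (ht : 0 < t) : 0 ≤ scaledGCoeff d s p t := by
  have := fundConst_pos d hs0
  unfold scaledGCoeff
  positivity

lemma scaledG_nonneg (hs0 : 0 < s) (ht : 0 < t) (X : ℝ × Rd d) : 0 ≤ scaledG d s p X t := by
  rw [scaledG_eq]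
  exact mul_nonneg (scaledGCoeff_nonneg hs0 ht) (Real.exp_nonneg _)

lemma abs_scaledG_le (hs0 : 0 < s) (ht : 0 < t) (X : ℝ × Rd d) :
    |scaledG d s p X t| ≤ scaledGCoeff d s p t := by
  rw [abs_of_nonneg (scaledG_nonneg hs0 ht X), scaledG_eq]
  refine mul_le_of_le_one_right (scaledGCoeff_nonneg hs0 ht) (Real.exp_le_one_iff.2 ?_)
  exact div_nonpos_of_nonpos_of_nonneg (neg_nonpos.2 (sqNorm_nonneg X)) (by positivity)

lemma continuousAt_scaledGCoeff (ht : 0 < t) : ContinuousAt (scaledGCoeff d s p) t := by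
  have h := (Real.rpow_pos_of_pos ht ((d : ℝ) / 2 + 1 - s)).ne'
  exact (Real.continuousAt_rpow_const _ _ (Or.inl ht.ne')).mul (continuousAt_const.mul
    (continuousAt_const.div (Real.continuousAt_rpow_const _ _ (Or.inl ht.ne')) h))

lemma continuous_scaledG (t : ℝ) : Continuous fun X : ℝ × Rd d => scaledG d s p X t := by
  simp only [scaledG_eq]
  exact continuous_const.mul (Real.continuous_exp.comp (continuous_sqNorm.neg.div_const _))

lemma continuousAt_scaledG (ht : 0 < t) (X : ℝ × Rd d) :
    ContinuousAt (fun r => scaledG d s p X r) t := by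
  simp only [scaledG_eq]
  refine (continuousAt_scaledGCoeff ht).mul (Real.continuous_exp.continuousAt.comp ?_)
  exact continuousAt_const.div (continuousAt_const.mul continuousAt_id) (by positivity)

lemma integrableOn_mul_scaledG {f : ℝ × Rd d → ℝ} (hs0 : 0 < s) (ht : 0 < t)
    (hf : IntegrableOn f (halfSpace d)) :
    IntegrableOn (fun X => f X * scaledG d s p X t) (halfSpace d) :=
  hf.mul_bdd (c := scaledGCoeff d s p t) (continuous_scaledG t).aestronglyMeasurable
    (Eventually.of_forall fun X => abs_scaledG_le hs0 ht X)

/-- The dissipation is the squared scaling field, which is `L¹`-continuous by hypothesis, times a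
factor that is bounded at each fixed time. -/
lemma dissipationDensity_eq (ht : 0 < t) (X : ℝ × Rd d) : dissipationDensity s p U t X =
    X.1 ^ (1 - 2 * s) * scalingField s p U X t ^ 2 * (scaledG d s p X t * (1 / (4 * t ^ 2))) := by
  have e : dT U X t + euler U X t / (2 * t) + 2 * s / (p - 1) * (U X t / (2 * t)) =
      scalingField s p U X t / (2 * t) := by
    unfold scalingField
    field_simp
    ring
  rw [dissipationDensity, e, div_pow]
  ring

lemma integrableOn_dirichletDensity (hs0 : 0 < s) (hUC : ClassC s p T U) (ht : t ∈ Ioo 0 T) :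
    IntegrableOn (dirichletDensity s p U t) (halfSpace d) := by
  have h := memLp_one_iff_integrable.1 (hUC.grad_L1.1 t ⟨ht.1, ht.2.le⟩)
  refine ((integrableOn_mul_scaledG (p := p) hs0 ht.1 h).div_const 2).congr
    (Eventually.of_forall fun X => ?_)
  simp only [dirichletDensity]
  ring

lemma integrableOn_massDensity (hs0 : 0 < s) (hUC : ClassC s p T U) (ht : t ∈ Ioo 0 T) :
    IntegrableOn (massDensity s p U t) (halfSpace d) := by
  have h := memLp_one_iff_integrable.1 (hUC.sq_L1.1 t ⟨ht.1, ht.2.le⟩)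
  refine ((integrableOn_mul_scaledG (p := p) hs0 ht.1 h).div_const (2 * t)).congr
    (Eventually.of_forall fun X => ?_)
  simp only [massDensity]
  ring

lemma integrableOn_dissipationDensity (hs0 : 0 < s) (hUC : ClassC s p T U) (ht : t ∈ Ioo 0 T) :
    IntegrableOn (dissipationDensity s p U t) (halfSpace d) := by
  have h := memLp_one_iff_integrable.1 (hUC.scaling_L1.1 t ⟨ht.1, ht.2.le⟩)
  refine ((integrableOn_mul_scaledG (p := p) hs0 ht.1 h).mul_const (1 / (4 * t ^ 2))).congr
    (Eventually.of_forall fun X => ?_)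
  simp only [dissipationDensity_eq ht.1]
  ring

/-- The factor `𝒢_s / (4t²)` is continuous in `t` at each point and bounded uniformly in `X` for `t`
near a positive time, so the `L¹` continuity passes to the integral. -/
lemma tendsto_integral_dissipationDensity (hs0 : 0 < s) (hUC : ClassC s p T U)
    (ht : t ∈ Ioo 0 T) : Tendsto (fun r => ∫ X in halfSpace d, dissipationDensity s p U r X)
      (𝓝 t) (𝓝 (∫ X in halfSpace d, dissipationDensity s p U t X)) := by
  have ht0 := ht.1
  have hc : ContinuousAt (fun r => scaledGCoeff d s p r * (1 / (4 * r ^ 2))) t :=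
    (continuousAt_scaledGCoeff ht0).mul (continuousAt_const.div
      (continuousAt_const.mul (continuousAt_id.pow 2)) (by simp [ht0.ne']))
  have h := tendsto_integral_mul_of_continuousInLp hUC.scaling_L1
    (k := fun X r => scaledG d s p X r * (1 / (4 * r ^ 2)))
    (M := scaledGCoeff d s p t * (1 / (4 * t ^ 2)) + 1)
    (mem_of_superset (Ioo_mem_nhds ht0 ht.2) Ioo_subset_Ioc_self)
    (Eventually.of_forall fun r =>
      ((continuous_scaledG r).mul continuous_const).aestronglyMeasurable)
    (by
      filter_upwards [hc.eventually_le_const (lt_add_one _), lt_mem_nhds ht0] with r hr hr0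
      refine Eventually.of_forall fun X => le_trans ?_ hr
      rw [abs_mul, abs_of_nonneg (by positivity : 0 ≤ 1 / (4 * r ^ 2))]
      exact mul_le_mul_of_nonneg_right (abs_scaledG_le hs0 hr0 X) (by positivity))
    (Eventually.of_forall fun X => (continuousAt_scaledG ht0 X).mul (continuousAt_const.div
      (continuousAt_const.mul (continuousAt_id.pow 2)) (by simp [ht0.ne'])))
  simp only [dissipationDensity_eq ht0]
  refine h.congr' ?_
  filter_upwards [lt_mem_nhds ht0] with r hr
  simp only [dissipationDensity_eq hr]

end Densities

/-! ### The profile of `U` as a rescaled flow -/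

section Rescaling

variable {s p T TM : ℝ} {u : Rd d → ℝ → ℝ} {U : ℝ × Rd d → ℝ → ℝ} {t : ℝ}

lemma ClassC.contDiffOn_Ioo (hUC : ClassC s p T U) :
    ContDiffOn ℝ 2 (fun q : (ℝ × Rd d) × ℝ => U q.1 q.2) (halfSpace d ×ˢ Ioo 0 T) :=
  hUC.contDiff.mono (prod_mono subset_rfl Ioo_subset_Ioc_self)

lemma rpow_two_mul_add_one (ht : 0 < t) (κ : ℝ) : t ^ (2 * κ + 1) = (t ^ κ) ^ 2 * t := by
  rw [Real.rpow_add ht, Real.rpow_one, two_mul, Real.rpow_add ht, sq]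

lemma profile_sq (ht : 0 < t) (Y : ℝ × Rd d) :
    t ^ (2 * (s / (p - 1)) + 1) * (U (√t • Y) t ^ 2 / (2 * t)) =
      profile (s / (p - 1)) U t Y ^ 2 / 2 := by
  rw [rpow_two_mul_add_one ht, profile]
  field_simp

lemma profileDeriv_sq (ht : 0 < t) (Y : ℝ × Rd d) :
    t ^ (2 * (s / (p - 1)) + 1) * (dT U (√t • Y) t + euler U (√t • Y) t / (2 * t) +
      2 * s / (p - 1) * (U (√t • Y) t / (2 * t))) ^ 2 = t * profileDeriv s p U t Y ^ 2 := by
  rw [rpow_two_mul_add_one ht, profileDeriv, scalingField, Real.rpow_sub_one ht.ne']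
  field_simp
  ring

lemma gradDot_profile_eq_sqGrad
    (hU : ContDiffOn ℝ 2 (fun q : (ℝ × Rd d) × ℝ => U q.1 q.2) (halfSpace d ×ˢ Ioo 0 T))
    (ht : t ∈ Ioo 0 T) {Y : ℝ × Rd d} (hY : Y ∈ halfSpace d) :
    t ^ (2 * (s / (p - 1)) + 1) * (sqGrad U (√t • Y) t / 2) =
      gradDot (profile (s / (p - 1)) U t) (profile (s / (p - 1)) U t) Y / 2 := by
  rw [gradDot_profile ht.1, sqGrad_eq_gradDot (differentiableAt_slice hU
    (smul_mem_halfSpace (Real.sqrt_pos.2 ht.1) hY) ht)]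
  ring

lemma integral_dissipationDensity (ht : 0 < t) :
    ∫ X in halfSpace d, dissipationDensity s p U t X = fundConst d s *
      (t * ∫ Y in halfSpace d, weight d (1 - 2 * s) Y * profileDeriv s p U t Y ^ 2) := by
  rw [integral_density (s := s) (p := p) (k := dissipationDensity s p U t)
    (h := fun X => (dT U X t + euler U X t / (2 * t) +
    2 * s / (p - 1) * (U X t / (2 * t))) ^ 2) ht fun X => rfl]
  simp only [profileDeriv_sq ht]
  rw [← integral_const_mul t]
  congr 2
  ext Y
  ring

lemma memLp_profileDeriv (hs0 : 0 < s) (hUC : ClassC s p T U) (ht : t ∈ Ioo 0 T) :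
    MemLp (profileDeriv s p U t) 2 (weightMeasure d (1 - 2 * s)) := by
  have hU := hUC.contDiffOn_Ioo
  have hc : ContinuousOn (profileDeriv s p U t) (halfSpace d) :=
    (continuousOn_profileDeriv hU).comp (f := fun Y : ℝ × Rd d => (Y, t)) (by fun_prop)
      fun _ hY => ⟨hY, ht⟩
  refine memLp_weightMeasure hc ?_
  have h := (integrableOn_density (s := s) (p := p)
    (h := fun X => (dT U X t + euler U X t / (2 * t) +
    2 * s / (p - 1) * (U X t / (2 * t))) ^ 2) hs0 ht.1 fun X => rfl).2
    (integrableOn_dissipationDensity hs0 hUC ht)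
  simp only [profileDeriv_sq ht.1] at h
  refine (h.div_const t).congr (Eventually.of_forall fun Y => ?_)
  have := ht.1.ne'
  field_simp

lemma memLp_profile (hs0 : 0 < s) (hUC : ClassC s p T U) (ht : t ∈ Ioo 0 T) :
    MemLp (profile (s / (p - 1)) U t) 2 (weightMeasure d (1 - 2 * s)) := by
  have hU := hUC.contDiffOn_Ioo
  refine memLp_weightMeasure (contDiffOn_profile hU _ ht).continuousOn ?_
  have h := (integrableOn_density (s := s) (p := p)
    (h := fun X => U X t ^ 2 / (2 * t)) hs0 ht.1 fun X => rfl).2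
    (integrableOn_massDensity hs0 hUC ht)
  simp only [profile_sq ht.1] at h
  refine (h.const_mul 2).congr (Eventually.of_forall fun Y => ?_)
  ring

lemma integrableOn_gradDot_profile (hs0 : 0 < s) (hUC : ClassC s p T U) (ht : t ∈ Ioo 0 T) :
    IntegrableOn (fun Y => weight d (1 - 2 * s) Y *
      gradDot (profile (s / (p - 1)) U t) (profile (s / (p - 1)) U t) Y) (halfSpace d) := by
  have hU := hUC.contDiffOn_Ioo
  have h := (integrableOn_density (s := s) (p := p)
    (h := fun X => sqGrad U X t / 2) hs0 ht.1 fun X => rfl).2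
    (integrableOn_dirichletDensity hs0 hUC ht)
  refine (Integrable.const_mul h 2).congr ?_
  filter_upwards [self_mem_ae_restrict measurableSet_halfSpace] with Y hY
  rw [gradDot_profile_eq_sqGrad hU ht hY]
  ring

/-- Pointwise continuity comes from the smoothness of `U`. The squared norm is the dissipation
integral divided by a constant times `t`, hence continuous as well; `tendsto_L2of` combines the two.
-/
lemma continuousAt_L2of_profileDeriv (hs0 : 0 < s) (hUC : ClassC s p T U) (ht : t ∈ Ioo 0 T) :
    ContinuousAt (fun r => L2of (weightMeasure d (1 - 2 * s)) (profileDeriv s p U r)) t := by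
  have hU := hUC.contDiffOn_Ioo
  have hI := Ioo_mem_nhds ht.1 ht.2
  have hc0 := fundConst_pos d hs0
  refine tendsto_L2of ?_ (memLp_profileDeriv hs0 hUC ht) ?_ ?_
  · filter_upwards [hI] with r hr using memLp_profileDeriv hs0 hUC hr
  · filter_upwards [ae_weightMeasure] with Y hY
    exact (((continuousOn_profileDeriv hU).comp (f := fun r : ℝ => (Y, r)) (by fun_prop)
      fun _ hr => ⟨hY, hr⟩).continuousAt hI).tendsto
  · have h1 := tendsto_integral_dissipationDensity hs0 hUC ht
    have h2 := h1.div (continuousAt_const.mul continuousAt_id).tendsto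
      (mul_pos hc0 ht.1).ne'
    have key : ∀ r, 0 < r → ∫ Y, profileDeriv s p U r Y ^ 2 ∂weightMeasure d (1 - 2 * s) =
        (∫ X in halfSpace d, dissipationDensity s p U r X) / (fundConst d s * r) :=
      fun r hr => by
        rw [integral_weightMeasure, integral_dissipationDensity hr]
        field_simp
    rw [key t ht.1]
    refine h2.congr' ?_
    filter_upwards [lt_mem_nhds ht.1] with r hr using (key r hr).symm

lemma hasDerivAt_L2of_profile (hs0 : 0 < s) (hUC : ClassC s p T U) (ht : t ∈ Ioo 0 T) :
    HasDerivAt (fun r => L2of (weightMeasure d (1 - 2 * s)) (profile (s / (p - 1)) U r))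
      (L2of (weightMeasure d (1 - 2 * s)) (profileDeriv s p U t)) t := by
  have hU := hUC.contDiffOn_Ioo
  refine hasDerivAt_L2of (Ioo_mem_nhds ht.1 ht.2) ?_ ?_ ?_
    (fun r hr => memLp_profile hs0 hUC hr) (fun r hr => memLp_profileDeriv hs0 hUC hr)
    (continuousAt_L2of_profileDeriv hs0 hUC ht)
  · filter_upwards [ae_weightMeasure] with Y hY r hr using hasDerivAt_profile hU hY hr
  · filter_upwards [ae_weightMeasure] with Y hY
    exact (continuousOn_profileDeriv hU).comp (f := fun r : ℝ => (Y, r)) (by fun_prop)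
      fun _ hr => ⟨hY, hr⟩
  · have h := (continuousOn_profileDeriv (s := s) (p := p) hU).aestronglyMeasurable
      (μ := volume.prod volume) (measurableSet_halfSpace.prod measurableSet_Ioo)
    rw [← Measure.prod_restrict] at h
    exact h.mono_ac (weightMeasure_ac.prod Measure.AbsolutelyContinuous.rfl)

/-- Rescaling multiplies the flux by `t^κ t^s`, and `t^s = (t^κ)^{p-1}` because `κ(p-1) = s`. This
choice of `κ` keeps the nonlinear boundary condition free of explicit powers of `t`. -/
lemma exists_profile_boundary (hs0 : 0 < s) (hs1 : s < 1) (hp : 1 < p) (hTM : T < TM)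
    (hu : IsBackwardSolution s p TM u) (huB : ClassB s p T u)
    (hU : ∀ X ∈ halfSpace d, ∀ t ∈ Ioo 0 TM, U X t = backwardExtension s u X t)
    (hUC : ClassC s p T U) (ht : t ∈ Ioo 0 T) :
    ∃ g F : ℝ × Rd d → ℝ, ContinuousOn g (closedHalfSpace d) ∧
      ContinuousOn F (closedHalfSpace d) ∧
      (∀ Y ∈ halfSpace d, g Y = profile (s / (p - 1)) U t Y) ∧
      (∀ Y ∈ halfSpace d,
        F Y = Y.1 ^ (1 - 2 * s) * fderiv ℝ (profile (s / (p - 1)) U t) Y e₀) ∧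
      (∀ y, g (0, y) = t ^ (s / (p - 1)) * u (√t • y) t) ∧
      ∀ y, F (0, y) = -(etaConst s * (|t ^ (s / (p - 1)) * u (√t • y) t| ^ (p - 1) *
        (t ^ (s / (p - 1)) * u (√t • y) t))) := by
  obtain ⟨g, F, hgc, hFc, hge, hFe, hg0, hF0⟩ :=
    exists_boundary_extension hs0 hs1 hTM hu huB hU hUC ht
  have ht0 := ht.1
  have hR := Real.sqrt_pos.2 ht0
  have hp1 : p - 1 ≠ 0 := by linarith
  have hm : MapsTo (fun Y : ℝ × Rd d => √t • Y) (closedHalfSpace d) (closedHalfSpace d) :=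
    fun _ hY => smul_mem_closedHalfSpace hR hY
  have hz : ∀ y : Rd d, √t • (((0 : ℝ), y) : ℝ × Rd d) = (0, √t • y) := fun y => by
    ext <;> simp
  refine ⟨fun Y => t ^ (s / (p - 1)) * g (√t • Y),
    fun Y => t ^ (s / (p - 1)) * t ^ s * F (√t • Y),
    continuousOn_const.mul (hgc.comp (by fun_prop) hm),
    continuousOn_const.mul (hFc.comp (by fun_prop) hm), fun Y hY => ?_, fun Y hY => ?_,
    fun y => ?_, fun y => ?_⟩
  · beta_reduce
    rw [hge _ (smul_mem_halfSpace hR hY), profile]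
  · beta_reduce
    have hY0 : 0 ≤ Y.1 := le_of_lt hY
    have e : t ^ s * √t ^ (1 - 2 * s) = √t := by
      rw [Real.sqrt_eq_rpow, ← Real.rpow_mul ht0.le, ← Real.rpow_add ht0]
      congr 1
      ring
    rw [hFe _ (smul_mem_halfSpace hR hY), fderiv_profile, Prod.smul_fst, smul_eq_mul,
      Real.mul_rpow hR.le hY0]
    calc _ = t ^ (s / (p - 1)) * (t ^ s * √t ^ (1 - 2 * s)) * (Y.1 ^ (1 - 2 * s) *
          fderiv ℝ (fun X => U X t) (√t • Y) e₀) := by ring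
      _ = _ := by rw [e]; ring
  · beta_reduce
    rw [hz, hg0]
  · beta_reduce
    have e : (t ^ (s / (p - 1))) ^ (p - 1) = t ^ s := by
      rw [← Real.rpow_mul ht0.le, div_mul_cancel₀ _ hp1]
    rw [hz, hF0, abs_mul, abs_of_nonneg (Real.rpow_nonneg ht0.le _),
      Real.mul_rpow (Real.rpow_nonneg ht0.le _) (abs_nonneg _), e]
    ring

lemma rescaledFlow_profile {C : ℝ} (hs0 : 0 < s) (hs1 : s < 1) (hp : 1 < p) (hTM : T < TM)
    (hu : IsBackwardSolution s p TM u) (huB : ClassB s p T u)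
    (hC : ∀ x t, 0 < t → |u x t| ≤ C)
    (hU : ∀ X ∈ halfSpace d, ∀ t ∈ Ioo 0 TM, U X t = backwardExtension s u X t)
    (hUC : ClassC s p T U) :
    RescaledFlow (1 - 2 * s) (s / (p - 1)) (etaConst s) p (T ^ (s / (p - 1)) * C) (Ioo 0 T)
      (profile (s / (p - 1)) U) (profileDeriv s p U)
      (fun t y => t ^ (s / (p - 1)) * u (√t • y) t) := by
  have hU2 := hUC.contDiffOn_Ioo
  obtain ⟨ε, hε, C', hH⟩ := huB.holder
  have huc := continuousOn_of_holder (by positivity) hH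
  have hκ : 0 ≤ s / (p - 1) := div_nonneg hs0.le (by linarith)
  have hle : ∀ t ∈ Ioo 0 T, ∀ x : ℝ, |x| ≤ C → |t ^ (s / (p - 1)) * x| ≤
      T ^ (s / (p - 1)) * C := fun t ht x hx => by
    rw [abs_mul, abs_of_nonneg (Real.rpow_nonneg ht.1.le _)]
    exact mul_le_mul (Real.rpow_le_rpow ht.1.le ht.2.le hκ) hx (abs_nonneg _)
      (Real.rpow_nonneg (ht.1.trans ht.2).le _)
  refine ⟨fun t ht => contDiffOn_profile hU2 _ ht,
    fun t ht Y hY => profile_equation hU2 hs0 hTM huc hC hU ht hY,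
    fun t ht => exists_profile_boundary hs0 hs1 hp hTM hu huB hU hUC ht,
    fun t ht Y hY => ?_, fun t ht y => hle t ht _ (hC _ _ ht.1), fun t ht => ?_,
    fun t ht => memLp_profile hs0 hUC ht, fun t ht => memLp_profileDeriv hs0 hUC ht,
    fun t ht => integrableOn_gradDot_profile hs0 hUC ht⟩
  · have hX := smul_mem_halfSpace (Real.sqrt_pos.2 ht.1) hY
    refine hle t ht _ ?_
    rw [hU _ hX t ⟨ht.1, ht.2.trans hTM⟩]
    exact abs_backwardExtension_le hs0 hs1 hC hX ht.1
  · exact continuous_const.mul ((continuous_slice huc ht.1).comp (continuous_const_smul _))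

/-- All three terms scale alike. The term with `U²/(2t)` becomes `κ w²/2`, the zeroth-order part of
the quadratic form, which is why that form must carry the coefficient `κ`. -/
lemma energyJ_eq (hs0 : 0 < s) (hp : 1 < p) (hUC : ClassC s p T U) (ht : t ∈ Ioo 0 T) :
    energyJ s p u U t = fundConst d s *
      (dirichletForm (1 - 2 * s) (s / (p - 1)) (profile (s / (p - 1)) U t)
        (profile (s / (p - 1)) U t) / 2 - etaConst s / (p + 1) *
        ∫ y : Rd d, Real.exp (-‖y‖ ^ 2 / 4) * |t ^ (s / (p - 1)) * u (√t • y) t| ^ (p + 1)) := by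
  have hU := hUC.contDiffOn_Ioo
  have i1 := integrableOn_gradDot_profile hs0 hUC ht
  have hm := memLp_profile hs0 hUC ht
  have i2 := (integrableOn_weight_mul hm hm).const_mul (s / (p - 1))
  have e1 : ∫ X in halfSpace d, dirichletDensity s p U t X = fundConst d s *
      ((∫ Y in halfSpace d, weight d (1 - 2 * s) Y *
        gradDot (profile (s / (p - 1)) U t) (profile (s / (p - 1)) U t) Y) / 2) := by
    rw [integral_density (s := s) (p := p) (k := dirichletDensity s p U t)
      (h := fun X => sqGrad U X t / 2) ht.1 fun X => rfl, ← integral_div]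
    congr 1
    refine setIntegral_congr_fun measurableSet_halfSpace fun Y hY => ?_
    beta_reduce
    rw [gradDot_profile_eq_sqGrad hU ht hY]
    ring
  have e2 : s / (p - 1) * ∫ X in halfSpace d, massDensity s p U t X = fundConst d s *
      ((∫ Y in halfSpace d, s / (p - 1) * (weight d (1 - 2 * s) Y *
        (profile (s / (p - 1)) U t Y * profile (s / (p - 1)) U t Y))) / 2) := by
    rw [integral_density (s := s) (p := p) (k := massDensity s p U t)
      (h := fun X => U X t ^ 2 / (2 * t)) ht.1 fun X => rfl, ← integral_div,
      mul_left_comm, ← integral_const_mul]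
    simp only [profile_sq ht.1]
    congr 2
    ext Y
    ring
  have e3 : dirichletForm (1 - 2 * s) (s / (p - 1)) (profile (s / (p - 1)) U t)
      (profile (s / (p - 1)) U t) = (∫ Y in halfSpace d, weight d (1 - 2 * s) Y *
        gradDot (profile (s / (p - 1)) U t) (profile (s / (p - 1)) U t) Y) +
      ∫ Y in halfSpace d, s / (p - 1) * (weight d (1 - 2 * s) Y *
        (profile (s / (p - 1)) U t Y * profile (s / (p - 1)) U t Y)) := by
    rw [← integral_add i1 i2, dirichletForm]
    congr 1
    ext Y
    ring
  rw [energyJ, e1, e2, integral_boundaryDensity hp ht.1, e3]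
  ring

lemma dissipationDensity_nonneg (hs0 : 0 < s) (ht : 0 < t) {X : ℝ × Rd d}
    (hX : X ∈ halfSpace d) : 0 ≤ dissipationDensity s p U t X :=
  mul_nonneg (mul_nonneg (Real.rpow_nonneg (le_of_lt hX) _) (sq_nonneg _))
    (scaledG_nonneg hs0 ht X)

lemma etaConst_nonneg (hs0 : 0 < s) : 0 ≤ etaConst s := by
  have := Real.Gamma_pos_of_pos hs0
  unfold etaConst
  positivity

end Rescaling

end FracHeat

/-! ### The monotonicity formula -/

theorem theorem5p3 (d : ℕ) (hd : 0 < d) (s p T TM : ℝ) (hs0 : 0 < s) (hs1 : s < 1) (hp : 1 < p)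
    (hT : 0 < T) (hTM : T < TM)
    (u : FracHeat.Rd d → ℝ → ℝ) (U : ℝ × FracHeat.Rd d → ℝ → ℝ)
    (hu : FracHeat.IsBackwardSolution s p TM u)
    (huB : FracHeat.ClassB s p T u)
    (hU : ∀ X ∈ FracHeat.halfSpace d, ∀ t ∈ Set.Ioo 0 TM,
      U X t = FracHeat.backwardExtension s u X t)
    (hUC : FracHeat.ClassC s p T U) :
    (∀ t ∈ Set.Ioo 0 T,
      MeasureTheory.IntegrableOn (FracHeat.dirichletDensity s p U t) (FracHeat.halfSpace d) ∧
      MeasureTheory.Integrable (FracHeat.boundaryDensity s p u t) ∧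
      MeasureTheory.IntegrableOn (FracHeat.massDensity s p U t) (FracHeat.halfSpace d) ∧
      MeasureTheory.IntegrableOn (FracHeat.dissipationDensity s p U t) (FracHeat.halfSpace d)) ∧
    MonotoneOn (FracHeat.energyJ s p u U) (Set.Ioo 0 T) ∧
    (∀ t ∈ Set.Ioo 0 T,
      HasDerivAt (FracHeat.energyJ s p u U)
        (∫ X in FracHeat.halfSpace d, FracHeat.dissipationDensity s p U t X) t) := by
  obtain ⟨C, hC⟩ := huB.bounded
  have hC0 : 0 ≤ C := (abs_nonneg _).trans (hC 0 1 one_pos)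
  have hflow := FracHeat.rescaledFlow_profile hs0 hs1 hp hTM hu huB hC hU hUC
  have hκ : 0 ≤ s / (p - 1) := div_nonneg hs0.le (by linarith)
  have hderiv : ∀ t ∈ Set.Ioo 0 T, HasDerivAt (FracHeat.energyJ s p u U)
      (∫ X in FracHeat.halfSpace d, FracHeat.dissipationDensity s p U t X) t := fun t ht => by
    have h := hflow.hasDerivAt (by linarith) (by linarith) hκ (FracHeat.etaConst_nonneg hs0) hp
      (mul_nonneg (Real.rpow_nonneg hT.le _) hC0) (Ioo_mem_nhds ht.1 ht.2)
      (FracHeat.hasDerivAt_L2of_profile hs0 hUC ht)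
      (FracHeat.continuousAt_L2of_profileDeriv hs0 hUC ht)
    rw [FracHeat.integral_dissipationDensity ht.1]
    refine (h.const_mul (FracHeat.fundConst d s)).congr_of_eventuallyEq ?_
    filter_upwards [Ioo_mem_nhds ht.1 ht.2] with r hr
    exact FracHeat.energyJ_eq hs0 hp hUC hr
  refine ⟨fun t ht => ⟨FracHeat.integrableOn_dirichletDensity hs0 hUC ht,
    FracHeat.integrable_boundaryDensity hp ht.1 (hflow.integrable_trace_power hp ht),
    FracHeat.integrableOn_massDensity hs0 hUC ht,
    FracHeat.integrableOn_dissipationDensity hs0 hUC ht⟩, ?_, hderiv⟩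
  refine monotoneOn_of_deriv_nonneg (convex_Ioo 0 T)
    (fun t ht => (hderiv t ht).continuousAt.continuousWithinAt)
    (fun t ht => (hderiv t (interior_subset ht)).differentiableAt.differentiableWithinAt)
    fun t ht => ?_
  have ht' := interior_subset ht
  rw [(hderiv t ht').deriv]
  exact setIntegral_nonneg FracHeat.measurableSet_halfSpace fun X hX =>
    FracHeat.dissipationDensity_nonneg hs0 ht'.1 hX
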